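/- Setting. Let $G=(V,E)$ be a connected undirected graph with $V=\{0,\dots,n-1\}$ and diameter $D$ (hop diameter), with integer edge weights $w:E\to\{0,\dots,W\}$, $W=\mathrm{poly}(n)$, and let $P_{st}$ be a shortest $s$-$t$ path with $h_{st}$ edges. For $e\in P_{st}$, a replacement path for $e$ is a minimum weight simple $s$-$t$ path that does not contain $e$; $h_{rep}$ is the maximum number of edges of a replacement path over all $e\in P_{st}$ ($0$ if there is none). The model is CONGEST on the network $G$: synchronous rounds, in each of which every node may send $O(\log n)$ bits to each neighbour; local computation is free. Initially every node knows $n$, its own identifier, the identifiers of its neighbours, the weights of its incident edges, and the sequence of vertices of $P_{st}$. A routing table at a node has one entry for each edge $e\in P_{st}$; for each $e$ that has a replacement path, the entries at all nodes together describe one replacement path $P_e$ for $e$: the entry of a node on $P_e$ other than $t$ is its next vertex on $P_e$, and all other entries are empty. If $e$ has no replacement path, all entries for $e$ are empty. Theorem. (Weighted graphs.) Given any (possibly randomized) CONGEST algorithm that solves single source shortest paths on connected undirected graphs with polynomially bounded weights in at most $SSSP=SSSP(n,D)$ rounds with failure probability at most $\varepsilon(n)$ on each instance, there is an algorithm for replacement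 paths in undirected weighted graphs with the following properties, which hold simultaneously with failure probability at most $2\varepsilon(n)$ on each instance. 1. Within $O(SSSP+D+h_{st})$ rounds every node knows the weight of a replacement path for every $e\in P_{st}$ ($\infty$ if there is none), and all nodes terminate simultaneously. 2. From the states of the nodes at that time, $O(h_{st}+h_{rep})$ additional rounds suffice to compute routing tables at all nodes. 3. Alternatively, every node may keep only $O(1)$ words of $\Theta(\log n)$ bits from its state at that time, and use only $O(1)$ words of memory afterwards (besides its knowledge of its own identifier and its incident edges). When an edge $e\in P_{st}$ fails, which initially only the end points of $e$ know, and $s$ holds a one-word message, then after at most $h_{st}+3h_{rep}$ rounds of communication on $G-e$ exactly the nodes on some replacement path $P_e$ for $e$ know that they are on it, each of them other than $t$ knows its next vertex on $P_e$, and each of them, including $t$, has received the message. If $e$ has no replacement path, then from that time on no node believes that it is on one. The constants depend only on the exponent in $W=\mathrm{poly}(n)$ and on the constant in the message size of the given SSSP algorithm. (The SSSP algorithm may be applied to weights bounded by a larger polynomial, whose exponent depends only on that of $W$.) (Unweighted graphs.) If all weights are $1$, there is a deterministic algorithm with the same properties, with absolute constants and without any given SSSP algorithm, that takes $O(D)$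 rounds in 1 and $O(D)$ additional rounds in 2; the bounds in 3 are the same. -/

import Mathlib

open scoped ENNReal

/-! ### Weighted undirected graphs: shortest paths and replacement paths -/

namespace RPaths

/-- The total weight of a walk; an undirected weight assignment is a function on unordered pairs,
and only its values on the edges of the graph matter. -/
def weight {n : ℕ} {G : SimpleGraph (Fin n)} (w : Sym2 (Fin n) → ℕ) {s t : Fin n}
    (p : G.Walk s t) : ℕ :=
  (p.edges.map w).sum

/-- `p` is a simple path of minimum weight between its end points. -/
def IsShortestPath {n : ℕ} {G : SimpleGraph (Fin n)} (w : Sym2 (Fin n) → ℕ) {s t : Fin n}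
    (p : G.Walk s t) : Prop :=
  p.IsPath ∧ ∀ q : G.Walk s t, q.IsPath → weight w p ≤ weight w q

/-- `q` is a replacement path for the edge `e`: a simple path of minimum weight among the simple
paths with the same end points that do not contain `e`. -/
def IsReplacementPath {n : ℕ} {G : SimpleGraph (Fin n)} (w : Sym2 (Fin n) → ℕ) {s t : Fin n}
    (e : Sym2 (Fin n)) (q : G.Walk s t) : Prop :=
  q.IsPath ∧ e ∉ q.edges ∧
    ∀ q' : G.Walk s t, q'.IsPath → e ∉ q'.edges → weight w q ≤ weight w q'

/-- The weight of a replacement path for `e` (`⊤` if every `s`-`t` path contains `e`). -/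
noncomputable def replacementWeight {n : ℕ} (G : SimpleGraph (Fin n)) (w : Sym2 (Fin n) → ℕ)
    (s t : Fin n) (e : Sym2 (Fin n)) : ℕ∞ :=
  ⨅ (q : G.Walk s t) (_ : q.IsPath ∧ e ∉ q.edges), (weight w q : ℕ∞)

/-- `h_rep`: the maximum number of edges of a replacement path, over all edges `e` of the input
path and all replacement paths for `e` (`0` if there is none). -/
noncomputable def hRep {n : ℕ} {G : SimpleGraph (Fin n)} (w : Sym2 (Fin n) → ℕ) {s t : Fin n}
    (p : G.Walk s t) : ℕ :=
  sSup {h : ℕ | ∃ e ∈ p.edges, ∃ q : G.Walk s t, IsReplacementPath w e q ∧ q.length = h}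

/-- The supremum in `hRep` is over a bounded set, hence is a maximum when the set is nonempty. -/
theorem bddAbove_hRep {n : ℕ} {G : SimpleGraph (Fin n)} (w : Sym2 (Fin n) → ℕ) {s t : Fin n}
    (p : G.Walk s t) :
    BddAbove {h : ℕ | ∃ e ∈ p.edges, ∃ q : G.Walk s t, IsReplacementPath w e q ∧ q.length = h} := by
  refine ⟨n, ?_⟩
  rintro h ⟨e, -, q, hq, rfl⟩
  have := hq.1.length_lt
  simp only [Fintype.card_fin] at this
  exact this.le

/-- The vertex that follows `x` on a path (`none` if `x` is not on it or is its last vertex). -/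
def nextHop {n : ℕ} {G : SimpleGraph (Fin n)} {s t : Fin n} : G.Walk s t → Fin n → Option (Fin n)
  | .nil, _ => none
  | .cons (u := a) (v := b) _ p, x => if x = a then some b else nextHop p x

/-! ### The CONGEST model -/

/-- The number of bits of a word: enough for a vertex identifier, and `Θ(log n)`. -/
def wordLen (n : ℕ) : ℕ := Nat.log 2 n + 1

/-- A message of `b` words, that is, of `O(log n)` bits. -/
abbrev Msg (n b : ℕ) : Type := BitVec (b * wordLen n)

/-- What a node knows about the network: its identifier, the identifiers of its neighbours and the
weights of the edges to them (`link u = none` if `u` is not a neighbour); also `n`. -/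
structure Local (n : ℕ) where
  id : Fin n
  link : Fin n → Option ℕ

open Classical in
noncomputable def localView {n : ℕ} (G : SimpleGraph (Fin n)) (w : Sym2 (Fin n) → ℕ)
    (v : Fin n) : Local n where
  id := v
  link u := if G.Adj v u then some (w s(v, u)) else none

/-- The code of the nodes in a synchronous round: each node sends at most one message to each
neighbour, then updates its state from the messages received (`inbox u` comes from `u`).
Local computation is unrestricted. -/
structure Protocol (n b : ℕ) (State : Type) where
  send : Local n → State → Fin n → Option (Msg n b)
  recv : Local n → State → (inbox : Fin n → Option (Msg n b)) → State

open Classical in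
/-- The states of the nodes after `r` rounds on the network `N`. -/
noncomputable def Protocol.run {n b : ℕ} {State : Type} (A : Protocol n b State)
    (N : SimpleGraph (Fin n)) (loc : Fin n → Local n) (start : Fin n → State) :
    ℕ → Fin n → State
  | 0 => start
  | r + 1 => fun v => A.recv (loc v) (A.run N loc start r v)
      (fun u => if N.Adj u v then A.send (loc u) (A.run N loc start r u) v else none)

/-- A terminating CONGEST algorithm for `n` nodes. A node with input `In` starts in state `init`;
it has terminated once `out` is defined, and then stays silent and keeps its state. -/
structure CongestAlg (n b : ℕ) (In Out : Type) where
  State : Type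
  init : Local n → In → State
  code : Protocol n b State
  out : Local n → State → Option Out
  silent_of_out : ∀ L σ, out L σ ≠ none → ∀ u, code.send L σ u = none
  stay_of_out : ∀ L σ, out L σ ≠ none → ∀ m, code.recv L σ m = σ

/-- The states after `r` rounds on the weighted graph `(G, w)`, which is also the network. -/
noncomputable def CongestAlg.states {n b : ℕ} {In Out : Type} (A : CongestAlg n b In Out)
    (G : SimpleGraph (Fin n)) (w : Sym2 (Fin n) → ℕ) (inp : Fin n → In) (r : ℕ) :
    Fin n → A.State :=
  A.code.run G (localView G w) (fun v => A.init (localView G w v) (inp v)) r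

/-- The output of node `v`, if it has terminated, after `r` rounds. -/
noncomputable def CongestAlg.output {n b : ℕ} {In Out : Type} (A : CongestAlg n b In Out)
    (G : SimpleGraph (Fin n)) (w : Sym2 (Fin n) → ℕ) (inp : Fin n → In) (r : ℕ) (v : Fin n) :
    Option Out :=
  A.out (localView G w v) (A.states G w inp r v)

/-! ### Single source shortest paths -/

/-- Within `r` rounds all nodes terminate and each outputs its distance from `s`, on the instance
`(G, w, s)` and with the random string `ρ v` at node `v`. All nodes know the identifier of `s`. -/
def ComputesSSSP {n b : ℕ} {S : Type} (A : CongestAlg n b (Fin n × S) ℕ)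
    (G : SimpleGraph (Fin n)) (w : Sym2 (Fin n) → ℕ) (s : Fin n) (ρ : Fin n → S) (r : ℕ) : Prop :=
  ∀ v, ∃ p : G.Walk s v, IsShortestPath w p ∧
    A.output G w (fun u => (s, ρ u)) r v = some (weight w p)

/-- `A` is a (randomized) CONGEST algorithm for SSSP on connected undirected graphs with integer
weights in `{0, …, n ^ k}`: it needs at most `T n D` rounds, where `D` is the diameter, and it
fails with probability at most `ε n` over the random strings `ρ` drawn from `μ n`. -/
def SolvesSSSP (k b : ℕ) (S : ℕ → Type) [∀ n, MeasurableSpace (S n)]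
    (μ : ∀ n, MeasureTheory.Measure (Fin n → S n))
    (A : ∀ n, CongestAlg n b (Fin n × S n) ℕ) (T : ℕ → ℕ → ℕ) (ε : ℕ → ℝ≥0∞) : Prop :=
  ∀ (n : ℕ) (G : SimpleGraph (Fin n)), G.Connected →
    ∀ w : Sym2 (Fin n) → ℕ, (∀ e ∈ G.edgeSet, w e ≤ n ^ k) →
      ∀ s : Fin n, μ n {ρ | ¬ ComputesSSSP (A n) G w s ρ (T n G.diam)} ≤ ε n

/-! ### Replacement paths, routing tables and on-the-fly construction -/

/-- After exactly `τ` rounds all nodes terminate, simultaneously, and every node outputs the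
replacement path weights for the successive edges of the path `p`. -/
def ComputesRPaths {n b : ℕ} {In : Type} (P : CongestAlg n b In (List ℕ∞))
    (G : SimpleGraph (Fin n)) (w : Sym2 (Fin n) → ℕ) {s t : Fin n} (p : G.Walk s t)
    (inp : Fin n → In) (τ : ℕ) : Prop :=
  (∀ v, P.output G w inp τ v = some (p.edges.map (replacementWeight G w s t))) ∧
    ∀ r < τ, ∀ v, P.output G w inp r v = none

/-- `next` gives every node its next vertex on one and the same replacement path for `e`
(`none` for `t`, and for the nodes that are not on that path); if there is no replacement path,
`next` is `none` everywhere. -/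
def RoutesAround {n : ℕ} (G : SimpleGraph (Fin n)) (w : Sym2 (Fin n) → ℕ) (s t : Fin n)
    (e : Sym2 (Fin n)) (next : Fin n → Option (Fin n)) : Prop :=
  (∃ q : G.Walk s t, IsReplacementPath w e q ∧ ∀ v, next v = nextHop q v) ∨
    ((¬ ∃ q : G.Walk s t, IsReplacementPath w e q) ∧ ∀ v, next v = none)

/-- Within `r` rounds all nodes terminate and output correct routing tables for `p`. The table of a
node has one entry for each edge of `p`, in the order of the path. -/
def ComputesTables {n b : ℕ} {In : Type} (K : CongestAlg n b In (List (Option (Fin n))))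
    (G : SimpleGraph (Fin n)) (w : Sym2 (Fin n) → ℕ) {s t : Fin n} (p : G.Walk s t)
    (inp : Fin n → In) (r : ℕ) : Prop :=
  ∃ next : Sym2 (Fin n) → Fin n → Option (Fin n),
    (∀ e ∈ p.edges, RoutesAround G w s t e (next e)) ∧
      ∀ v, K.output G w inp r v = some (p.edges.map fun e => next e v)

/-- On-the-fly construction with `c` words of memory per node. Before any failure a node keeps
nothing of the information `Prior` gathered during preprocessing but the `c` words `store`. When a
failure occurs, `wake` resets the memory, knowing which of its links are down and, at the source,
the one-word message to be sent. The memory never exceeds `c` words during the subsequent rounds.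
`read` is the verdict of a node: `none` if it is not on the replacement path, as far as it
knows, otherwise the message that has reached it and its next vertex on the path. -/
structure OnTheFly (n b c : ℕ) (Prior : Type) where
  store : Local n → Prior → BitVec (c * wordLen n)
  wake : Local n → BitVec (c * wordLen n) → (down : Fin n → Bool) →
    (message : Option (BitVec (wordLen n))) → BitVec (c * wordLen n)
  code : Protocol n b (BitVec (c * wordLen n))
  read : Local n → BitVec (c * wordLen n) → Option (BitVec (wordLen n) × Option (Fin n))

/-- The verdict of node `v`, `r` rounds after the failure of the edge `e`. Only the end points of
`e` learn of the failure by themselves, only `s` knows the message `x`, and the failed link can no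
longer be used for communication. -/
noncomputable def OnTheFly.verdict {n b c : ℕ} {Prior : Type} (R : OnTheFly n b c Prior)
    (G : SimpleGraph (Fin n)) (w : Sym2 (Fin n) → ℕ) (s : Fin n) (prior : Fin n → Prior)
    (e : Sym2 (Fin n)) (x : BitVec (wordLen n)) (r : ℕ) (v : Fin n) :
    Option (BitVec (wordLen n) × Option (Fin n)) :=
  R.read (localView G w v)
    (R.code.run (G.deleteEdges {e}) (localView G w)
      (fun u => R.wake (localView G w u) (R.store (localView G w u) (prior u))
        (fun u' => decide (s(u, u') = e)) (if u = s then some x else none)) r v)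

/-- Whatever edge `e` of `p` fails and whatever the message `x` is, from round `r₀` after the
failure on, exactly the nodes on a replacement path for `e` know that they are on it, each of them
knows its next vertex, and the message has been received all along that path, up to `t`.
If there is no replacement path for `e`, no node believes that it is on one. -/
def ReroutesWithin {n b c : ℕ} {Prior : Type} (R : OnTheFly n b c Prior)
    (G : SimpleGraph (Fin n)) (w : Sym2 (Fin n) → ℕ) {s t : Fin n} (p : G.Walk s t)
    (prior : Fin n → Prior) (r₀ : ℕ) : Prop :=
  ∀ e ∈ p.edges, ∀ x : BitVec (wordLen n),
    (∃ q : G.Walk s t, IsReplacementPath w e q ∧ ∀ r ≥ r₀, ∀ v,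
      R.verdict G w s prior e x r v = if v ∈ q.support then some (x, nextHop q v) else none) ∨
    ((¬ ∃ q : G.Walk s t, IsReplacementPath w e q) ∧ ∀ r ≥ r₀, ∀ v,
      R.verdict G w s prior e x r v = none)

/-- The algorithm `P` computes the replacement path weights for `p` in at most `r₁` rounds, and from
the states in which it leaves the nodes,
* the algorithm `K` computes routing tables in at most `r₂` additional rounds, and
* on-the-fly construction by `R` takes at most `h_st + 3 h_rep` rounds after a failure. -/
def RPathsConstruction {n b c : ℕ} {In : Type} (P : CongestAlg n b In (List ℕ∞))
    (K : CongestAlg n b P.State (List (Option (Fin n)))) (R : OnTheFly n b c P.State)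
    (G : SimpleGraph (Fin n)) (w : Sym2 (Fin n) → ℕ) {s t : Fin n} (p : G.Walk s t)
    (inp : Fin n → In) (r₁ r₂ : ℕ) : Prop :=
  ∃ τ ≤ r₁, ComputesRPaths P G w p inp τ ∧
    ComputesTables K G w p (P.states G w inp τ) r₂ ∧
    ReroutesWithin R G w p (P.states G w inp τ) (p.length + 3 * hRep w p)

end RPaths

/-! Write `P` for the given path, `h` for its number of edges and `e_i` for its edge number `i`. The
weights are perturbed to `n² w(e) + n [e ∉ P] + 1`. A simple path has fewer than `n` edges, so its
perturbed weight, read in base `n`, reveals its weight, its number of edges off `P` and its number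
of edges. All weights become positive and `P` remains shortest (`IsShortestPath.perturb`). Shortest
paths need not be unique, but the distance of `v` from `s` alone determines the number `α(v)` of
edges of `P` on any of them (`onOf`). Such a path can contain `e_i` only if `i < α(v)`
(`lt_onOf_of_edgeAt_mem`). Let `β(v)` be the analogue from `t`. An exchange argument gives `α(v) +
β(v) ≤ h` (`onOf_add_onOf_le`), so one of the two shortest path trees always reaches `v` without
`e_i`.

A walk from `s` to `t` avoiding `e_i` starts with `α = 0 ≤ i` and ends with `α = h > i`. At its
first edge `uv` with `α(u) ≤ i < α(v)` one has `β(v) ≤ h - i - 1`. Replacing the parts before `u`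
and after `v` by tree paths costs nothing and still avoids `e_i` (`exists_isCand_le`). Minimizing
`ds(u) + w'(uv) + dt(v)`, with `w'` the perturbed weight, over the edges that satisfy these two
conditions therefore yields a replacement path of the form tree path, edge, tree path
(`IsCand.isReplacementPath`). The conditions on `uv` can be checked at `u` from its own distance and
that of its neighbour.

The distributed algorithm runs two copies of the SSSP algorithm, from `s` and from `t`, on the
perturbed weights, and detects their termination in a round `τ` along the hop layers around `s`
(`complete_sound`, `complete_live`). Then it computes the `h` minima by pipelining, towards `s` and
back (`IsPrep.up_le`, `IsPrep.down_le`). A minimum carries its edge as a tie breaker (`detourCode`),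
so all nodes select the same detours (`IsPrep.isPlan`).

Routing tables arise when tokens climb both trees from the ends of each bypass edge, delayed by the
edge number so that they never collide (`routesAround_entry`). After a failure, the near end of the
failed edge floods the bypass edge, a token climbs from `u` to `s`, and the message follows the
detour; each of these takes at most `h_rep` rounds, apart from at most `h` rounds in which the flood
reaches `s` (`rerouteRun_active_live`). In unweighted graphs breadth first search replaces the SSSP
algorithm, since the perturbation only chooses among hop-shortest paths (`bfs_states`). -/

namespace RPaths

/-! ### Weights of walks -/

section Weight

variable {n : ℕ} {G : SimpleGraph (Fin n)} {w : Sym2 (Fin n) → ℕ}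

@[simp] lemma weight_nil {s : Fin n} : weight w (.nil : G.Walk s s) = 0 := rfl

@[simp] lemma weight_cons {r s t : Fin n} (h : G.Adj r s) (p : G.Walk s t) :
    weight w (.cons h p) = w s(r, s) + weight w p := by
  simp [weight]

@[simp] lemma weight_append {r s t : Fin n} (p : G.Walk r s) (q : G.Walk s t) :
    weight w (p.append q) = weight w p + weight w q := by
  simp [weight]

@[simp] lemma weight_reverse {s t : Fin n} (p : G.Walk s t) :
    weight w p.reverse = weight w p := by
  simp [weight, List.sum_reverse]

lemma weight_bypass_le {s t : Fin n} (p : G.Walk s t) : weight w p.bypass ≤ weight w p :=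
  ((p.edges_bypass_sublist_edges).map w).sum_le_sum (by simp)

lemma IsShortestPath.le_weight {s t : Fin n} {p : G.Walk s t} (hp : IsShortestPath w p)
    (q : G.Walk s t) : weight w p ≤ weight w q :=
  (hp.2 _ q.bypass_isPath).trans (weight_bypass_le q)

lemma IsShortestPath.reverse {s t : Fin n} {p : G.Walk s t} (hp : IsShortestPath w p) :
    IsShortestPath w p.reverse := by
  refine ⟨hp.1.reverse, fun q hq => ?_⟩
  simpa using hp.2 q.reverse hq.reverse

lemma isShortestPath_of_append_left {r s t : Fin n} {p : G.Walk r s} {q : G.Walk s t}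
    (h : IsShortestPath w (p.append q)) : IsShortestPath w p := by
  refine ⟨h.1.of_append_left, fun p' _ => ?_⟩
  have := h.le_weight (p'.append q)
  simp only [weight_append] at this
  omega

lemma sum_map_lt_of_sublist {α : Type*} {f : α → ℕ} (hf : ∀ a, 0 < f a) {l₁ l₂ : List α}
    (h : l₁.Sublist l₂) (hl : l₁.length < l₂.length) : (l₁.map f).sum < (l₂.map f).sum := by
  induction h with
  | slnil => simp at hl
  | @cons l₁ l₂ a h _ =>
    have := (h.map f).sum_le_sum (by simp)
    have := hf a
    simp only [List.map_cons, List.sum_cons]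
    omega
  | @cons_cons l₁ l₂ a h ih =>
    simp only [List.length_cons, List.map_cons, List.sum_cons] at hl ⊢
    have := ih (by omega)
    omega

/-- With positive weights, cutting a cycle out of a walk strictly lowers its weight. Minimum weight
walks are thus automatically simple, which is how detours glued from tree paths are seen to be
paths. -/
lemma isPath_of_weight_le_bypass (hw : ∀ e, 0 < w e) {s t : Fin n} {p : G.Walk s t}
    (h : weight w p ≤ weight w p.bypass) : p.IsPath := by
  have hlen : p.length ≤ p.bypass.length := by
    by_contra! hlt
    have := sum_map_lt_of_sublist hw p.edges_bypass_sublist_edges (by simpa using hlt)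
    exact absurd h (by simpa [weight] using this)
  rw [← p.bypass_eq_self_of_length_le_length_bypass hlen]
  exact p.bypass_isPath

lemma isShortestPath_of_le (hw : ∀ e, 0 < w e) {s t : Fin n} {p : G.Walk s t}
    (h : ∀ q : G.Walk s t, weight w p ≤ weight w q) : IsShortestPath w p :=
  ⟨isPath_of_weight_le_bypass hw (h _), fun q _ => h q⟩

/-- `d` is the distance from `s` with respect to `w`. -/
def IsDist (G : SimpleGraph (Fin n)) (w : Sym2 (Fin n) → ℕ) (s : Fin n) (d : Fin n → ℕ) : Prop :=
  ∀ v, ∃ p : G.Walk s v, IsShortestPath w p ∧ weight w p = d v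

namespace IsDist

variable {s : Fin n} {d : Fin n → ℕ}

lemma le_weight (hd : IsDist G w s d) {v : Fin n} (q : G.Walk s v) : d v ≤ weight w q := by
  obtain ⟨p, hp, h⟩ := hd v
  exact h ▸ hp.le_weight q

lemma eq_weight (hd : IsDist G w s d) {v : Fin n} {q : G.Walk s v} (hq : IsShortestPath w q) :
    weight w q = d v := by
  obtain ⟨p, hp, h⟩ := hd v
  exact le_antisymm (h ▸ hq.le_weight p) (hd.le_weight q)

lemma isShortestPath (hd : IsDist G w s d) (hw : ∀ e, 0 < w e) {v : Fin n} {q : G.Walk s v}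
    (hq : weight w q ≤ d v) : IsShortestPath w q :=
  isShortestPath_of_le hw fun _ => hq.trans (hd.le_weight _)

lemma source (hd : IsDist G w s d) : d s = 0 := by
  simpa using hd.le_weight (.nil : G.Walk s s)

lemma le_add_weight (hd : IsDist G w s d) {u v : Fin n} (q : G.Walk u v) :
    d v ≤ d u + weight w q := by
  obtain ⟨p, -, h⟩ := hd u
  simpa [h] using hd.le_weight (p.append q)

lemma le_add (hd : IsDist G w s d) {u v : Fin n} (h : G.Adj u v) : d v ≤ d u + w s(u, v) := by
  simpa using hd.le_add_weight (SimpleGraph.Walk.cons h .nil)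

lemma exists_pred (hd : IsDist G w s d) {v : Fin n} (hv : v ≠ s) :
    ∃ u, G.Adj v u ∧ d u + w s(v, u) = d v := by
  obtain ⟨p, hp, h⟩ := hd v
  -- Reversing the path exposes its last edge to case analysis.
  rw [← SimpleGraph.Walk.reverse_reverse p] at hp h
  generalize p.reverse = p' at hp h
  cases p' with
  | nil => exact absurd rfl hv
  | @cons _ u _ huv q =>
    refine ⟨u, huv, ?_⟩
    have hq := (hd.eq_weight (q := q.reverse) (by
      rw [SimpleGraph.Walk.reverse_cons] at hp
      exact isShortestPath_of_append_left hp))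
    simp only [weight_reverse, weight_cons] at hq h
    omega

end IsDist

end Weight

/-! ### The perturbed weights -/

section Perturb

variable {n : ℕ} {G : SimpleGraph (Fin n)} {w : Sym2 (Fin n) → ℕ}

open Classical in
/-- The weights perturbed in favour of the edges in `E`, and of few edges among ties. -/
noncomputable def perturb (w : Sym2 (Fin n) → ℕ) (E : List (Sym2 (Fin n))) (e : Sym2 (Fin n)) : ℕ :=
  n ^ 2 * w e + n * (if e ∈ E then 0 else 1) + 1

open Classical in
/-- The number of edges of a walk that are not in `E`. -/
noncomputable def offCount (E : List (Sym2 (Fin n))) {s t : Fin n} (q : G.Walk s t) : ℕ :=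
  q.edges.countP (fun e => e ∉ E)

open Classical in
/-- The number of edges of a walk that are in `E`. -/
noncomputable def onCount (E : List (Sym2 (Fin n))) {s t : Fin n} (q : G.Walk s t) : ℕ :=
  q.edges.countP (fun e => e ∈ E)

lemma onCount_add_offCount (E : List (Sym2 (Fin n))) {s t : Fin n} (q : G.Walk s t) :
    onCount E q + offCount E q = q.length := by
  classical
  rw [← q.length_edges, List.length_eq_countP_add_countP (fun e => decide (e ∈ E))]
  simp [onCount, offCount]

lemma perturb_pos (w : Sym2 (Fin n) → ℕ) (E : List (Sym2 (Fin n))) (e : Sym2 (Fin n)) :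
    0 < perturb w E e := Nat.succ_pos _

lemma perturb_congr {E E' : List (Sym2 (Fin n))} (h : ∀ e, e ∈ E ↔ e ∈ E') :
    perturb w E = perturb w E' := by
  funext e; simp [perturb, h]

lemma weight_perturb (E : List (Sym2 (Fin n))) {s t : Fin n} (q : G.Walk s t) :
    weight (perturb w E) q = n ^ 2 * weight w q + n * offCount E q + q.length := by
  classical
  induction q with
  | nil => simp [offCount]
  | @cons a b c h q ih =>
    rw [weight_cons, ih, weight_cons, perturb, SimpleGraph.Walk.length_cons]
    have : offCount E (SimpleGraph.Walk.cons h q)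
        = (if s(a, b) ∈ E then 0 else 1) + offCount E q := by
      unfold offCount
      rw [SimpleGraph.Walk.edges_cons, List.countP_cons, add_comm]
      simp
    rw [this]; ring

/-- The number of edges of a path, read off from its perturbed weight. -/
def hopOf (n x : ℕ) : ℕ := x % n

/-- The number of favoured edges of a path, read off from its perturbed weight. -/
def onOf (n x : ℕ) : ℕ := x % n - x / n % n

/-- The lower two summands are digits in base `n`, and no carry occurs. -/
lemma decode {W o l : ℕ} (ho : o < n) (hl : l < n) :
    (n ^ 2 * W + n * o + l) % n = l ∧ (n ^ 2 * W + n * o + l) / n % n = o ∧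
      (n ^ 2 * W + n * o + l) / n ^ 2 = W := by
  have hn : 0 < n := by omega
  have h1 : n ^ 2 * W + n * o + l = l + n * (o + n * W) := by ring
  have h2 : (n ^ 2 * W + n * o + l) / n = o + n * W := by
    rw [h1, Nat.add_mul_div_left _ _ hn, Nat.div_eq_of_lt hl, zero_add]
  refine ⟨?_, ?_, ?_⟩
  · rw [h1, Nat.add_mul_mod_self_left, Nat.mod_eq_of_lt hl]
  · rw [h2, Nat.add_mul_mod_self_left, Nat.mod_eq_of_lt ho]
  · rw [pow_two n, ← Nat.div_div_eq_div_mul, ← pow_two, h2, Nat.add_mul_div_left _ _ hn,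
      Nat.div_eq_of_lt ho, zero_add]

lemma decode_weight (E : List (Sym2 (Fin n))) {s t : Fin n} {q : G.Walk s t} (hq : q.IsPath) :
    hopOf n (weight (perturb w E) q) = q.length ∧ onOf n (weight (perturb w E) q) = onCount E q ∧
      weight (perturb w E) q / n ^ 2 = weight w q := by
  have hl : q.length < n := by simpa using hq.length_lt
  have hc := onCount_add_offCount E q
  obtain ⟨h1, h2, h3⟩ := decode (n := n) (W := weight w q) (o := offCount E q) (l := q.length)
    (by omega) hl
  rw [weight_perturb, hopOf, onOf, h1, h2, h3]
  exact ⟨rfl, by omega, rfl⟩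

/-- The perturbation only breaks ties: the original weight is the leading part of the perturbed one.
-/
lemma weight_le_of_perturb_le (E : List (Sym2 (Fin n))) {s t : Fin n} {q q' : G.Walk s t}
    (hq : q.IsPath) (hq' : q'.IsPath)
    (h : weight (perturb w E) q ≤ weight (perturb w E) q') : weight w q ≤ weight w q' := by
  rw [← (decode_weight E hq).2.2, ← (decode_weight (w := w) E hq').2.2]
  exact Nat.div_le_div_right h

lemma isShortestPath_of_perturb (E : List (Sym2 (Fin n))) {s t : Fin n} {q : G.Walk s t}
    (hq : IsShortestPath (perturb w E) q) : IsShortestPath w q :=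
  ⟨hq.1, fun q' hq' => weight_le_of_perturb_le E hq.1 hq' (hq.2 q' hq')⟩

end Perturb

end RPaths

namespace RPaths

/-! ### The edges and the vertices of a path -/

section EdgeAt

variable {n : ℕ} {G : SimpleGraph (Fin n)} {s t : Fin n}

/-- The edge number `i` of a walk. -/
def edgeAt (p : G.Walk s t) (i : ℕ) : Sym2 (Fin n) := s(p.getVert i, p.getVert (i + 1))

lemma edges_eq_map_edgeAt (p : G.Walk s t) : p.edges = (List.range p.length).map (edgeAt p) := by
  refine List.ext_getElem (by simp) fun i h1 h2 => ?_
  have h : i < p.darts.length := by simpa using h1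
  have := p.darts_getElem_eq_getVert i h
  simp [SimpleGraph.Walk.edges, edgeAt, this]

lemma mem_edges_iff (p : G.Walk s t) {e : Sym2 (Fin n)} :
    e ∈ p.edges ↔ ∃ i < p.length, e = edgeAt p i := by
  rw [edges_eq_map_edgeAt]
  simp [eq_comm]

lemma onCount_self (p : G.Walk s t) : onCount p.edges p = p.length := by
  classical
  rw [← p.length_edges, onCount, List.countP_eq_length]
  simp

lemma onCount_eq_length {E : List (Sym2 (Fin n))} {p : G.Walk s t} (h : ∀ e ∈ p.edges, e ∈ E) :
    onCount E p = p.length := by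
  classical
  rw [← p.length_edges, onCount, List.countP_eq_length]
  simpa using h

@[simp] lemma onCount_append (E : List (Sym2 (Fin n))) {r s t : Fin n} (p : G.Walk r s)
    (q : G.Walk s t) : onCount E (p.append q) = onCount E p + onCount E q := by
  simp [onCount, List.countP_append]

/-- Each edge of a walk inside `p` changes the position on `p` by one, so the position advances by
at most the length of the walk. -/
lemma exists_getVert_of_edges_subset {p : G.Walk s t} (hp : p.IsPath) {u v : Fin n}
    (q : G.Walk u v) (hq : ∀ e ∈ q.edges, e ∈ p.edges) {i : ℕ} (hi : i ≤ p.length)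
    (hu : p.getVert i = u) : ∃ j ≤ p.length, p.getVert j = v ∧ j ≤ i + q.length := by
  induction q generalizing i with
  | nil => exact ⟨i, hi, hu, by simp⟩
  | @cons a b c h q ih =>
    obtain ⟨k, hk, he⟩ := (mem_edges_iff p).1 (hq s(a, b) (by simp))
    have hinj := hp.getVert_injOn
    have key : ∃ i' ≤ p.length, p.getVert i' = b ∧ i' ≤ i + 1 := by
      rw [edgeAt, Sym2.eq_iff] at he
      rcases he with ⟨h1, h2⟩ | ⟨h1, h2⟩
      · have : i = k := hinj (by simpa using hi) (by simpa using hk.le) (hu.trans h1)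
        exact ⟨k + 1, hk, h2.symm, by omega⟩
      · have : i = k + 1 := hinj (by simpa using hi) (by simpa using hk) (hu.trans h1)
        exact ⟨k, hk.le, h2.symm, by omega⟩
    obtain ⟨i', hi', hb, hle⟩ := key
    obtain ⟨j, hj, hv, hjl⟩ := ih (fun e he => hq e (by simp [he])) hi' hb
    exact ⟨j, hj, hv, by simp only [SimpleGraph.Walk.length_cons]; omega⟩

/-- A competitor of equal weight either leaves `p`, which costs at least `n` and exceeds the hop
count of `p`, or stays inside `p` and then needs at least as many edges. -/
lemma IsShortestPath.perturb {w : Sym2 (Fin n) → ℕ} {p : G.Walk s t} (hp : IsShortestPath w p) :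
    IsShortestPath (perturb w p.edges) p := by
  refine ⟨hp.1, fun q hq => ?_⟩
  have hpl : p.length < n := by simpa using hp.1.length_lt
  have h1 := onCount_add_offCount p.edges p
  have h2 := onCount_add_offCount p.edges q
  rw [onCount_self] at h1
  have hoff : offCount p.edges p = 0 := by omega
  have hw := hp.2 q hq
  rw [weight_perturb, weight_perturb, hoff]
  rcases Nat.eq_zero_or_pos (offCount p.edges q) with h0 | h0
  · have hsub : ∀ e ∈ q.edges, e ∈ p.edges := by
      classical
      simpa [offCount, List.countP_eq_zero] using h0
    obtain ⟨j, hj, hjt, hjl⟩ := exists_getVert_of_edges_subset hp.1 q hsub (Nat.zero_le _)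
      p.getVert_zero
    have := (hp.1.getVert_eq_end_iff hj).1 hjt
    have := Nat.mul_le_mul_left (n ^ 2) hw
    omega
  · have := Nat.mul_le_mul_left (n ^ 2) hw
    have := Nat.mul_le_mul_left n h0
    omega

end EdgeAt

/-! ### Distances from one end of a shortest path -/

section OneSide

variable {n : ℕ} {G : SimpleGraph (Fin n)} {s t : Fin n} {w : Sym2 (Fin n) → ℕ} {p : G.Walk s t}
  {d : Fin n → ℕ}

lemma dist_getVert (hp : IsShortestPath w p) (hd : IsDist G (perturb w p.edges) s d) {j : ℕ} :
    weight (perturb w p.edges) (p.take j) = d (p.getVert j) := by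
  refine hd.eq_weight (isShortestPath_of_append_left (q := p.drop j) ?_)
  rw [SimpleGraph.Walk.append_take_drop_eq]
  exact hp.perturb

lemma dist_getVert_succ (hp : IsShortestPath w p) (hd : IsDist G (perturb w p.edges) s d) {i : ℕ}
    (hi : i < p.length) :
    d (p.getVert (i + 1)) = d (p.getVert i) + perturb w p.edges (edgeAt p i) := by
  rw [← dist_getVert hp hd, ← dist_getVert hp hd]
  simp only [weight, SimpleGraph.Walk.edges_take]
  rw [List.take_add_one, List.map_append, List.sum_append]
  have : p.edges[i]? = some (edgeAt p i) := by simp [edges_eq_map_edgeAt, hi]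
  simp [this]

lemma dist_getVert_lt (hp : IsShortestPath w p) (hd : IsDist G (perturb w p.edges) s d) {i j : ℕ}
    (hij : i < j) (hj : j ≤ p.length) : d (p.getVert i) < d (p.getVert j) := by
  induction j, hij using Nat.le_induction with
  | base =>
    rw [dist_getVert_succ hp hd (by omega)]
    have := perturb_pos w p.edges (edgeAt p i)
    omega
  | succ j hij ih =>
    have := ih (by omega)
    rw [dist_getVert_succ hp hd (by omega)]
    omega

/-- The initial part of `p` up to this vertex is a shortest path all of whose edges are favoured. -/
lemma onOf_dist_getVert (hp : IsShortestPath w p) (hd : IsDist G (perturb w p.edges) s d) {j : ℕ}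
    (hj : j ≤ p.length) : onOf n (d (p.getVert j)) = j := by
  rw [← dist_getVert hp hd, (decode_weight _ (hp.1.take j)).2.1, onCount_eq_length]
  · simpa using hj
  · intro e he
    rw [SimpleGraph.Walk.edges_take] at he
    exact List.mem_of_mem_take he

lemma onOf_eq_onCount (hd : IsDist G (perturb w p.edges) s d) {v : Fin n} {q : G.Walk s v}
    (hq : IsShortestPath (perturb w p.edges) q) : onOf n (d v) = onCount p.edges q := by
  rw [← hd.eq_weight hq, (decode_weight _ hq.1).2.1]

/-- A shortest path to `v` leaves `p` for good at the vertex whose number is `onOf n (d v)`. -/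
lemma exists_branch (hp : IsShortestPath w p) (hd : IsDist G (perturb w p.edges) s d)
    (v : Fin n) : onOf n (d v) ≤ p.length ∧ ∃ q : G.Walk (p.getVert (onOf n (d v))) v,
      d v = d (p.getVert (onOf n (d v))) + weight (perturb w p.edges) q := by
  induction h : d v using Nat.strong_induction_on generalizing v with
  | _ x ih =>
  subst h
  by_cases hv : v ∈ p.support
  · obtain ⟨j, rfl, hj⟩ := SimpleGraph.Walk.mem_support_iff_exists_getVert.1 hv
    have h1 := onOf_dist_getVert hp hd hj
    -- The start vertex of the walk depends on `onOf`, so the equation `h1` can only be substituted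
    -- after generalizing.
    have key : ∀ a, a = j → ∃ q : G.Walk (p.getVert a) (p.getVert j),
        d (p.getVert j) = d (p.getVert a) + weight (perturb w p.edges) q := by
      rintro _ rfl
      exact ⟨.nil, by simp⟩
    exact ⟨h1.le.trans hj, key _ h1⟩
  · have hvs : v ≠ s := fun h => hv (h ▸ p.start_mem_support)
    obtain ⟨u, huv, hu⟩ := hd.exists_pred hvs
    have hpos := perturb_pos w p.edges s(v, u)
    obtain ⟨h1, q, hq⟩ := ih (d u) (by omega) u rfl
    obtain ⟨q0, hq0, hq0w⟩ := hd u
    have hcw : weight (perturb w p.edges) (q0.append (.cons huv.symm .nil)) = d v := by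
      simp only [weight_append, weight_cons, weight_nil, hq0w, Sym2.eq_swap (a := u)]
      omega
    have hsp := hd.isShortestPath (perturb_pos w _) hcw.le
    -- As `v` is not on `p`, the last edge is not in `p` and contributes nothing to the count.
    have hon : onOf n (d v) = onOf n (d u) := by
      rw [onOf_eq_onCount hd hsp, onOf_eq_onCount hd hq0, onCount_append]
      have : s(u, v) ∉ p.edges := fun h => hv (p.snd_mem_support_of_mem_edges h)
      simp [onCount, this]
    rw [hon]
    refine ⟨h1, q.append (.cons huv.symm .nil), ?_⟩
    simp only [weight_append, weight_cons, weight_nil, Sym2.eq_swap (a := u)]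
    omega

/-- The path passes through vertex number `i + 1` of `p`, and its initial part up to there, being
shortest, already contains `i + 1` edges of `p`. -/
lemma lt_onOf_of_edgeAt_mem (hp : IsShortestPath w p) (hd : IsDist G (perturb w p.edges) s d)
    {v : Fin n} {q : G.Walk s v} (hq : IsShortestPath (perturb w p.edges) q) {i : ℕ}
    (hi : i < p.length) (he : edgeAt p i ∈ q.edges) : i < onOf n (d v) := by
  have hv : p.getVert (i + 1) ∈ q.support := q.snd_mem_support_of_mem_edges he
  have hsp : IsShortestPath (perturb w p.edges) (q.takeUntil _ hv) := by
    refine isShortestPath_of_append_left (q := q.dropUntil _ hv) ?_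
    rwa [SimpleGraph.Walk.take_spec]
  have h1 := onOf_dist_getVert hp hd (j := i + 1) hi
  have h2 : onCount p.edges q
      = onCount p.edges (q.takeUntil _ hv) + onCount p.edges (q.dropUntil _ hv) := by
    rw [← onCount_append, SimpleGraph.Walk.take_spec]
  rw [onOf_eq_onCount hd hsp] at h1
  rw [onOf_eq_onCount hd hq]
  omega

end OneSide

/-! ### Detours -/

section Detour

variable {n : ℕ} {G : SimpleGraph (Fin n)} {s t : Fin n} {w : Sym2 (Fin n) → ℕ} {p : G.Walk s t}
  {ds dt : Fin n → ℕ}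

lemma perturb_edges_reverse (p : G.Walk s t) : perturb w p.reverse.edges = perturb w p.edges :=
  perturb_congr fun e => by simp

lemma edgeAt_reverse (p : G.Walk s t) {i : ℕ} (hi : i < p.length) :
    edgeAt p.reverse (p.length - 1 - i) = edgeAt p i := by
  simp only [edgeAt, SimpleGraph.Walk.getVert_reverse]
  rw [Sym2.eq_swap]
  congr 2 <;> omega

/-- Exchange argument. Suppose the branch from `s` left `p` strictly closer to `t` than the branch
from `t` does. Swapping the two branches would shorten the initial segments on `p` for both ends, so
the two triangle inequalities would add up to a contradiction. -/
lemma onOf_add_onOf_le (hp : IsShortestPath w p) (hs : IsDist G (perturb w p.edges) s ds)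
    (ht : IsDist G (perturb w p.edges) t dt) (v : Fin n) :
    onOf n (ds v) + onOf n (dt v) ≤ p.length := by
  have ht' : IsDist G (perturb w p.reverse.edges) t dt := by rwa [perturb_edges_reverse]
  obtain ⟨ha, q, hq⟩ := exists_branch hp hs v
  obtain ⟨hc, q', hq'⟩ := exists_branch hp.reverse ht' v
  have htri := hs.le_add_weight (q'.copy (p.getVert_reverse _) rfl)
  have htri' := ht.le_add_weight q
  have hcopy : ∀ {u u' : Fin n} (h : u = u') (q : G.Walk u v),
      weight (perturb w p.edges) (q.copy h rfl) = weight (perturb w p.edges) q := by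
    rintro u _ rfl q; rfl
  rw [hcopy] at htri
  rw [perturb_edges_reverse] at hq'
  by_contra! hlt
  rw [SimpleGraph.Walk.length_reverse] at hc
  have h1 := dist_getVert_lt hp hs (i := p.length - onOf n (dt v)) (j := onOf n (ds v))
    (by omega) ha
  have h2 := dist_getVert_lt hp.reverse ht' (i := p.length - onOf n (ds v)) (j := onOf n (dt v))
    (by omega) (by simpa using hc)
  have h3 : p.length - (p.length - onOf n (ds v)) = onOf n (ds v) := by omega
  rw [p.getVert_reverse, h3] at h2
  omega

/-- The edge `uv` can be used to bypass the edge number `i` of `p`. -/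
def IsCand (p : G.Walk s t) (ds dt : Fin n → ℕ) (i : ℕ) (u v : Fin n) : Prop :=
  G.Adj u v ∧ s(u, v) ≠ edgeAt p i ∧ onOf n (ds u) ≤ i ∧ onOf n (dt v) + i + 1 ≤ p.length

/-- The count from `s` is `0` at `s` and `p.length` at `t`, so it must rise above `i` along some
edge of the walk. The far end of that edge has a small count from `t` by `onOf_add_onOf_le`. -/
lemma exists_isCand_le (hp : IsShortestPath w p) (hs : IsDist G (perturb w p.edges) s ds)
    (ht : IsDist G (perturb w p.edges) t dt) {i : ℕ} (hi : i < p.length)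
    (q : G.Walk s t) (hq : edgeAt p i ∉ q.edges) :
    ∃ u v, IsCand p ds dt i u v ∧
      ds u + perturb w p.edges s(u, v) + dt v ≤ weight (perturb w p.edges) q := by
  -- The induction runs over the remaining part of the walk; `ds x` accounts for the part already
  -- passed.
  have key : ∀ (x z : Fin n) (q : G.Walk x z), z = t → edgeAt p i ∉ q.edges → onOf n (ds x) ≤ i →
      ∃ u v, IsCand p ds dt i u v ∧
        ds u + perturb w p.edges s(u, v) + dt v ≤ ds x + weight (perturb w p.edges) q := by
    intro x z q hz hq hx
    induction q with
    | nil =>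
      subst hz
      have := onOf_dist_getVert hp hs (j := p.length) le_rfl
      rw [p.getVert_length] at this
      omega
    | @cons x y z h r ih =>
      simp only [SimpleGraph.Walk.edges_cons, List.mem_cons, not_or] at hq
      rcases le_or_gt (onOf n (ds y)) i with hy | hy
      · obtain ⟨u, v, h1, h2⟩ := ih hz hq.2 hy
        have := hs.le_add h
        exact ⟨u, v, h1, by rw [weight_cons]; omega⟩
      · have := onOf_add_onOf_le hp hs ht y
        refine ⟨x, y, ⟨h, Ne.symm hq.1, hx, by omega⟩, ?_⟩
        subst hz
        have := ht.le_weight r.reverse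
        rw [weight_reverse] at this
        rw [weight_cons]
        omega
  have := key s t q rfl hq (by
    have := onOf_dist_getVert hp hs (j := 0) (Nat.zero_le _)
    rw [p.getVert_zero] at this
    omega)
  rwa [hs.source, zero_add] at this

/-- The two count conditions exclude the edge from the two tree paths, whichever shortest paths are
chosen. On `p.reverse` the edge has number `p.length - 1 - i`. -/
lemma IsCand.notMem_edges (hp : IsShortestPath w p) (hs : IsDist G (perturb w p.edges) s ds)
    (ht : IsDist G (perturb w p.edges) t dt) {i : ℕ} (hi : i < p.length) {u v : Fin n}
    (h : IsCand p ds dt i u v) {q : G.Walk s u} {q' : G.Walk t v}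
    (hq : IsShortestPath (perturb w p.edges) q) (hq' : IsShortestPath (perturb w p.edges) q') :
    edgeAt p i ∉ (q.append (.cons h.1 q'.reverse)).edges := by
  have ht' : IsDist G (perturb w p.reverse.edges) t dt := by rwa [perturb_edges_reverse]
  simp only [SimpleGraph.Walk.edges_append, SimpleGraph.Walk.edges_cons, List.mem_append,
    List.mem_cons, SimpleGraph.Walk.edges_reverse, List.mem_reverse, not_or]
  refine ⟨fun hm => ?_, h.2.1.symm, fun hm => ?_⟩
  · have := lt_onOf_of_edgeAt_mem hp hs hq hi hm
    have := h.2.2.1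
    omega
  · rw [← edgeAt_reverse p hi] at hm
    have := lt_onOf_of_edgeAt_mem hp.reverse ht' (by rwa [perturb_edges_reverse])
      (by rw [p.length_reverse]; omega) hm
    have := h.2.2.2
    omega

/-- The glued walk is no heavier, in the perturbed sense, than any walk avoiding the edge. Its own
bypass is such a walk, so positivity makes it simple. -/
lemma IsCand.isReplacementPath (hp : IsShortestPath w p)
    (hs : IsDist G (perturb w p.edges) s ds) (ht : IsDist G (perturb w p.edges) t dt) {i : ℕ}
    (hi : i < p.length) {u v : Fin n} (h : IsCand p ds dt i u v)
    (hmin : ∀ u' v', IsCand p ds dt i u' v' → ds u + perturb w p.edges s(u, v) + dt v ≤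
      ds u' + perturb w p.edges s(u', v') + dt v')
    {q : G.Walk s u} {q' : G.Walk t v}
    (hq : IsShortestPath (perturb w p.edges) q) (hq' : IsShortestPath (perturb w p.edges) q') :
    IsReplacementPath w (edgeAt p i) (q.append (.cons h.1 q'.reverse)) ∧
      weight (perturb w p.edges) (q.append (.cons h.1 q'.reverse)) =
        ds u + perturb w p.edges s(u, v) + dt v := by
  have hW : weight (perturb w p.edges) (q.append (.cons h.1 q'.reverse)) =
      ds u + perturb w p.edges s(u, v) + dt v := by
    simp [hs.eq_weight hq, ht.eq_weight hq', add_assoc]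
  have hne := h.notMem_edges hp hs ht hi hq hq'
  have hle : ∀ r : G.Walk s t, edgeAt p i ∉ r.edges →
      weight (perturb w p.edges) (q.append (.cons h.1 q'.reverse)) ≤
        weight (perturb w p.edges) r := by
    intro r hr
    obtain ⟨u', v', h1, h2⟩ := exists_isCand_le hp hs ht hi r hr
    have := hmin u' v' h1
    omega
  have hpath : (q.append (.cons h.1 q'.reverse)).IsPath :=
    isPath_of_weight_le_bypass (perturb_pos w _)
      (hle _ fun hm => hne (SimpleGraph.Walk.edges_bypass_subset_edges _ hm))
  exact ⟨⟨hpath, hne, fun r hr hr' => weight_le_of_perturb_le _ hpath hr (hle r hr')⟩, hW⟩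

lemma not_isCand_of_forall_not (hp : IsShortestPath w p)
    (hs : IsDist G (perturb w p.edges) s ds) (ht : IsDist G (perturb w p.edges) t dt) {i : ℕ}
    (hi : i < p.length) (h : ∀ u v, ¬ IsCand p ds dt i u v) (q : G.Walk s t) :
    edgeAt p i ∈ q.edges := by
  by_contra hq
  obtain ⟨u, v, huv, -⟩ := exists_isCand_le hp hs ht hi q hq
  exact h u v huv

lemma replacementWeight_eq {e : Sym2 (Fin n)} {q : G.Walk s t} (hq : IsReplacementPath w e q) :
    replacementWeight G w s t e = weight w q := by
  refine le_antisymm (iInf₂_le q ⟨hq.1, hq.2.1⟩) (le_iInf₂ fun q' hq' => ?_)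
  exact_mod_cast hq.2.2 q' hq'.1 hq'.2

lemma replacementWeight_eq_top {e : Sym2 (Fin n)} (h : ∀ q : G.Walk s t, e ∈ q.edges) :
    replacementWeight G w s t e = ⊤ := by
  simp [replacementWeight, h]

lemma IsReplacementPath.length_le_hRep {e : Sym2 (Fin n)} {q : G.Walk s t}
    (hq : IsReplacementPath w e q) (he : e ∈ p.edges) : q.length ≤ hRep w p :=
  le_csSup (bddAbove_hRep w p) ⟨e, he, q, hq, rfl⟩

end Detour

end RPaths

namespace RPaths

/-! ### Parent pointers and the steps of a walk -/

section Chain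

variable {n : ℕ} {G : SimpleGraph (Fin n)}

open Classical in
/-- Some vertex with the property `P`, if there is one. -/
noncomputable def pick {α : Type*} (P : α → Prop) : Option α :=
  if h : ∃ y, P y then some h.choose else none

lemma of_pick_eq_some {α : Type*} {P : α → Prop} {y : α} (h : pick P = some y) : P y := by
  unfold pick at h
  split_ifs at h with h'
  exact Option.some.inj h ▸ h'.choose_spec

lemma pick_eq_none {α : Type*} {P : α → Prop} : pick P = none ↔ ∀ y, ¬ P y := by
  unfold pick
  split_ifs with h
  · simpa using h
  · simpa using h

/-- The walk `q` goes from `x` directly to `y` at some point. -/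
def Step {s t : Fin n} (q : G.Walk s t) (x y : Fin n) : Prop :=
  ∃ d ∈ q.darts, d.fst = x ∧ d.snd = y

lemma not_step_nil {s x y : Fin n} : ¬ Step (.nil : G.Walk s s) x y := by simp [Step]

lemma step_cons {r s t x y : Fin n} (h : G.Adj r s) (q : G.Walk s t) :
    Step (.cons h q) x y ↔ (x = r ∧ y = s) ∨ Step q x y := by
  simp [Step, eq_comm]

lemma step_append {r s t x y : Fin n} (p : G.Walk r s) (q : G.Walk s t) :
    Step (p.append q) x y ↔ Step p x y ∨ Step q x y := by
  simp only [Step, SimpleGraph.Walk.darts_append, List.mem_append, or_and_right, exists_or]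

lemma step_reverse {s t x y : Fin n} (q : G.Walk s t) : Step q.reverse x y ↔ Step q y x := by
  induction q with
  | nil => simp [Step]
  | cons h q ih =>
    rw [SimpleGraph.Walk.reverse_cons, step_append, step_cons, step_cons, ih]
    simp only [not_step_nil, or_false]
    tauto

lemma Step.mem_edges {s t x y : Fin n} {q : G.Walk s t} (h : Step q x y) : s(x, y) ∈ q.edges := by
  obtain ⟨d, hd, rfl, rfl⟩ := h
  exact List.mem_map_of_mem hd

lemma Step.adj {s t x y : Fin n} {q : G.Walk s t} (h : Step q x y) : G.Adj x y :=
  q.adj_of_mem_edges h.mem_edges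

lemma Step.fst_mem {s t x y : Fin n} {q : G.Walk s t} (h : Step q x y) : x ∈ q.support :=
  q.fst_mem_support_of_mem_edges h.mem_edges

lemma nextHop_eq_none_of_notMem {s t x : Fin n} (q : G.Walk s t) (h : x ∉ q.support) :
    nextHop q x = none := by
  induction q with
  | nil => rfl
  | cons hadj q ih =>
    simp only [SimpleGraph.Walk.support_cons, List.mem_cons, not_or] at h
    rw [nextHop, if_neg h.1, ih h.2]

lemma nextHop_last {s t : Fin n} {q : G.Walk s t} (hq : q.IsPath) : nextHop q t = none := by
  induction q with
  | nil => rfl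
  | cons hadj q ih =>
    rw [SimpleGraph.Walk.cons_isPath_iff] at hq
    rw [nextHop, if_neg (by rintro rfl; exact hq.2 q.end_mem_support), ih hq.1]

lemma nextHop_eq_some_iff {s t x y : Fin n} {q : G.Walk s t} (hq : q.IsPath) :
    nextHop q x = some y ↔ Step q x y := by
  induction q with
  | nil => simp [nextHop, not_step_nil]
  | @cons a b c hadj q ih =>
    rw [SimpleGraph.Walk.cons_isPath_iff] at hq
    rw [nextHop, step_cons]
    split_ifs with hx
    · subst hx
      have : ¬ Step q x y := fun h => hq.2 h.fst_mem
      simp [this, eq_comm]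
    · simp [hx, ih hq.1]

/-- The vertex `y` is reached from `x` by following the pointers `par`. -/
def Anc (par : Fin n → Option (Fin n)) : Fin n → Fin n → Prop :=
  Relation.ReflTransGen fun a b => par a = some b

lemma Anc.refl {par : Fin n → Option (Fin n)} (x : Fin n) : Anc par x x :=
  Relation.ReflTransGen.refl

lemma Anc.tail {par : Fin n → Option (Fin n)} {x y z : Fin n} (h : Anc par x y)
    (h' : par y = some z) : Anc par x z :=
  Relation.ReflTransGen.tail h h'

lemma anc_iff {par : Fin n → Option (Fin n)} {x y z : Fin n} (h : par x = some y) :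
    Anc par x z ↔ z = x ∨ Anc par y z := by
  unfold Anc
  rw [Relation.ReflTransGen.cases_head_iff]
  simp [h, eq_comm]

lemma anc_iff_of_none {par : Fin n → Option (Fin n)} {x z : Fin n} (h : par x = none) :
    Anc par x z ↔ z = x := by
  unfold Anc
  rw [Relation.ReflTransGen.cases_head_iff]
  simp [h, eq_comm]

/-- The pointers `par` lead to `root`, along edges that decrease `dep` by one. -/
structure IsForest (G : SimpleGraph (Fin n)) (root : Fin n) (par : Fin n → Option (Fin n))
    (dep : Fin n → ℕ) : Prop where
  none_iff : ∀ x, par x = none ↔ x = root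
  adj : ∀ {x y}, par x = some y → G.Adj x y
  succ : ∀ {x y}, par x = some y → dep y + 1 = dep x
  dep_root : dep root = 0

lemma IsForest.dep_le {root : Fin n} {par : Fin n → Option (Fin n)} {dep : Fin n → ℕ}
    (hF : IsForest G root par dep) {x y : Fin n} (h : Anc par x y) : dep y ≤ dep x := by
  induction h with
  | refl => exact le_rfl
  | tail _ h ih => have := hF.succ h; omega

/-- The pointers `par` follow shortest paths to `s`. -/
structure IsParent (G : SimpleGraph (Fin n)) (w : Sym2 (Fin n) → ℕ) (s : Fin n) (d : Fin n → ℕ)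
    (par : Fin n → Option (Fin n)) : Prop where
  none_iff : ∀ x, par x = none ↔ x = s
  adj : ∀ {x y}, par x = some y → G.Adj x y
  dist : ∀ {x y}, par x = some y → d y + w s(x, y) = d x

variable {w : Sym2 (Fin n) → ℕ} {s : Fin n} {d : Fin n → ℕ} {par : Fin n → Option (Fin n)}

/-- Distances strictly decrease along the pointers, so every choice of tight predecessors yields a
shortest path tree. The vertices and steps of the walk are expressed through `Anc`, the form in
which tokens climbing the tree discover them. -/
lemma IsParent.exists_walk (hw : ∀ e, 0 < w e) (hd : IsDist G w s d) (hp : IsParent G w s d par)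
    (x : Fin n) : ∃ q : G.Walk s x, IsShortestPath w q ∧ (∀ y, y ∈ q.support ↔ Anc par x y) ∧
      ∀ y z, Step q y z ↔ Anc par x z ∧ par z = some y := by
  suffices h : ∃ q : G.Walk s x, weight w q = d x ∧ (∀ y, y ∈ q.support ↔ Anc par x y) ∧
      ∀ y z, Step q y z ↔ Anc par x z ∧ par z = some y by
    obtain ⟨q, h1, h2⟩ := h
    exact ⟨q, hd.isShortestPath hw h1.le, h2⟩
  induction h : d x using Nat.strong_induction_on generalizing x with
  | _ k ih =>
  subst h
  cases hx : par x with
  | none =>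
    obtain rfl := (hp.none_iff x).1 hx
    refine ⟨.nil, by simp [hd.source], fun y => by simp [anc_iff_of_none hx], fun y z => ?_⟩
    rw [anc_iff_of_none hx]
    simp only [not_step_nil, false_iff, not_and]
    rintro rfl
    simp [hx]
  | some y =>
    have h1 := hp.dist hx
    have h2 := hw s(x, y)
    obtain ⟨q, hq, hs, hst⟩ := ih (d y) (by omega) y rfl
    refine ⟨q.append (.cons (hp.adj hx).symm .nil), ?_, fun z => ?_, fun a z => ?_⟩
    · simp [hq, Sym2.eq_swap (a := y), h1]
    · rw [anc_iff hx, SimpleGraph.Walk.mem_support_append_iff, hs]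
      simp only [SimpleGraph.Walk.support_cons, SimpleGraph.Walk.support_nil, List.mem_cons,
        List.not_mem_nil, or_false]
      constructor
      · rintro (h | rfl | rfl)
        · exact .inr h
        · exact .inr (Anc.refl _)
        · exact .inl rfl
      · tauto
    · rw [step_append, step_cons, hst, anc_iff hx]
      simp only [not_step_nil, or_false]
      constructor
      · rintro (⟨h, h'⟩ | ⟨rfl, rfl⟩)
        · exact ⟨.inr h, h'⟩
        · exact ⟨.inl rfl, hx⟩
      · rintro ⟨rfl | h, h'⟩
        · rw [hx] at h'
          exact .inr ⟨(Option.some.inj h').symm, rfl⟩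
        · exact .inl ⟨h, h'⟩

lemma hopOf_eq_length {E : List (Sym2 (Fin n))} (hd : IsDist G (perturb w E) s d) {x : Fin n}
    {q : G.Walk s x} (hq : IsShortestPath (perturb w E) q) : hopOf n (d x) = q.length := by
  rw [← hd.eq_weight hq, (decode_weight _ hq.1).1]

/-- Extending a shortest path by a tight edge gives a shortest, hence simple, path, so the last
digit rises by one without carry. -/
lemma hopOf_succ {E : List (Sym2 (Fin n))} (hd : IsDist G (perturb w E) s d) {x y : Fin n}
    (h : G.Adj x y) (hxy : d y + perturb w E s(x, y) = d x) :
    hopOf n (d y) + 1 = hopOf n (d x) := by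
  obtain ⟨q, hq, hqw⟩ := hd y
  have hq' : IsShortestPath (perturb w E) (q.append (.cons h.symm .nil)) := by
    refine hd.isShortestPath (perturb_pos w E) ?_
    simp [hqw, Sym2.eq_swap (a := y), hxy]
  rw [hopOf_eq_length hd hq, hopOf_eq_length hd hq']
  simp

lemma IsParent.isForest {E : List (Sym2 (Fin n))} (hd : IsDist G (perturb w E) s d)
    (hp : IsParent G (perturb w E) s d par) :
    IsForest G s par (fun x => hopOf n (d x)) where
  none_iff := hp.none_iff
  adj := hp.adj
  succ h := hopOf_succ hd (hp.adj h) (hp.dist h)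
  dep_root := by simp [hd.source, hopOf]

end Chain

/-! ### Typed protocols -/

section Typed

/-- The elements of `X` can be written in `q` words. -/
def Fits (n q : ℕ) (X : Type) : Prop := Finite X ∧ Nat.card X ≤ 2 ^ (q * wordLen n)

namespace Fits

variable {n q q' : ℕ} {X Y : Type}

lemma mono (h : Fits n q X) (hq : q ≤ q') : Fits n q' X :=
  ⟨h.1, h.2.trans (Nat.pow_le_pow_right (by norm_num) (Nat.mul_le_mul_right _ hq))⟩

lemma prod (h : Fits n q X) (h' : Fits n q' Y) : Fits n (q + q') (X × Y) := by
  have := h.1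
  have := h'.1
  refine ⟨inferInstance, ?_⟩
  rw [Nat.card_prod, add_mul, pow_add]
  exact Nat.mul_le_mul h.2 h'.2

lemma of_injective (h : Fits n q Y) (f : X → Y) (hf : f.Injective) : Fits n q X := by
  have := h.1
  exact ⟨Finite.of_injective f hf, (Nat.card_le_card_of_injective f hf).trans h.2⟩

lemma option (h : Fits n q X) : Fits n (q + 1) (Option X) := by
  have := h.1
  refine ⟨inferInstance, ?_⟩
  rw [Finite.card_option, add_mul, pow_add]
  have h1 : 2 ^ 1 ≤ 2 ^ (1 * wordLen n) :=
    Nat.pow_le_pow_right (by norm_num) (by simp [wordLen])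
  have h2 : 1 ≤ 2 ^ (q * wordLen n) := Nat.one_le_two_pow
  have h3 := Nat.mul_le_mul_left (2 ^ (q * wordLen n)) h1
  have := h.2
  omega

lemma bool : Fits n 1 Bool := by
  refine ⟨inferInstance, ?_⟩
  have h1 : 2 ^ 1 ≤ 2 ^ (1 * wordLen n) :=
    Nat.pow_le_pow_right (by norm_num) (by simp [wordLen])
  simpa using h1

lemma fin : Fits n 1 (Fin n) := by
  refine ⟨inferInstance, ?_⟩
  simpa [wordLen] using (Nat.lt_pow_succ_log_self (b := 2) (by norm_num) n).le

lemma bitVec : Fits n q (BitVec (q * wordLen n)) := by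
  have e : BitVec (q * wordLen n) ≃ Fin (2 ^ (q * wordLen n)) :=
    ⟨BitVec.toFin, BitVec.ofFin, fun _ => rfl, fun _ => rfl⟩
  exact ⟨Finite.of_equiv _ e.symm, by rw [Nat.card_congr e]; simp⟩

lemma word : Fits n 1 (BitVec (wordLen n)) := by
  have := bitVec (n := n) (q := 1)
  rwa [one_mul] at this

lemma finPow : Fits n q (Fin (2 ^ (q * wordLen n))) := ⟨inferInstance, by simp⟩

/-- Local computation is free, so only the cardinality of a message or memory type matters. -/
lemma exists_code [Nonempty X] (h : Fits n q X) :
    ∃ (enc : X → BitVec (q * wordLen n)) (dec : BitVec (q * wordLen n) → X),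
      ∀ x, dec (enc x) = x := by
  have := h.1
  let f : X → BitVec (q * wordLen n) :=
    fun x => BitVec.ofFin (Fin.castLE h.2 (Finite.equivFin X x))
  have hf : f.Injective := fun x y hxy => by simpa [f] using hxy
  exact ⟨f, Function.invFun f, Function.leftInverse_invFun hf⟩

end Fits

/-- A protocol with arbitrary messages, in which every node sends to all neighbours in every
round. -/
structure TypedProtocol (n : ℕ) (M State : Type) where
  send : Local n → State → Fin n → M
  recv : Local n → State → (Fin n → Option M) → State

variable {n b c : ℕ} {M State In Out : Type}

open Classical in
/-- The messages that the node `v` receives from nodes in the states `σ`. -/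
noncomputable def TypedProtocol.inbox (A : TypedProtocol n M State) (N : SimpleGraph (Fin n))
    (loc : Fin n → Local n) (σ : Fin n → State) (v u : Fin n) : Option M :=
  if N.Adj u v then some (A.send (loc u) (σ u) v) else none

lemma TypedProtocol.inbox_eq_some_iff {A : TypedProtocol n M State} {N : SimpleGraph (Fin n)}
    {loc : Fin n → Local n} {σ : Fin n → State} {v u : Fin n} {m : M} :
    A.inbox N loc σ v u = some m ↔ N.Adj u v ∧ A.send (loc u) (σ u) v = m := by
  unfold TypedProtocol.inbox
  split_ifs with h <;> simp [h]

/-- The states of the nodes after `r` rounds. -/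
noncomputable def TypedProtocol.run (A : TypedProtocol n M State)
    (N : SimpleGraph (Fin n)) (loc : Fin n → Local n) (start : Fin n → State) :
    ℕ → Fin n → State
  | 0 => start
  | r + 1 => fun v => A.recv (loc v) (A.run N loc start r v)
      (A.inbox N loc (A.run N loc start r) v)

open Classical in
/-- The algorithm that follows the protocol `A` until an output is available. -/
noncomputable def TypedProtocol.toAlg (A : TypedProtocol n M State) (enc : M → Msg n b)
    (dec : Msg n b → M) (init : Local n → In → State) (out : Local n → State → Option Out) :
    CongestAlg n b In Out where
  State := State
  init := init
  code :=
    { send := fun L σ u => if out L σ = none then some (enc (A.send L σ u)) else none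
      recv := fun L σ m => if out L σ = none then A.recv L σ (fun u => (m u).map dec) else σ }
  out := out
  silent_of_out _ _ h _ := if_neg h
  stay_of_out _ _ h _ := if_neg h

/-- A node falls silent once it has an output, so the algorithm agrees with the typed protocol as
long as no node has one; this is where simultaneous termination helps. -/
lemma TypedProtocol.states_toAlg (A : TypedProtocol n M State) {enc : M → Msg n b}
    {dec : Msg n b → M} (hdec : ∀ m, dec (enc m) = m) {init : Local n → In → State}
    {out : Local n → State → Option Out} (G : SimpleGraph (Fin n)) (w : Sym2 (Fin n) → ℕ)
    (inp : Fin n → In) {τ : ℕ}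
    (h : ∀ r < τ, ∀ v, out (localView G w v)
      (A.run G (localView G w) (fun v => init (localView G w v) (inp v)) r v) = none)
    {r : ℕ} (hr : r ≤ τ) :
    (A.toAlg enc dec init out).states G w inp r =
      A.run G (localView G w) (fun v => init (localView G w v) (inp v)) r := by
  induction r with
  | zero => rfl
  | succ r ih =>
    have hih := ih (by omega)
    have hn := h r (by omega)
    rw [← hih] at hn
    unfold CongestAlg.states at hih hn ⊢
    funext v
    rw [Protocol.run, TypedProtocol.run, ← hih]
    simp only [TypedProtocol.toAlg] at hn ⊢
    rw [if_pos (hn v)]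
    congr 1
    funext u
    unfold TypedProtocol.inbox
    by_cases hu : G.Adj u v
    · simp only [hu, if_true]
      rw [if_pos (hn u), Option.map_some, hdec]
    · simp [hu]

lemma CongestAlg.states_eq_of_out (A : CongestAlg n b In Out) (G : SimpleGraph (Fin n))
    (w : Sym2 (Fin n) → ℕ) (inp : Fin n → In) {r : ℕ} {v : Fin n}
    (h : A.output G w inp r v ≠ none) {r' : ℕ} (hr : r ≤ r') :
    A.states G w inp r' v = A.states G w inp r v := by
  induction r', hr using Nat.le_induction with
  | base => rfl
  | succ r' hr ih =>
    have h' := h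
    unfold CongestAlg.output at h'
    rw [← ih] at h'
    rw [← ih]
    exact A.stay_of_out _ _ h' _

lemma CongestAlg.output_eq_of_le (A : CongestAlg n b In Out) (G : SimpleGraph (Fin n))
    (w : Sym2 (Fin n) → ℕ) (inp : Fin n → In) {r : ℕ} {v : Fin n} {o : Out}
    (h : A.output G w inp r v = some o) {r' : ℕ} (hr : r ≤ r') :
    A.output G w inp r' v = some o := by
  rw [← h]
  unfold CongestAlg.output
  rw [A.states_eq_of_out G w inp (by simp [h]) hr]

/-- Outputs are final. Hence a value that some node outputs early is already the one it has at the
end, and termination can be detected without knowing the running time. -/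
lemma CongestAlg.output_eq_of_output (A : CongestAlg n b In Out) (G : SimpleGraph (Fin n))
    (w : Sym2 (Fin n) → ℕ) (inp : Fin n → In) {r r' : ℕ} {v : Fin n} {o o' : Out}
    (h : A.output G w inp r v = some o) (h' : A.output G w inp r' v = some o') : o = o' := by
  rcases le_total r r' with hr | hr
  · have := A.output_eq_of_le G w inp h hr
    rw [h'] at this
    exact (Option.some.inj this).symm
  · have := A.output_eq_of_le G w inp h' hr
    rw [h] at this
    exact Option.some.inj this

/-- On-the-fly construction by a protocol with typed messages and memory. -/
noncomputable def TypedProtocol.toOnTheFly {Mem Prior : Type} (A : TypedProtocol n M Mem)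
    (enc : M → Msg n b) (dec : Msg n b → M) (pack : Mem → BitVec (c * wordLen n))
    (unpack : BitVec (c * wordLen n) → Mem) (store : Local n → Prior → Mem)
    (wake : Local n → Mem → (Fin n → Bool) → Option (BitVec (wordLen n)) → Mem)
    (read : Local n → Mem → Option (BitVec (wordLen n) × Option (Fin n))) :
    OnTheFly n b c Prior where
  store L x := pack (store L x)
  wake L m down x := pack (wake L (unpack m) down x)
  code :=
    { send := fun L σ u => some (enc (A.send L (unpack σ) u))
      recv := fun L σ m => pack (A.recv L (unpack σ) (fun u => (m u).map dec)) }
  read L m := read L (unpack m)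

lemma TypedProtocol.verdict_toOnTheFly {Mem Prior : Type} (A : TypedProtocol n M Mem)
    {enc : M → Msg n b} {dec : Msg n b → M} (hdec : ∀ m, dec (enc m) = m)
    {pack : Mem → BitVec (c * wordLen n)} {unpack : BitVec (c * wordLen n) → Mem}
    (hpack : ∀ m, unpack (pack m) = m) (store : Local n → Prior → Mem)
    (wake : Local n → Mem → (Fin n → Bool) → Option (BitVec (wordLen n)) → Mem)
    (read : Local n → Mem → Option (BitVec (wordLen n) × Option (Fin n)))
    (G : SimpleGraph (Fin n)) (w : Sym2 (Fin n) → ℕ) (s : Fin n) (prior : Fin n → Prior)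
    (e : Sym2 (Fin n)) (x : BitVec (wordLen n)) (r : ℕ) (v : Fin n) :
    (A.toOnTheFly enc dec pack unpack store wake read).verdict G w s prior e x r v =
      read (localView G w v) (A.run (G.deleteEdges {e}) (localView G w)
        (fun u => wake (localView G w u) (store (localView G w u) (prior u))
          (fun u' => decide (s(u, u') = e)) (if u = s then some x else none)) r v) := by
  unfold OnTheFly.verdict
  simp only [TypedProtocol.toOnTheFly, hpack]
  congr 1
  induction r generalizing v with
  | zero => simp [Protocol.run, TypedProtocol.run, hpack]
  | succ r ih =>
    rw [Protocol.run, TypedProtocol.run, hpack, ih]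
    congr 1
    funext u
    unfold TypedProtocol.inbox
    by_cases hu : (G.deleteEdges {e}).Adj u v
    · simp only [hu, if_true]
      rw [Option.map_some, hdec, ih]
    · simp only [hu, if_false, Option.map_none]

end Typed

end RPaths

namespace RPaths

/-! ### What the nodes know after the preprocessing -/

section Plan

variable {n : ℕ} {G : SimpleGraph (Fin n)} {w : Sym2 (Fin n) → ℕ} {s t : Fin n}

/-- The knowledge of a node: its parents and depths in the shortest path trees of the two ends of
the path, its successor on the path and the bypass edge for the edge to it, the number of edges of
the path, the bypass edges for all of them, and a bound on the number of hops of the detours. -/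
structure Info (n : ℕ) where
  parS : Option (Fin n)
  parT : Option (Fin n)
  depS : ℕ
  depT : ℕ
  succ : Option (Fin n)
  own : Option (Fin n × Fin n)
  len : ℕ
  cand : ℕ → Option (Fin n × Fin n)
  maxHop : ℕ

/-- The walk `q` follows the tree of `s` to `u`, the edge `uv`, and the tree of `t` from `v`, and
it is a replacement path for the edge `e`. -/
structure IsDetour (w : Sym2 (Fin n) → ℕ) (parS parT : Fin n → Option (Fin n))
    (e : Sym2 (Fin n)) (u v : Fin n) (q : G.Walk s t) : Prop where
  isReplacementPath : IsReplacementPath w e q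
  mem_support : ∀ x, x ∈ q.support ↔ Anc parS u x ∨ Anc parT v x
  step_iff : ∀ x y, Step q x y ↔ (Anc parS u y ∧ parS y = some x) ∨ (x = u ∧ y = v) ∨
    (Anc parT v x ∧ parT x = some y)

/-- The knowledge `I` of the nodes describes a replacement path for every edge of `p` that has
one. -/
structure IsPlan (w : Sym2 (Fin n) → ℕ) (p : G.Walk s t) (I : Fin n → Info n)
    (cand : ℕ → Option (Fin n × Fin n)) (H : ℕ) : Prop where
  forestS : IsForest G s (fun x => (I x).parS) (fun x => (I x).depS)
  forestT : IsForest G t (fun x => (I x).parT) (fun x => (I x).depT)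
  len : ∀ x, (I x).len = p.length
  cand_eq : ∀ x, ∀ i < p.length, (I x).cand i = cand i
  maxHop : ∀ x, (I x).maxHop = H
  maxHop_le : H ≤ hRep w p
  succ_iff : ∀ x y, (I x).succ = some y ↔ ∃ i < p.length, x = p.getVert i ∧ y = p.getVert (i + 1)
  own : ∀ i < p.length, (I (p.getVert i)).own = cand i
  detour : ∀ i < p.length, ∀ u v, cand i = some (u, v) →
    ∃ q : G.Walk s t, IsDetour w (fun x => (I x).parS) (fun x => (I x).parT) (edgeAt p i) u v q ∧
      (I u).depS + 1 + (I v).depT = q.length ∧ q.length ≤ H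
  not_detour : ∀ i < p.length, cand i = none → ∀ q : G.Walk s t, edgeAt p i ∈ q.edges

end Plan

/-! ### Routing tables -/

section Tables

variable {n : ℕ} {G : SimpleGraph (Fin n)} {w : Sym2 (Fin n) → ℕ} {s t : Fin n}

/-- The state of a node during the computation of the routing tables: `child i` is the next vertex
on the part of the detour number `i` in the tree of `s`, `tok i` says that the node is on the part in
the tree of `t`. -/
structure TableState (n : ℕ) where
  info : Info n
  clock : ℕ
  child : ℕ → Option (Fin n)
  tok : ℕ → Prop

def TableState.start (I : Info n) : TableState n := ⟨I, 0, fun _ => none, fun _ => False⟩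

/-- The token starts at the near end of the bypass edge and is afterwards recognized by the child
that sent it. -/
def TableState.OnS (x : Fin n) (σ : TableState n) (i : ℕ) : Prop :=
  i < σ.info.len ∧ (σ.child i ≠ none ∨ ∃ v, σ.info.cand i = some (x, v))

def TableState.OnT (x : Fin n) (σ : TableState n) (i : ℕ) : Prop :=
  i < σ.info.len ∧ (σ.tok i ∨ ∃ u, σ.info.cand i = some (u, x))

/-- The token of detour number `i` leaves a node of depth `d` in round `maxHop - d + i`. -/
noncomputable def tableProtocol (n : ℕ) :
    TypedProtocol n (Option (Fin n) × Option (Fin n)) (TableState n) where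
  send L σ y :=
    (pick fun i => σ.info.parS = some y ∧ σ.info.maxHop - σ.info.depS + i = σ.clock ∧
        σ.OnS L.id i,
     pick fun i => σ.info.parT = some y ∧ σ.info.maxHop - σ.info.depT + i = σ.clock ∧
        σ.OnT L.id i)
  recv _ σ inbox :=
    { info := σ.info
      clock := σ.clock + 1
      child := fun i =>
        (pick fun y => ∃ m, inbox y = some m ∧ m.1.map Fin.val = some i).or (σ.child i)
      tok := fun i => σ.tok i ∨ ∃ y m, inbox y = some m ∧ m.2.map Fin.val = some i }

open Classical in
/-- The entry number `i` of the routing table of node `x`. -/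
noncomputable def TableState.entry (x : Fin n) (σ : TableState n) (i : ℕ) : Option (Fin n) :=
  (σ.child i).or
    (if σ.OnS x i then (σ.info.cand i).map Prod.snd else if σ.OnT x i then σ.info.parT else none)

noncomputable def TableState.out (x : Fin n) (σ : TableState n) : Option (List (Option (Fin n))) :=
  if σ.info.len + σ.info.maxHop ≤ σ.clock then some ((List.range σ.info.len).map (σ.entry x))
  else none

variable {p : G.Walk s t} {I : Fin n → Info n} {cand : ℕ → Option (Fin n × Fin n)} {H : ℕ}

/-- The states of the nodes during the computation of the routing tables. -/
noncomputable def tableRun (G : SimpleGraph (Fin n)) (w : Sym2 (Fin n) → ℕ) (I : Fin n → Info n) :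
    ℕ → Fin n → TableState n :=
  (tableProtocol n).run G (localView G w) (fun v => .start (I v))

lemma tableRun_info (r : ℕ) (x : Fin n) : (tableRun G w I r x).info = I x := by
  induction r with
  | zero => rfl
  | succ r ih => exact ih

lemma tableRun_clock (r : ℕ) (x : Fin n) : (tableRun G w I r x).clock = r := by
  induction r with
  | zero => rfl
  | succ r ih => exact congrArg (· + 1) ih

lemma pick_eq_some_of_unique {α : Type*} {P : α → Prop} {y : α} (hy : P y)
    (h : ∀ z, P z → z = y) : pick P = some y := by
  cases hp : pick P with
  | none => exact absurd hy (pick_eq_none.1 hp y)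
  | some z => rw [h z (of_pick_eq_some hp)]

/-- At a node of fixed depth different detours are scheduled for different rounds, so the choice
made by `pick` is unique and a message needs to carry only one number per tree. -/
lemma tableRun_sendS {r : ℕ} {x y : Fin n} {i : ℕ} (hi : i < n) :
    ((tableProtocol n).send (localView G w y) (tableRun G w I r y) x).1.map Fin.val = some i ↔
      (I y).parS = some x ∧ (I y).maxHop - (I y).depS + i = r ∧ (tableRun G w I r y).OnS y i := by
  simp only [tableProtocol, tableRun_info, tableRun_clock, localView, Option.map_eq_some_iff]
  constructor
  · rintro ⟨j, hj, rfl⟩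
    have := of_pick_eq_some hj
    exact this
  · rintro h
    refine ⟨⟨i, hi⟩, pick_eq_some_of_unique h ?_, rfl⟩
    rintro z ⟨-, hz, -⟩
    exact Fin.ext (by dsimp only; omega)

lemma tableRun_sendT {r : ℕ} {x y : Fin n} {i : ℕ} (hi : i < n) :
    ((tableProtocol n).send (localView G w y) (tableRun G w I r y) x).2.map Fin.val = some i ↔
      (I y).parT = some x ∧ (I y).maxHop - (I y).depT + i = r ∧ (tableRun G w I r y).OnT y i := by
  simp only [tableProtocol, tableRun_info, tableRun_clock, localView, Option.map_eq_some_iff]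
  constructor
  · rintro ⟨j, hj, rfl⟩
    have := of_pick_eq_some hj
    exact this
  · rintro h
    refine ⟨⟨i, hi⟩, pick_eq_some_of_unique h ?_, rfl⟩
    rintro z ⟨-, hz, -⟩
    exact Fin.ext (by dsimp only; omega)

lemma tableRun_child_succ {r : ℕ} {x : Fin n} {i : ℕ} :
    (tableRun G w I (r + 1) x).child i =
      (pick fun y => ∃ m, (tableProtocol n).inbox G (localView G w) (tableRun G w I r) x y = some m ∧
        m.1.map Fin.val = some i).or ((tableRun G w I r x).child i) := rfl

lemma tableRun_tok_succ {r : ℕ} {x : Fin n} {i : ℕ} :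
    (tableRun G w I (r + 1) x).tok i ↔
      ((tableRun G w I r x).tok i ∨
        ∃ y m, (tableProtocol n).inbox G (localView G w) (tableRun G w I r) x y = some m ∧
        m.2.map Fin.val = some i) := Iff.rfl

/-- Tokens are created only at the near end of a bypass edge and move only along parent pointers. -/
lemma tableRun_child_sound (hI : IsPlan w p I cand H) {r : ℕ} {x y : Fin n} {i : ℕ}
    (hi : i < p.length) (hn : i < n) (h : (tableRun G w I r x).child i = some y) :
    ∃ u v, cand i = some (u, v) ∧ Anc (fun x => (I x).parS) u y ∧ (I y).parS = some x := by
  induction r generalizing x y with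
  | zero => cases h
  | succ r ih =>
    rw [tableRun_child_succ, Option.or_eq_some_iff] at h
    rcases h with h | ⟨-, h⟩
    · obtain ⟨m, hm, him⟩ := of_pick_eq_some h
      obtain ⟨hadj, rfl⟩ := TypedProtocol.inbox_eq_some_iff.1 hm
      obtain ⟨h1, -, -, h2⟩ := (tableRun_sendS hn).1 him
      rcases h2 with h2 | ⟨v, h2⟩
      · obtain ⟨z, hz⟩ := Option.ne_none_iff_exists'.1 h2
        obtain ⟨u, v, hu, ha, hp⟩ := ih hz
        exact ⟨u, v, hu, ha.tail hp, h1⟩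
      · rw [tableRun_info, hI.cand_eq _ _ hi] at h2
        exact ⟨y, v, h2, .refl _, h1⟩
    · exact ih h

lemma tableRun_tok_sound (hI : IsPlan w p I cand H) {r : ℕ} {x : Fin n} {i : ℕ}
    (hi : i < p.length) (hn : i < n) (h : (tableRun G w I r x).tok i) :
    ∃ u v, cand i = some (u, v) ∧ Anc (fun x => (I x).parT) v x := by
  induction r generalizing x with
  | zero => cases h
  | succ r ih =>
    rw [tableRun_tok_succ] at h
    rcases h with h | ⟨y, m, hm, him⟩
    · exact ih h
    · obtain ⟨hadj, rfl⟩ := TypedProtocol.inbox_eq_some_iff.1 hm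
      obtain ⟨h1, -, -, h2⟩ := (tableRun_sendT hn).1 him
      rcases h2 with h2 | ⟨v, h2⟩
      · obtain ⟨u, v, hu, ha⟩ := ih h2
        exact ⟨u, v, hu, ha.tail h1⟩
      · rw [tableRun_info, hI.cand_eq _ _ hi] at h2
        exact ⟨v, y, h2, (Anc.refl _).tail h1⟩

lemma tableRun_child_mono {r r' : ℕ} (hr : r ≤ r') {x : Fin n} {i : ℕ}
    (h : (tableRun G w I r x).child i ≠ none) : (tableRun G w I r' x).child i ≠ none := by
  induction r', hr using Nat.le_induction with
  | base => exact h
  | succ r' _ ih =>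
    rw [tableRun_child_succ]
    simp [Option.or_eq_none_iff, ih]

lemma tableRun_tok_mono {r r' : ℕ} (hr : r ≤ r') {x : Fin n} {i : ℕ}
    (h : (tableRun G w I r x).tok i) : (tableRun G w I r' x).tok i := by
  induction r', hr using Nat.le_induction with
  | base => exact h
  | succ r' _ ih => exact .inl ih

/-- A parent is one level closer to the root, so its round follows immediately on that of its child.
Depths on the chain are at most `H`, hence the truncated subtraction is exact. -/
lemma tableRun_onS (hI : IsPlan w p I cand H) {i : ℕ} (hi : i < p.length) (hn : i < n)
    {u v : Fin n} (hc : cand i = some (u, v)) (hu : (I u).depS ≤ H) {x : Fin n}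
    (hx : Anc (fun x => (I x).parS) u x) :
    ∀ r, H - (I x).depS + i ≤ r → (tableRun G w I r x).OnS x i := by
  induction hx with
  | refl =>
    intro r _
    refine ⟨by rwa [tableRun_info, hI.len], .inr ⟨v, ?_⟩⟩
    rw [tableRun_info, hI.cand_eq _ _ hi, hc]
  | @tail y x ha hp ih =>
    intro r hr
    have hd := hI.forestS.succ hp
    have hd' := hI.forestS.dep_le ha
    have hsend := ih (H - (I y).depS + i) le_rfl
    refine ⟨by rwa [tableRun_info, hI.len], .inl (tableRun_child_mono (r := H - (I y).depS + i + 1)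
      (by omega) ?_)⟩
    rw [tableRun_child_succ, Ne, Option.or_eq_none_iff, not_and_or]
    refine .inl fun hnone => pick_eq_none.1 hnone y ⟨_, TypedProtocol.inbox_eq_some_iff.2
      ⟨hI.forestS.adj hp, rfl⟩, (tableRun_sendS hn).2 ⟨hp, ?_, hsend⟩⟩
    rw [hI.maxHop]

lemma tableRun_onT (hI : IsPlan w p I cand H) {i : ℕ} (hi : i < p.length) (hn : i < n)
    {u v : Fin n} (hc : cand i = some (u, v)) (hv : (I v).depT ≤ H) {x : Fin n}
    (hx : Anc (fun x => (I x).parT) v x) :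
    ∀ r, H - (I x).depT + i ≤ r → (tableRun G w I r x).OnT x i := by
  induction hx with
  | refl =>
    intro r _
    refine ⟨by rwa [tableRun_info, hI.len], .inr ⟨u, ?_⟩⟩
    rw [tableRun_info, hI.cand_eq _ _ hi, hc]
  | @tail y x ha hp ih =>
    intro r hr
    have hd := hI.forestT.succ hp
    have hd' := hI.forestT.dep_le ha
    have hsend := ih (H - (I y).depT + i) le_rfl
    refine ⟨by rwa [tableRun_info, hI.len], .inl (tableRun_tok_mono (r := H - (I y).depT + i + 1)
      (by omega) ?_)⟩
    rw [tableRun_tok_succ]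
    refine .inr ⟨y, _, TypedProtocol.inbox_eq_some_iff.2 ⟨hI.forestT.adj hp, rfl⟩,
      (tableRun_sendT hn).2 ⟨hp, ?_, hsend⟩⟩
    rw [hI.maxHop]

/-- By round `p.length + H` all tokens have arrived. A node in the tree of `s` forwards to the child
that sent the token, `u` forwards across the bypass edge, and a node in the tree of `t` forwards to
its parent. -/
lemma routesAround_entry (hI : IsPlan w p I cand H) {i : ℕ} (hi : i < p.length) (hn : i < n)
    {r : ℕ} (hr : p.length + H ≤ r) :
    RoutesAround G w s t (edgeAt p i) (fun x => (tableRun G w I r x).entry x i) := by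
  cases hc : cand i with
  | none =>
    refine .inr ⟨?_, fun x => ?_⟩
    · rintro ⟨q, hq⟩
      exact hq.2.1 (hI.not_detour i hi hc q)
    · have hch : (tableRun G w I r x).child i = none := by
        by_contra hne
        obtain ⟨y, hy⟩ := Option.ne_none_iff_exists'.1 hne
        obtain ⟨u, v, hu, -⟩ := tableRun_child_sound hI hi hn hy
        simp [hc] at hu
      have hT : ¬ (tableRun G w I r x).OnT x i := by
        rintro ⟨-, h | ⟨u, h⟩⟩
        · obtain ⟨u, v, hu, -⟩ := tableRun_tok_sound hI hi hn h
          simp [hc] at hu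
        · rw [tableRun_info, hI.cand_eq _ _ hi, hc] at h
          cases h
      simp only [TableState.entry, hch, tableRun_info, hI.cand_eq _ _ hi, hc, hT]
      simp
  | some uv =>
    obtain ⟨u, v⟩ := uv
    obtain ⟨q, hq, hlen, hH⟩ := hI.detour i hi u v hc
    have hpath := hq.isReplacementPath.1
    refine .inl ⟨q, hq.isReplacementPath, fun x => ?_⟩
    have hcx := hI.cand_eq x i hi
    cases hch : (tableRun G w I r x).child i with
    | some y =>
      simp only [TableState.entry, hch, Option.some_or]
      obtain ⟨u', v', hu, h1, h2⟩ := tableRun_child_sound hI hi hn hch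
      obtain ⟨rfl, rfl⟩ : u = u' ∧ v = v' := by simpa [hc] using hu
      exact ((nextHop_eq_some_iff hpath).2 ((hq.step_iff x y).2 (.inl ⟨h1, h2⟩))).symm
    | none =>
      simp only [TableState.entry, hch, Option.none_or, tableRun_info, hcx, hc, Option.map_some]
      by_cases hS : (tableRun G w I r x).OnS x i
      · rw [if_pos hS]
        obtain ⟨-, h | ⟨v', h⟩⟩ := hS
        · exact absurd hch h
        · rw [tableRun_info, hcx, hc] at h
          obtain ⟨rfl, -⟩ : u = x ∧ v = v' := by simpa using h
          exact ((nextHop_eq_some_iff hpath).2 ((hq.step_iff u v).2 (.inr (.inl ⟨rfl, rfl⟩)))).symm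
      · rw [if_neg hS]
        have hnS : ¬ Anc (fun x => (I x).parS) u x := fun h =>
          hS (tableRun_onS hI hi hn hc (by omega) h r (by omega))
        by_cases hT : (tableRun G w I r x).OnT x i
        · rw [if_pos hT]
          have hax : Anc (fun x => (I x).parT) v x := by
            obtain ⟨-, h | ⟨u', h⟩⟩ := hT
            · obtain ⟨u', v', hu, h1⟩ := tableRun_tok_sound hI hi hn h
              obtain ⟨rfl, rfl⟩ : u = u' ∧ v = v' := by simpa [hc] using hu
              exact h1
            · rw [tableRun_info, hcx, hc] at h
              obtain ⟨-, rfl⟩ : u = u' ∧ v = x := by simpa using h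
              exact .refl _
          cases hp : (I x).parT with
          | none =>
            obtain rfl := (hI.forestT.none_iff x).1 hp
            exact (nextHop_last hpath).symm
          | some y =>
            exact ((nextHop_eq_some_iff hpath).2
              ((hq.step_iff x y).2 (.inr (.inr ⟨hax, hp⟩)))).symm
        · rw [if_neg hT]
          refine (nextHop_eq_none_of_notMem q fun hm => ?_).symm
          rcases (hq.mem_support x).1 hm with h | h
          · exact hnS h
          · exact hT (tableRun_onT hI hi hn hc (by omega) h r (by omega))

lemma fits_tableMsg (n : ℕ) : Fits n 4 (Option (Fin n) × Option (Fin n)) :=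
  Fits.fin.option.prod Fits.fin.option

/-- Routing tables can be computed from the knowledge of the nodes. -/
lemma exists_computesTables (n : ℕ) {b : ℕ} (hb : 4 ≤ b) {In : Type} (info : Local n → In → Info n) :
    ∃ K : CongestAlg n b In (List (Option (Fin n))),
      (∀ (G : SimpleGraph (Fin n)) (w : Sym2 (Fin n) → ℕ) (s t : Fin n) (p : G.Walk s t)
        (inp : Fin n → In) (cand : ℕ → Option (Fin n × Fin n)) (H : ℕ), p.IsPath →
        IsPlan w p (fun v => info (localView G w v) (inp v)) cand H →
        ∀ r, p.length + H ≤ r → ComputesTables K G w p inp r) ∧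
      ∀ (G : SimpleGraph (Fin n)) (w : Sym2 (Fin n) → ℕ) (inp : Fin n → In) (r : ℕ) (v : Fin n),
        (info (localView G w v) (inp v)).len = 0 → (info (localView G w v) (inp v)).maxHop = 0 →
        K.output G w inp r v = some [] := by
  obtain ⟨enc, dec, hdec⟩ := ((fits_tableMsg n).mono hb).exists_code
  refine ⟨(tableProtocol n).toAlg enc dec (fun L x => .start (info L x))
    (fun L σ => σ.out L.id), ?_, fun G w inp r v hlen hhop =>
      CongestAlg.output_eq_of_le _ G w inp (r := 0) ?_ (Nat.zero_le r)⟩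
  swap
  · simp [CongestAlg.output, CongestAlg.states, Protocol.run, TypedProtocol.toAlg, TableState.out,
      TableState.start, hlen, hhop]
  intro G w s t p inp cand H hp hI r hr
  set I := fun v => info (localView G w v) (inp v) with hIdef
  have hout : ∀ r v, (tableRun G w I r v).out v = if p.length + H ≤ r then
      some ((List.range p.length).map ((tableRun G w I r v).entry v)) else none := by
    intro r v
    simp only [TableState.out, tableRun_info, tableRun_clock, hI.len, hI.maxHop]
  have hst := TypedProtocol.states_toAlg (tableProtocol n) hdec
    (init := fun L x => TableState.start (info L x)) (out := fun L σ => σ.out L.id) G w inp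
    (τ := p.length + H) (fun r hr v => (hout r v).trans (if_neg (by omega))) le_rfl
  -- The specification indexes entries by edges, the protocol by positions; on a path the two
  -- correspond because no edge repeats.
  have hidx : ∀ i < p.length, p.edges.idxOf (edgeAt p i) = i := by
    intro i hi
    have h1 : p.edges[i]'(by simpa using hi) = edgeAt p i := by simp [edges_eq_map_edgeAt]
    rw [← h1]
    exact hp.isTrail.edges_nodup.idxOf_getElem i _
  have hpn : p.length < n := by simpa using hp.length_lt
  refine ⟨fun e v => (tableRun G w I (p.length + H) v).entry v (p.edges.idxOf e), ?_, fun v => ?_⟩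
  · intro e he
    obtain ⟨i, hi, rfl⟩ := (mem_edges_iff p).1 he
    simp only [hidx i hi]
    exact routesAround_entry hI hi (by omega) le_rfl
  · refine CongestAlg.output_eq_of_le _ G w inp (r := p.length + H) ?_ hr
    rw [CongestAlg.output, hst]
    refine (hout _ v).trans ?_
    rw [if_pos le_rfl]
    conv_rhs => rw [edges_eq_map_edgeAt, List.map_map]
    congr 1
    refine List.map_congr_left fun i hi => ?_
    simp only [Function.comp]
    rw [← edges_eq_map_edgeAt, hidx i (by simpa using hi)]

end Tables
end RPaths

namespace RPaths

/-! ### On-the-fly construction -/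

section Reroute

variable {n : ℕ} {G : SimpleGraph (Fin n)} {w : Sym2 (Fin n) → ℕ} {s t : Fin n}

/-- The memory of a node: its parents in the two trees, its successor on the path and the bypass edge
for the edge to it; then the bypass edge for the failed edge, the next vertex on the detour in the
tree of `s`, and the message, as far as they are known. -/
structure Memory (n : ℕ) where
  parS : Option (Fin n)
  parT : Option (Fin n)
  succ : Option (Fin n)
  own : Option (Fin n × Fin n)
  bypass : Option (Fin n × Fin n)
  child : Option (Fin n)
  msg : Option (BitVec (wordLen n))

lemma fits_memory (n : ℕ) : Fits n 16 (Memory n) := by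
  have h2 : Fits n 2 (Option (Fin n)) := Fits.fin.option
  have h3 : Fits n 3 (Option (Fin n × Fin n)) := (Fits.fin.prod Fits.fin).option
  have hw : Fits n 2 (Option (BitVec (wordLen n))) := Fits.word.option
  refine (h2.prod (h2.prod (h2.prod (h3.prod (h3.prod (h2.prod hw)))))).of_injective
    (fun m => (m.parS, m.parT, m.succ, m.own, m.bypass, m.child, m.msg)) ?_
  rintro ⟨⟩ ⟨⟩ h
  simpa using h

instance (n : ℕ) : Nonempty (Memory n) := ⟨⟨none, none, none, none, none, none, none⟩⟩

namespace Memory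

/-- The token marks the nodes of the detour between `s` and the near end of the bypass edge. -/
def HasToken (x : Fin n) (m : Memory n) : Prop := m.child ≠ none ∨ ∃ v, m.bypass = some (x, v)

open Classical in
-- The last alternative is meant for nodes on the part in the tree of `t`; they recognize themselves
-- only by having received the message without a token.
noncomputable def hop (x : Fin n) (m : Memory n) : Option (Fin n) :=
  m.child.or (if ∃ v, m.bypass = some (x, v) then m.bypass.map Prod.snd else m.parT)

/-- Only `s` has no parent in its tree. It holds the message from the outset and must wait for the
token, whereas other nodes receive the message only if they are on the detour. -/
def Active (x : Fin n) (m : Memory n) : Prop := m.msg ≠ none ∧ (m.parS = none → m.HasToken x)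

def store (I : Info n) : Memory n := ⟨I.parS, I.parT, I.succ, I.own, none, none, none⟩

open Classical in
-- The failed edge leads to the successor at only one of its ends, so only that end starts the
-- flood.
noncomputable def wake (m : Memory n) (down : Fin n → Bool)
    (message : Option (BitVec (wordLen n))) : Memory n :=
  { m with
    bypass := if ∃ y, m.succ = some y ∧ down y then m.own else none
    msg := message }

open Classical in
noncomputable def read (x : Fin n) (m : Memory n) :
    Option (BitVec (wordLen n) × Option (Fin n)) :=
  if m.Active x then m.msg.map fun z => (z, m.hop x) else none

end Memory

open Classical in
/-- The bypass edge is flooded through the network, a token moves up to `s` in its tree from the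
near end of the bypass edge, and then the message moves along the detour. -/
noncomputable def rerouteProtocol (n : ℕ) :
    TypedProtocol n (Option (Fin n × Fin n) × Bool × Option (BitVec (wordLen n))) (Memory n) where
  send L m y := (m.bypass, decide (m.HasToken L.id ∧ m.parS = some y),
    if m.Active L.id ∧ m.hop L.id = some y then m.msg else none)
  recv _ m inbox :=
    { m with
      bypass := m.bypass.or (pick fun z => ∃ y k, inbox y = some k ∧ k.1 = some z)
      child := m.child.or (pick fun y => ∃ k, inbox y = some k ∧ k.2.1 = true)
      msg := m.msg.or (pick fun z => ∃ y k, inbox y = some k ∧ k.2.2 = some z) }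

lemma fits_rerouteMsg (n : ℕ) :
    Fits n 6 (Option (Fin n × Fin n) × Bool × Option (BitVec (wordLen n))) :=
  (Fits.fin.prod Fits.fin).option.prod (Fits.bool.prod Fits.word.option)

/-- The memories of the nodes after the failure of the edge `e`. -/
noncomputable def rerouteRun (G : SimpleGraph (Fin n)) (w : Sym2 (Fin n) → ℕ) (s : Fin n)
    (I : Fin n → Info n) (e : Sym2 (Fin n)) (z : BitVec (wordLen n)) : ℕ → Fin n → Memory n :=
  (rerouteProtocol n).run (G.deleteEdges {e}) (localView G w) (fun v => (Memory.store (I v)).wake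
    (fun u => decide (s(v, u) = e)) (if v = s then some z else none))

variable {p : G.Walk s t} {I : Fin n → Info n} {cand : ℕ → Option (Fin n × Fin n)} {H : ℕ}
  {e : Sym2 (Fin n)} {z : BitVec (wordLen n)}

lemma rerouteRun_parS (r : ℕ) (x : Fin n) : (rerouteRun G w s I e z r x).parS = (I x).parS := by
  induction r with
  | zero => rfl
  | succ r ih => exact ih

lemma rerouteRun_parT (r : ℕ) (x : Fin n) : (rerouteRun G w s I e z r x).parT = (I x).parT := by
  induction r with
  | zero => rfl
  | succ r ih => exact ih

lemma rerouteRun_bypass_succ (r : ℕ) (x : Fin n) {a : Fin n × Fin n}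
    (h : (rerouteRun G w s I e z (r + 1) x).bypass = some a) :
    (rerouteRun G w s I e z r x).bypass = some a ∨
      ∃ y, (rerouteRun G w s I e z r y).bypass = some a := by
  rw [rerouteRun, TypedProtocol.run, ← rerouteRun] at h
  rcases Option.or_eq_some_iff.1 h with h | ⟨-, h⟩
  · exact .inl h
  · obtain ⟨y, k, hk, hka⟩ := of_pick_eq_some h
    obtain ⟨-, rfl⟩ := TypedProtocol.inbox_eq_some_iff.1 hk
    exact .inr ⟨y, hka⟩

lemma rerouteRun_child_succ (r : ℕ) (x : Fin n) {y : Fin n}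
    (h : (rerouteRun G w s I e z (r + 1) x).child = some y) :
    (rerouteRun G w s I e z r x).child = some y ∨
      ((rerouteRun G w s I e z r y).HasToken y ∧ (I y).parS = some x) := by
  rw [rerouteRun, TypedProtocol.run, ← rerouteRun] at h
  rcases Option.or_eq_some_iff.1 h with h | ⟨-, h⟩
  · exact .inl h
  · obtain ⟨k, hk, hka⟩ := of_pick_eq_some h
    obtain ⟨-, rfl⟩ := TypedProtocol.inbox_eq_some_iff.1 hk
    simp only [rerouteProtocol, decide_eq_true_eq, rerouteRun_parS] at hka
    exact .inr hka

lemma rerouteRun_msg_succ (r : ℕ) (x : Fin n) {a : BitVec (wordLen n)}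
    (h : (rerouteRun G w s I e z (r + 1) x).msg = some a) :
    (rerouteRun G w s I e z r x).msg = some a ∨
      ∃ y, (rerouteRun G w s I e z r y).Active y ∧
        (rerouteRun G w s I e z r y).hop y = some x ∧
        (rerouteRun G w s I e z r y).msg = some a := by
  rw [rerouteRun, TypedProtocol.run, ← rerouteRun] at h
  rcases Option.or_eq_some_iff.1 h with h | ⟨-, h⟩
  · exact .inl h
  · obtain ⟨y, k, hk, hka⟩ := of_pick_eq_some h
    obtain ⟨-, rfl⟩ := TypedProtocol.inbox_eq_some_iff.1 hk
    simp only [rerouteProtocol] at hka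
    split_ifs at hka with hc
    exact .inr ⟨y, hc.1, hc.2, hka⟩

lemma rerouteRun_bypass_mono {r r' : ℕ} (hr : r ≤ r') {x : Fin n} {a : Fin n × Fin n}
    (h : (rerouteRun G w s I e z r x).bypass = some a) :
    (rerouteRun G w s I e z r' x).bypass = some a := by
  induction r', hr using Nat.le_induction with
  | base => exact h
  | succ r' _ ih => exact Option.or_eq_some_iff.2 (.inl ih)

lemma rerouteRun_child_mono {r r' : ℕ} (hr : r ≤ r') {x y : Fin n}
    (h : (rerouteRun G w s I e z r x).child = some y) :
    (rerouteRun G w s I e z r' x).child = some y := by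
  induction r', hr using Nat.le_induction with
  | base => exact h
  | succ r' _ ih => exact Option.or_eq_some_iff.2 (.inl ih)

lemma rerouteRun_msg_mono {r r' : ℕ} (hr : r ≤ r') {x : Fin n} {a : BitVec (wordLen n)}
    (h : (rerouteRun G w s I e z r x).msg = some a) :
    (rerouteRun G w s I e z r' x).msg = some a := by
  induction r', hr using Nat.le_induction with
  | base => exact h
  | succ r' _ ih => exact Option.or_eq_some_iff.2 (.inl ih)

lemma rerouteRun_hasToken_mono {r r' : ℕ} (hr : r ≤ r') {x : Fin n}
    (h : (rerouteRun G w s I e z r x).HasToken x) :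
    (rerouteRun G w s I e z r' x).HasToken x := by
  rcases h with h | ⟨v, h⟩
  · obtain ⟨y, hy⟩ := Option.ne_none_iff_exists'.1 h
    exact .inl (by simp [rerouteRun_child_mono hr hy])
  · exact .inr ⟨v, rerouteRun_bypass_mono hr h⟩

lemma rerouteRun_bypass_of_adj {r : ℕ} {x y : Fin n} (hadj : (G.deleteEdges {e}).Adj y x)
    (h : (rerouteRun G w s I e z r y).bypass ≠ none) :
    (rerouteRun G w s I e z (r + 1) x).bypass ≠ none := by
  rw [rerouteRun, TypedProtocol.run, ← rerouteRun]
  intro hn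
  obtain ⟨a, ha⟩ := Option.ne_none_iff_exists'.1 h
  exact pick_eq_none.1 (Option.or_eq_none_iff.1 hn).2 a
    ⟨y, _, TypedProtocol.inbox_eq_some_iff.2 ⟨hadj, rfl⟩, ha⟩

lemma rerouteRun_child_of_adj {r : ℕ} {x y : Fin n} (hadj : (G.deleteEdges {e}).Adj y x)
    (h : (rerouteRun G w s I e z r y).HasToken y) (hp : (I y).parS = some x) :
    (rerouteRun G w s I e z (r + 1) x).child ≠ none := by
  rw [rerouteRun, TypedProtocol.run, ← rerouteRun]
  intro hn
  refine pick_eq_none.1 (Option.or_eq_none_iff.1 hn).2 y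
    ⟨_, TypedProtocol.inbox_eq_some_iff.2 ⟨hadj, rfl⟩, ?_⟩
  simp only [rerouteProtocol, decide_eq_true_eq, rerouteRun_parS]
  exact ⟨h, hp⟩

lemma rerouteRun_msg_of_adj {r : ℕ} {x y : Fin n} (hadj : (G.deleteEdges {e}).Adj y x)
    (h : (rerouteRun G w s I e z r y).Active y)
    (hp : (rerouteRun G w s I e z r y).hop y = some x) :
    (rerouteRun G w s I e z (r + 1) x).msg ≠ none := by
  rw [rerouteRun, TypedProtocol.run, ← rerouteRun]
  intro hn
  obtain ⟨a, ha⟩ := Option.ne_none_iff_exists'.1 h.1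
  refine pick_eq_none.1 (Option.or_eq_none_iff.1 hn).2 a
    ⟨y, _, TypedProtocol.inbox_eq_some_iff.2 ⟨hadj, rfl⟩, ?_⟩
  simp only [rerouteProtocol]
  rw [if_pos ⟨h, hp⟩, ha]

lemma edgeAt_injOn (hp : p.IsPath) {i j : ℕ} (hi : i < p.length) (hj : j < p.length)
    (h : edgeAt p i = edgeAt p j) : i = j := by
  have hinj := hp.getVert_injOn
  rw [edgeAt, edgeAt, Sym2.eq_iff] at h
  rcases h with ⟨h, -⟩ | ⟨h1, h2⟩
  · exact hinj (by simpa using hi.le) (by simpa using hj.le) h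
  · have := hinj (by simpa using hi.le) (by simpa using hj) h1
    have := hinj (by simpa using hi) (by simpa using hj.le) h2
    omega

lemma rerouteRun_bypass_zero (hp : p.IsPath) (hI : IsPlan w p I cand H) {i : ℕ}
    (hi : i < p.length) {x : Fin n} {a : Fin n × Fin n}
    (h : (rerouteRun G w s I (edgeAt p i) z 0 x).bypass = some a) : cand i = some a := by
  simp only [rerouteRun, TypedProtocol.run, Memory.wake, Memory.store, decide_eq_true_eq] at h
  split_ifs at h with hc
  obtain ⟨y, hy, hxy⟩ := hc
  obtain ⟨j, hj, rfl, rfl⟩ := (hI.succ_iff x y).1 hy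
  obtain rfl := edgeAt_injOn hp hj hi hxy
  rw [← hI.own j hj, h]

lemma rerouteRun_bypass_start (hI : IsPlan w p I cand H) {i : ℕ} (hi : i < p.length) :
    (rerouteRun G w s I (edgeAt p i) z 0 (p.getVert i)).bypass = cand i := by
  simp only [rerouteRun, TypedProtocol.run, Memory.wake, Memory.store, decide_eq_true_eq]
  rw [if_pos ⟨_, (hI.succ_iff _ (p.getVert (i + 1))).2 ⟨i, hi, rfl, rfl⟩, rfl⟩, hI.own i hi]

lemma rerouteRun_bypass_sound (hp : p.IsPath) (hI : IsPlan w p I cand H) {i : ℕ}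
    (hi : i < p.length) {r : ℕ} {x : Fin n} {a : Fin n × Fin n}
    (h : (rerouteRun G w s I (edgeAt p i) z r x).bypass = some a) : cand i = some a := by
  induction r generalizing x with
  | zero => exact rerouteRun_bypass_zero hp hI hi h
  | succ r ih =>
    rcases rerouteRun_bypass_succ r x h with h | ⟨y, h⟩
    · exact ih h
    · exact ih h

/-- The last clause says that the child itself holds the token, so that a message forwarded to it
stays on the marked part of the detour. -/
lemma rerouteRun_child_sound (hp : p.IsPath) (hI : IsPlan w p I cand H) {i : ℕ}
    (hi : i < p.length) {r : ℕ} {x y : Fin n}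
    (h : (rerouteRun G w s I (edgeAt p i) z r x).child = some y) :
    (∃ u v, cand i = some (u, v) ∧ Anc (fun x => (I x).parS) u y) ∧ (I y).parS = some x ∧
      (rerouteRun G w s I (edgeAt p i) z r y).HasToken y := by
  induction r generalizing x y with
  | zero => cases h
  | succ r ih =>
    rcases rerouteRun_child_succ r x h with h | ⟨h, hpar⟩
    · obtain ⟨h1, h2, h3⟩ := ih h
      exact ⟨h1, h2, rerouteRun_hasToken_mono (Nat.le_succ r) h3⟩
    · refine ⟨?_, hpar, rerouteRun_hasToken_mono (Nat.le_succ r) h⟩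
      rcases h with h | ⟨v, h⟩
      · obtain ⟨a, ha⟩ := Option.ne_none_iff_exists'.1 h
        obtain ⟨⟨u, v, h1, h2⟩, h3, -⟩ := ih ha
        exact ⟨u, v, h1, h2.tail h3⟩
      · exact ⟨y, v, rerouteRun_bypass_sound hp hI hi h, .refl _⟩

lemma rerouteRun_not_hasToken (hp : p.IsPath) (hI : IsPlan w p I cand H) {i : ℕ}
    (hi : i < p.length) (hc : cand i = none) (r : ℕ) (x : Fin n) :
    ¬ (rerouteRun G w s I (edgeAt p i) z r x).HasToken x := by
  rintro (h | ⟨v, h⟩)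
  · obtain ⟨a, ha⟩ := Option.ne_none_iff_exists'.1 h
    obtain ⟨⟨u, v, h1, -⟩, -⟩ := rerouteRun_child_sound hp hI hi ha
    simp [hc] at h1
  · have := rerouteRun_bypass_sound hp hI hi h
    simp [hc] at this

/-- Without a bypass edge no token exists, so `s` never becomes active and the message never leaves
it. -/
lemma rerouteRun_not_active (hp : p.IsPath) (hI : IsPlan w p I cand H) {i : ℕ}
    (hi : i < p.length) (hc : cand i = none) (r : ℕ) (x : Fin n) :
    ¬ (rerouteRun G w s I (edgeAt p i) z r x).Active x := by
  have hmsg : ∀ r x, x ≠ s → (rerouteRun G w s I (edgeAt p i) z r x).msg = none := by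
    intro r
    induction r with
    | zero =>
      intro x hx
      simp [rerouteRun, TypedProtocol.run, Memory.wake, hx]
    | succ r ih =>
      intro x hx
      by_contra hne
      obtain ⟨a, ha⟩ := Option.ne_none_iff_exists'.1 hne
      rcases rerouteRun_msg_succ r x ha with h | ⟨y, h1, -⟩
      · simp [ih x hx] at h
      · by_cases hy : y = s
        · refine rerouteRun_not_hasToken hp hI hi hc r y (h1.2 ?_)
          rw [rerouteRun_parS]
          exact (hI.forestS.none_iff y).2 hy
        · exact h1.1 (ih y hy)
  intro h
  by_cases hx : x = s
  · refine rerouteRun_not_hasToken hp hI hi hc r x (h.2 ?_)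
    rw [rerouteRun_parS]
    exact (hI.forestS.none_iff x).2 hx
  · exact h.1 (hmsg r x hx)

/-! ### Soundness and timing of the rerouting when a bypass edge exists -/

section Detour

variable {i : ℕ} {u v : Fin n}

lemma rerouteRun_anc_of_hasToken (hp : p.IsPath) (hI : IsPlan w p I cand H)
    (hi : i < p.length) (hc : cand i = some (u, v)) {r : ℕ} {x : Fin n}
    (h : (rerouteRun G w s I (edgeAt p i) z r x).HasToken x) :
    Anc (fun x => (I x).parS) u x := by
  rcases h with h | ⟨v', h⟩
  · obtain ⟨y, hy⟩ := Option.ne_none_iff_exists'.1 h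
    obtain ⟨⟨u', v', h1, h2⟩, h3, -⟩ := rerouteRun_child_sound hp hI hi hy
    obtain ⟨rfl, rfl⟩ : u = u' ∧ v = v' := by simpa [hc] using h1
    exact h2.tail h3
  · have h1 := rerouteRun_bypass_sound hp hI hi h
    obtain ⟨rfl, rfl⟩ : u = x ∧ v = v' := by simpa [hc] using h1
    exact .refl _

/-- The message moves to a token holder, across the bypass edge, or up the tree of `t`. A sender
without a token can be neither `s`, which would not be active, nor a marked node, so its parent
pointer towards `t` is the right one. -/
lemma rerouteRun_msg_sound (hp : p.IsPath) (hI : IsPlan w p I cand H)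
    (hi : i < p.length) (hc : cand i = some (u, v)) {r : ℕ} {x : Fin n} {a : BitVec (wordLen n)}
    (h : (rerouteRun G w s I (edgeAt p i) z r x).msg = some a) :
    a = z ∧ (x = s ∨ (rerouteRun G w s I (edgeAt p i) z r x).HasToken x ∨
      Anc (fun x => (I x).parT) v x) := by
  induction r generalizing x with
  | zero =>
    simp only [rerouteRun, TypedProtocol.run, Memory.wake] at h
    split_ifs at h with hx
    exact ⟨(Option.some.inj h).symm, .inl hx⟩
  | succ r ih =>
    rcases rerouteRun_msg_succ r x h with h | ⟨y, hact, hhop, h⟩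
    · obtain ⟨h1, h2⟩ := ih h
      exact ⟨h1, h2.imp_right (.imp_left (rerouteRun_hasToken_mono (Nat.le_succ r)))⟩
    · obtain ⟨h1, h2⟩ := ih h
      refine ⟨h1, .inr ?_⟩
      rcases Option.or_eq_some_iff.1 hhop with hch | ⟨hch, hhop⟩
      · exact .inl (rerouteRun_hasToken_mono (Nat.le_succ r)
          (rerouteRun_child_sound hp hI hi hch).2.2)
      · split_ifs at hhop with hb
        · obtain ⟨v', hb⟩ := hb
          have h3 := rerouteRun_bypass_sound hp hI hi hb
          obtain ⟨rfl, rfl⟩ : u = y ∧ v = v' := by simpa [hc] using h3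
          rw [hb] at hhop
          obtain rfl : v = x := by simpa using hhop
          exact .inr (.refl _)
        · have hnt : ¬ (rerouteRun G w s I (edgeAt p i) z r y).HasToken y := fun h =>
            h.elim (fun h => h hch) hb
          rw [rerouteRun_parT] at hhop
          rcases h2 with rfl | h2 | h2
          · refine absurd (hact.2 ?_) hnt
            rw [rerouteRun_parS]
            exact (hI.forestS.none_iff y).2 rfl
          · exact absurd h2 hnt
          · exact .inr (h2.tail hhop)

variable {q : G.Walk s t}

lemma rerouteRun_active_sound (hp : p.IsPath) (hI : IsPlan w p I cand H)
    (hi : i < p.length) (hc : cand i = some (u, v))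
    (hq : IsDetour w (fun x => (I x).parS) (fun x => (I x).parT) (edgeAt p i) u v q)
    {r : ℕ} {x : Fin n} (h : (rerouteRun G w s I (edgeAt p i) z r x).Active x) :
    x ∈ q.support ∧ (rerouteRun G w s I (edgeAt p i) z r x).msg = some z ∧
      (rerouteRun G w s I (edgeAt p i) z r x).hop x = nextHop q x := by
  obtain ⟨a, ha⟩ := Option.ne_none_iff_exists'.1 h.1
  obtain ⟨rfl, hx⟩ := rerouteRun_msg_sound hp hI hi hc ha
  have hpath := hq.isReplacementPath.1
  have hx' : (rerouteRun G w s I (edgeAt p i) a r x).HasToken x ∨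
      Anc (fun x => (I x).parT) v x := by
    rcases hx with hx | hx
    · refine .inl (h.2 ?_)
      rw [rerouteRun_parS]
      exact (hI.forestS.none_iff x).2 hx
    · exact hx
  refine ⟨(hq.mem_support x).2 (hx'.imp_left (rerouteRun_anc_of_hasToken hp hI hi hc)), ha, ?_⟩
  unfold Memory.hop
  cases hch : (rerouteRun G w s I (edgeAt p i) a r x).child with
  | some y =>
    obtain ⟨⟨u', v', h1, h2⟩, h3, -⟩ := rerouteRun_child_sound hp hI hi hch
    obtain ⟨rfl, rfl⟩ : u = u' ∧ v = v' := by simpa [hc] using h1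
    exact ((nextHop_eq_some_iff hpath).2 ((hq.step_iff x y).2 (.inl ⟨h2, h3⟩))).symm
  | none =>
    rw [Option.none_or]
    split_ifs with hb
    · obtain ⟨v', hb⟩ := hb
      have h3 := rerouteRun_bypass_sound hp hI hi hb
      obtain ⟨rfl, rfl⟩ : u = x ∧ v = v' := by simpa [hc] using h3
      rw [hb]
      exact ((nextHop_eq_some_iff hpath).2 ((hq.step_iff u v).2 (.inr (.inl ⟨rfl, rfl⟩)))).symm
    · rcases hx' with hx' | hx'
      · exact absurd hx' fun h => h.elim (fun h => h hch) hb
      · rw [rerouteRun_parT]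
        cases hpar : (I x).parT with
        | none =>
          obtain rfl := (hI.forestT.none_iff x).1 hpar
          exact (nextHop_last hpath).symm
        | some y =>
          exact ((nextHop_eq_some_iff hpath).2
            ((hq.step_iff x y).2 (.inr (.inr ⟨hx', hpar⟩)))).symm

lemma IsDetour.adj_deleteEdges {parS parT : Fin n → Option (Fin n)}
    (hq : IsDetour w parS parT e u v q) {x y : Fin n} (h : Step q x y) :
    (G.deleteEdges {e}).Adj x y := by
  rw [SimpleGraph.deleteEdges_adj]
  exact ⟨h.adj, fun hm => hq.isReplacementPath.2.1 (Set.mem_singleton_iff.1 hm ▸ h.mem_edges)⟩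

lemma rerouteRun_bypass_of_walk {x y : Fin n} (q : (G.deleteEdges {e}).Walk x y) {r : ℕ}
    (h : (rerouteRun G w s I e z r x).bypass ≠ none) :
    (rerouteRun G w s I e z (r + q.length) y).bypass ≠ none := by
  induction q generalizing r with
  | nil => exact h
  | cons hadj q ih =>
    have := ih (rerouteRun_bypass_of_adj hadj h)
    rwa [SimpleGraph.Walk.length_cons, Nat.add_comm q.length, ← Nat.add_assoc]

/-- The flood can go back along `p` to `s` in `i` rounds and from there along the detour to `u`;
both pieces avoid the failed edge. -/
lemma rerouteRun_bypass_live (hp : p.IsPath) (hI : IsPlan w p I cand H)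
    (hi : i < p.length) (hc : cand i = some (u, v))
    (hq : IsDetour w (fun x => (I x).parS) (fun x => (I x).parT) (edgeAt p i) u v q)
    {r : ℕ} (hr : i + q.length ≤ r) :
    (rerouteRun G w s I (edgeAt p i) z r u).bypass = some (u, v) := by
  have hu : u ∈ q.support := (hq.mem_support u).2 (.inl (.refl _))
  let q₁ : G.Walk (p.getVert i) u := (p.take i).reverse.append (q.takeUntil u hu)
  have hq₁ : ∀ e ∈ q₁.edges, e ∉ ({edgeAt p i} : Set (Sym2 (Fin n))) := by
    intro e he hmem
    obtain rfl := Set.mem_singleton_iff.1 hmem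
    simp only [q₁, SimpleGraph.Walk.edges_append, SimpleGraph.Walk.edges_reverse,
      SimpleGraph.Walk.edges_take, List.mem_append, List.mem_reverse] at he
    rcases he with he | he
    · rw [edges_eq_map_edgeAt, ← List.map_take, List.take_range, List.mem_map] at he
      obtain ⟨j, hj, hji⟩ := he
      rw [List.mem_range] at hj
      have := edgeAt_injOn hp (by omega) hi hji
      omega
    · exact hq.isReplacementPath.2.1 (q.edges_takeUntil_subset_edges hu he)
  have h0 : (rerouteRun G w s I (edgeAt p i) z 0 (p.getVert i)).bypass ≠ none := by
    rw [rerouteRun_bypass_start hI hi, hc]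
    simp
  have h1 := rerouteRun_bypass_of_walk (q₁.toDeleteEdges _ hq₁) h0
  obtain ⟨a, ha⟩ := Option.ne_none_iff_exists'.1 h1
  have hlen : (q₁.toDeleteEdges _ hq₁).length ≤ i + q.length := by
    have := q.length_takeUntil_le_length hu
    simp [q₁]
    omega
  have ha' := rerouteRun_bypass_mono (r' := r) (by omega) ha
  have := rerouteRun_bypass_sound hp hI hi ha'
  rw [hc] at this
  rw [ha', this]

lemma rerouteRun_hasToken_live (hp : p.IsPath) (hI : IsPlan w p I cand H)
    (hi : i < p.length) (hc : cand i = some (u, v))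
    (hq : IsDetour w (fun x => (I x).parS) (fun x => (I x).parT) (edgeAt p i) u v q)
    {x : Fin n} (hx : Anc (fun x => (I x).parS) u x) :
    ∀ r, i + q.length + ((I u).depS - (I x).depS) ≤ r →
      (rerouteRun G w s I (edgeAt p i) z r x).HasToken x := by
  induction hx with
  | refl => exact fun r hr => .inr ⟨v, rerouteRun_bypass_live hp hI hi hc hq (by omega)⟩
  | @tail y x ha hpar ih =>
    intro r hr
    have hd := hI.forestS.succ hpar
    have hd' := hI.forestS.dep_le ha
    have hadj := hq.adj_deleteEdges ((hq.step_iff x y).2 (.inl ⟨ha, hpar⟩))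
    have h1 := ih _ le_rfl
    exact rerouteRun_hasToken_mono (r := i + q.length + ((I u).depS - (I y).depS) + 1)
      (by omega) (.inl (rerouteRun_child_of_adj hadj.symm h1 hpar))

lemma IsForest.anc_root {root : Fin n} {par : Fin n → Option (Fin n)} {dep : Fin n → ℕ}
    (hF : IsForest G root par dep) (x : Fin n) : Anc par x root := by
  induction h : dep x using Nat.strong_induction_on generalizing x with
  | _ k ih =>
  cases hx : par x with
  | none =>
    obtain rfl := (hF.none_iff x).1 hx
    exact .refl _
  | some y =>
    have := hF.succ hx
    exact (anc_iff hx).2 (.inr (ih (dep y) (by omega) y rfl))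

/-- The bypass edge reaches `u` by round `i + q.length`, the token reaches `s` after another `depS
u` rounds, and the message then advances one step of `q` per round. As `depS u < q.length`, all is
done by round `i + 3 * q.length`. -/
lemma rerouteRun_active_live (hp : p.IsPath) (hI : IsPlan w p I cand H)
    (hi : i < p.length) (hc : cand i = some (u, v))
    (hq : IsDetour w (fun x => (I x).parS) (fun x => (I x).parT) (edgeAt p i) u v q)
    (hlen : (I u).depS + 1 + (I v).depT = q.length) {x : Fin n} (hx : x ∈ q.support) {r : ℕ}
    (hr : i + 3 * q.length ≤ r) : (rerouteRun G w s I (edgeAt p i) z r x).Active x := by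
  have hroot := hI.forestS.anc_root u
  have hact : ∀ r x, i + q.length + (I u).depS ≤ r →
      (rerouteRun G w s I (edgeAt p i) z r x).msg ≠ none →
      (rerouteRun G w s I (edgeAt p i) z r x).Active x := by
    refine fun r x hr hm => ⟨hm, fun hpar => ?_⟩
    rw [rerouteRun_parS] at hpar
    obtain rfl := (hI.forestS.none_iff x).1 hpar
    exact rerouteRun_hasToken_live hp hI hi hc hq hroot r (by omega)
  have hmono : ∀ {r r' x}, r ≤ r' → (rerouteRun G w s I (edgeAt p i) z r x).msg ≠ none →
      (rerouteRun G w s I (edgeAt p i) z r' x).msg ≠ none := by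
    intro r r' x hr h
    obtain ⟨a, ha⟩ := Option.ne_none_iff_exists'.1 h
    simp [rerouteRun_msg_mono hr ha]
  have hstep : ∀ r x y, i + q.length + (I u).depS ≤ r → Step q x y →
      (rerouteRun G w s I (edgeAt p i) z r x).msg ≠ none →
      (rerouteRun G w s I (edgeAt p i) z (r + 1) y).msg ≠ none := by
    intro r x y hr hxy hm
    have ha := hact r x hr hm
    refine rerouteRun_msg_of_adj (hq.adj_deleteEdges hxy) ha ?_
    rw [(rerouteRun_active_sound hp hI hi hc hq ha).2.2,
      nextHop_eq_some_iff hq.isReplacementPath.1]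
    exact hxy
  have hS : ∀ k x, (I x).depS = k → Anc (fun x => (I x).parS) u x →
      (rerouteRun G w s I (edgeAt p i) z (i + q.length + (I u).depS + k) x).msg ≠ none := by
    intro k
    induction k with
    | zero =>
      intro x hk _
      cases hpar : (I x).parS with
      | none =>
        obtain rfl := (hI.forestS.none_iff x).1 hpar
        refine hmono (Nat.zero_le _) ?_
        simp [rerouteRun, TypedProtocol.run, Memory.wake]
      | some y =>
        have := hI.forestS.succ hpar
        omega
    | succ k ih =>
      intro x hk hx
      cases hpar : (I x).parS with
      | none =>
        obtain rfl := (hI.forestS.none_iff x).1 hpar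
        have := hI.forestS.dep_root
        omega
      | some y =>
        have := hI.forestS.succ hpar
        exact hstep (i + q.length + (I u).depS + k) y x (by omega)
          ((hq.step_iff y x).2 (.inl ⟨hx, hpar⟩))
          (ih y (by omega) (hx.tail hpar))
  have hT : ∀ x, Anc (fun x => (I x).parT) v x → ∀ r,
      i + q.length + (I u).depS + (I u).depS + 1 + ((I v).depT - (I x).depT) ≤ r →
      (rerouteRun G w s I (edgeAt p i) z r x).msg ≠ none := by
    intro x hx
    induction hx with
    | refl =>
      intro r hr
      exact hmono (by omega) (hstep _ u v (by omega)
        ((hq.step_iff u v).2 (.inr (.inl ⟨rfl, rfl⟩))) (hS _ u rfl (.refl _)))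
    | @tail y x ha hpar ih =>
      intro r hr
      have hd := hI.forestT.succ hpar
      have hd' := hI.forestT.dep_le ha
      exact hmono (by omega) (hstep _ y x (by omega)
        ((hq.step_iff y x).2 (.inr (.inr ⟨ha, hpar⟩))) (ih _ le_rfl))
  refine hact r x (by omega) ?_
  rcases (hq.mem_support x).1 hx with hx | hx
  · have := hI.forestS.dep_le hx
    exact hmono (by omega) (hS _ x rfl hx)
  · exact hT x hx r (by omega)

end Detour

/-- On-the-fly construction works with the knowledge of the nodes. -/
lemma exists_reroutesWithin (n : ℕ) {b c : ℕ} (hb : 6 ≤ b) (hc : 16 ≤ c) {In : Type}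
    (info : Local n → In → Info n) :
    ∃ R : OnTheFly n b c In,
      ∀ (G : SimpleGraph (Fin n)) (w : Sym2 (Fin n) → ℕ) (s t : Fin n) (p : G.Walk s t)
        (inp : Fin n → In) (cand : ℕ → Option (Fin n × Fin n)) (H : ℕ), p.IsPath →
        IsPlan w p (fun v => info (localView G w v) (inp v)) cand H →
        ReroutesWithin R G w p inp (p.length + 3 * hRep w p) := by
  obtain ⟨enc, dec, hdec⟩ := ((fits_rerouteMsg n).mono hb).exists_code
  obtain ⟨pack, unpack, hpack⟩ := ((fits_memory n).mono hc).exists_code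
  refine ⟨(rerouteProtocol n).toOnTheFly enc dec pack unpack (fun L x => .store (info L x))
    (fun _ m down z => m.wake down z) (fun L m => m.read L.id), ?_⟩
  intro G w s t p inp cand H hp hI e he z
  obtain ⟨i, hi, rfl⟩ := (mem_edges_iff p).1 he
  set I := fun v => info (localView G w v) (inp v) with hIdef
  simp only [TypedProtocol.verdict_toOnTheFly _ hdec hpack]
  change (∃ q : G.Walk s t, IsReplacementPath w (edgeAt p i) q ∧ ∀ r ≥ _, ∀ v,
      (rerouteRun G w s I (edgeAt p i) z r v).read v =
        if v ∈ q.support then some (z, nextHop q v) else none) ∨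
    ((¬ ∃ q : G.Walk s t, IsReplacementPath w (edgeAt p i) q) ∧ ∀ r ≥ _, ∀ v,
      (rerouteRun G w s I (edgeAt p i) z r v).read v = none)
  cases hcand : cand i with
  | none =>
    refine .inr ⟨?_, fun r _ v => if_neg (rerouteRun_not_active hp hI hi hcand r v)⟩
    rintro ⟨q, hq⟩
    exact hq.2.1 (hI.not_detour i hi hcand q)
  | some uv =>
    obtain ⟨u, v⟩ := uv
    obtain ⟨q, hq, hlen, hH⟩ := hI.detour i hi u v hcand
    refine .inl ⟨q, hq.isReplacementPath, fun r hr x => ?_⟩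
    have := hI.maxHop_le
    by_cases hx : x ∈ q.support
    · have hact := rerouteRun_active_live hp hI hi hcand hq hlen (z := z) (r := r) hx (by omega)
      obtain ⟨-, h1, h2⟩ := rerouteRun_active_sound hp hI hi hcand hq hact
      rw [if_pos hx, Memory.read, if_pos hact, h1, h2, Option.map_some]
    · rw [if_neg hx, Memory.read, if_neg fun hact =>
        hx (rerouteRun_active_sound hp hI hi hcand hq hact).1]

end Reroute
end RPaths

namespace RPaths

/-! ### The best bypass edge -/

section Best

variable {n : ℕ} {G : SimpleGraph (Fin n)} {w : Sym2 (Fin n) → ℕ} {s t : Fin n} {p : G.Walk s t}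
  {ds dt : Fin n → ℕ}

/-- A detour through the edge `xy` of length `l`, as a single number. -/
def detourCode (l : ℕ) (x y : Fin n) : ℕ := (l * n + x) * n + y

lemma detourCode_div (l : ℕ) (x y : Fin n) : detourCode l x y / n ^ 2 = l := by
  have hn : 0 < n := x.pos
  rw [detourCode, pow_two, ← Nat.div_div_eq_div_mul, mul_comm _ n, Nat.mul_add_div hn,
    Nat.div_eq_of_lt y.2, add_zero, mul_comm _ n, Nat.mul_add_div hn, Nat.div_eq_of_lt x.2, add_zero]

/-- The edge `xy` read off from the number of a detour. -/
def decodeEdge (x₀ : Fin n) (c : ℕ) : Fin n × Fin n :=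
  (⟨c / n % n, Nat.mod_lt _ x₀.pos⟩, ⟨c % n, Nat.mod_lt _ x₀.pos⟩)

lemma decodeEdge_detourCode (x₀ : Fin n) (l : ℕ) (x y : Fin n) :
    decodeEdge x₀ (detourCode l x y) = (x, y) := by
  have hn : 0 < n := x.pos
  refine Prod.ext (Fin.ext ?_) (Fin.ext ?_)
  · simp only [decodeEdge, detourCode]
    rw [mul_comm _ n, Nat.mul_add_div hn, Nat.div_eq_of_lt y.2, add_zero, mul_comm _ n,
      Nat.mul_add_mod, Nat.mod_eq_of_lt x.2]
  · simp only [decodeEdge, detourCode]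
    rw [mul_comm _ n, Nat.mul_add_mod, Nat.mod_eq_of_lt y.2]

lemma le_of_detourCode_le {l l' : ℕ} {x y x' y' : Fin n}
    (h : detourCode l x y ≤ detourCode l' x' y') : l ≤ l' := by
  rw [← detourCode_div l x y, ← detourCode_div l' x' y']
  exact Nat.div_le_div_right h

/-- The length of the detour through `xy`. -/
noncomputable def detourLength (w : Sym2 (Fin n) → ℕ) (p : G.Walk s t) (ds dt : Fin n → ℕ)
    (x y : Fin n) : ℕ :=
  ds x + perturb w p.edges s(x, y) + dt y

/-- The numbers of the detours for the edge number `i` of `p`, and infinity. -/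
def IsDetourValue (w : Sym2 (Fin n) → ℕ) (p : G.Walk s t) (ds dt : Fin n → ℕ) (i : ℕ) (c : ℕ∞) :
    Prop :=
  c = ⊤ ∨ ∃ x y, IsCand p ds dt i x y ∧ c = detourCode (detourLength w p ds dt x y) x y

/-- The best detour through an edge that starts at `x`. -/
noncomputable def bestFrom (w : Sym2 (Fin n) → ℕ) (p : G.Walk s t) (ds dt : Fin n → ℕ) (i : ℕ)
    (x : Fin n) : ℕ∞ :=
  sInf {c | ∃ y, IsCand p ds dt i x y ∧ c = detourCode (detourLength w p ds dt x y) x y}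

/-- The best detour. -/
noncomputable def best (w : Sym2 (Fin n) → ℕ) (p : G.Walk s t) (ds dt : Fin n → ℕ) (i : ℕ) : ℕ∞ :=
  ⨅ x, bestFrom w p ds dt i x

lemma isDetourValue_sInf {i : ℕ} {S : Set ℕ∞} (h : ∀ c ∈ S, IsDetourValue w p ds dt i c) :
    IsDetourValue w p ds dt i (sInf S) := by
  rcases S.eq_empty_or_nonempty with rfl | hS
  · exact .inl sInf_empty
  · exact h _ (csInf_mem hS)

lemma IsDetourValue.inf {i : ℕ} {c c' : ℕ∞} (h : IsDetourValue w p ds dt i c)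
    (h' : IsDetourValue w p ds dt i c') : IsDetourValue w p ds dt i (c ⊓ c') := by
  rcases min_choice c c' with hm | hm
  · exact hm.symm ▸ h
  · exact hm.symm ▸ h'

lemma isDetourValue_bestFrom (i : ℕ) (x : Fin n) :
    IsDetourValue w p ds dt i (bestFrom w p ds dt i x) := by
  refine isDetourValue_sInf ?_
  rintro c ⟨y, hy, rfl⟩
  exact .inr ⟨x, y, hy, rfl⟩

lemma isDetourValue_best (i : ℕ) : IsDetourValue w p ds dt i (best w p ds dt i) := by
  refine isDetourValue_sInf ?_
  rintro c ⟨x, rfl⟩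
  exact isDetourValue_bestFrom i x

lemma IsDetourValue.best_le {i : ℕ} {c : ℕ∞} (h : IsDetourValue w p ds dt i c) :
    best w p ds dt i ≤ c := by
  rcases h with rfl | ⟨x, y, h, rfl⟩
  · exact le_top
  · exact (iInf_le _ x).trans (sInf_le ⟨y, h, rfl⟩)

/-- The length occupies the leading digits of the number and the edge the last two, so the least
number belongs to a shortest detour and names one definite edge. -/
lemma best_eq_top_or (i : ℕ) :
    (best w p ds dt i = ⊤ ∧ ∀ x y, ¬ IsCand p ds dt i x y) ∨
      ∃ x y, IsCand p ds dt i x y ∧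
        best w p ds dt i = detourCode (detourLength w p ds dt x y) x y ∧
        ∀ x' y', IsCand p ds dt i x' y' →
          detourLength w p ds dt x y ≤ detourLength w p ds dt x' y' := by
  rcases isDetourValue_best (w := w) (p := p) (ds := ds) (dt := dt) i with h | ⟨x, y, h, hb⟩
  · refine .inl ⟨h, fun x y hxy => ?_⟩
    have : best w p ds dt i ≤ _ := IsDetourValue.best_le (.inr ⟨x, y, hxy, rfl⟩)
    rw [h] at this
    exact absurd this (by simp)
  · refine .inr ⟨x, y, h, hb, fun x' y' h' => ?_⟩
    have : best w p ds dt i ≤ _ := IsDetourValue.best_le (.inr ⟨x', y', h', rfl⟩)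
    rw [hb] at this
    exact le_of_detourCode_le (x := x) (y := y) (x' := x') (y' := y') (by exact_mod_cast this)

/-- The weight of a replacement path, read off from the best detour. -/
noncomputable def weightOf (n : ℕ) (c : ℕ∞) : ℕ∞ :=
  -- The first division removes the edge, the second the perturbation.
  if c = ⊤ then ⊤ else (c.toNat / n ^ 2 / n ^ 2 : ℕ)

/-- The vertex `x₀` only witnesses `0 < n`. The value does not depend on it, so nodes that insert
their own identifiers agree. -/
noncomputable def candOf (x₀ : Fin n) (c : ℕ∞) : Option (Fin n × Fin n) :=
  if c = ⊤ then none else some (decodeEdge x₀ c.toNat)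

/-- The default `0` is neutral in the maximum over all edges of the path. -/
noncomputable def hopsOf (n : ℕ) (c : ℕ∞) : ℕ :=
  if c = ⊤ then 0 else hopOf n (c.toNat / n ^ 2)

lemma candOf_detourCode (x₀ : Fin n) (l : ℕ) (x y : Fin n) :
    candOf x₀ (detourCode l x y : ℕ) = some (x, y) := by
  rw [candOf, if_neg (ENat.natCast_ne_top _), ENat.toNat_natCast, decodeEdge_detourCode]

lemma hopsOf_detourCode (l : ℕ) (x y : Fin n) :
    hopsOf n (detourCode l x y : ℕ) = hopOf n l := by
  rw [hopsOf, if_neg (ENat.natCast_ne_top _), ENat.toNat_natCast, detourCode_div]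

lemma weightOf_detourCode (l : ℕ) (x y : Fin n) :
    weightOf n (detourCode l x y : ℕ) = (l / n ^ 2 : ℕ) := by
  rw [weightOf, if_neg (ENat.natCast_ne_top _), ENat.toNat_natCast, detourCode_div]

lemma weightOf_best (hp : IsShortestPath w p) (hs : IsDist G (perturb w p.edges) s ds)
    (ht : IsDist G (perturb w p.edges) t dt) {i : ℕ} (hi : i < p.length) :
    weightOf n (best w p ds dt i) = replacementWeight G w s t (edgeAt p i) := by
  rcases best_eq_top_or (w := w) (p := p) (ds := ds) (dt := dt) i with ⟨h, hno⟩ | ⟨x, y, h, hb, hmin⟩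
  · rw [h, weightOf, if_pos rfl,
      replacementWeight_eq_top (not_isCand_of_forall_not hp hs ht hi hno)]
  · obtain ⟨q, hq, -⟩ := hs x
    obtain ⟨q', hq', -⟩ := ht y
    obtain ⟨h1, h2⟩ := h.isReplacementPath hp hs ht hi hmin hq hq'
    rw [hb, weightOf_detourCode, replacementWeight_eq h1, detourLength, ← h2,
      (decode_weight _ h1.1).2.2]

/-- The best detours follow the shortest path trees. -/
lemma exists_isDetour (hp : IsShortestPath w p) (hs : IsDist G (perturb w p.edges) s ds)
    (ht : IsDist G (perturb w p.edges) t dt) {parS parT : Fin n → Option (Fin n)}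
    (hparS : IsParent G (perturb w p.edges) s ds parS)
    (hparT : IsParent G (perturb w p.edges) t dt parT) {i : ℕ} (hi : i < p.length)
    (x₀ : Fin n) {u v : Fin n} (hc : candOf x₀ (best w p ds dt i) = some (u, v)) :
    ∃ q : G.Walk s t, IsDetour w parS parT (edgeAt p i) u v q ∧
      hopOf n (ds u) + 1 + hopOf n (dt v) = q.length ∧
      hopsOf n (best w p ds dt i) = q.length := by
  rcases best_eq_top_or (w := w) (p := p) (ds := ds) (dt := dt) i with ⟨h, -⟩ | ⟨x, y, h, hb, hmin⟩
  · simp [h, candOf] at hc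
  · rw [hb, candOf_detourCode] at hc
    obtain ⟨rfl, rfl⟩ : x = u ∧ y = v := by simpa using hc
    obtain ⟨q, hq, hqs, hqst⟩ := hparS.exists_walk (perturb_pos w _) hs x
    obtain ⟨q', hq', hqs', hqst'⟩ := hparT.exists_walk (perturb_pos w _) ht y
    obtain ⟨h1, h2⟩ := h.isReplacementPath hp hs ht hi hmin hq hq'
    refine ⟨_, ⟨h1, fun z => ?_, fun z z' => ?_⟩, ?_, ?_⟩
    · rw [SimpleGraph.Walk.mem_support_append_iff, SimpleGraph.Walk.support_cons, List.mem_cons,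
        SimpleGraph.Walk.support_reverse, List.mem_reverse, hqs, hqs']
      constructor
      · rintro (h | rfl | h)
        · exact .inl h
        · exact .inl (.refl _)
        · exact .inr h
      · exact Or.imp_right .inr
    · rw [step_append, step_cons, step_reverse, hqst, hqst']
    · simp [hopOf_eq_length hs hq, hopOf_eq_length ht hq']
      omega
    · rw [hb, hopsOf_detourCode, detourLength, ← h2, (decode_weight _ h1.1).1]

end Best

end RPaths

namespace RPaths

/-! ### The preprocessing -/

section Prep

/-- Numbers of `q` words. -/
abbrev Num (n q : ℕ) : Type := Fin (2 ^ (q * wordLen n))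

/-- The reduction makes the function total; the bounds in `IsPrep` ensure that it does not alter the
relevant numbers. -/
def toNum (n q x : ℕ) : Num n q := ⟨x % 2 ^ (q * wordLen n), Nat.mod_lt _ (Nat.two_pow_pos _)⟩

lemma val_toNum {n q x : ℕ} (h : x < 2 ^ (q * wordLen n)) : (toNum n q x).val = x :=
  Nat.mod_eq_of_lt h

lemma le_two_pow_wordLen (n : ℕ) {q : ℕ} (hq : 1 ≤ q) : n ≤ 2 ^ (q * wordLen n) :=
  (Nat.lt_pow_succ_log_self (b := 2) (by norm_num) n).le.trans
    (Nat.pow_le_pow_right (by norm_num) (Nat.le_mul_of_pos_left _ hq))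

noncomputable def toVal (n q : ℕ) (c : ℕ∞) : Option (Num n q) :=
  if c = ⊤ then none else some (toNum n q c.toNat)

def ofVal {n q : ℕ} : Option (Num n q) → ℕ∞
  | none => ⊤
  | some x => (x.val : ℕ∞)

lemma ofVal_toVal {n q : ℕ} {c : ℕ∞} (h : c = ⊤ ∨ ∃ x : ℕ, x < 2 ^ (q * wordLen n) ∧ c = x) :
    ofVal (toVal n q c) = c := by
  rcases h with rfl | ⟨x, hx, rfl⟩
  · simp [toVal, ofVal]
  · rw [toVal, if_neg (ENat.natCast_ne_top _), ENat.toNat_natCast, ofVal, val_toNum hx]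

/-- A message of the preprocessing: messages of the two copies of the given algorithm, the hop
distance from `s`, whether all nodes farther from `s` have finished, whether the aggregation starts,
the distances from `s` and `t`, and the best detour for one edge of the path. -/
structure PrepMsg (n b q : ℕ) where
  msgS : Option (Msg n b)
  msgT : Option (Msg n b)
  depth : Option (Num n q)
  complete : Bool
  start : Bool
  ds : Option (Num n q)
  dt : Option (Num n q)
  item : Option (Num n q × Option (Num n q))

lemma fits_prepMsg (n b q : ℕ) : Fits n (2 * b + 5 * q + 9) (PrepMsg n b q) := by
  have hb : Fits n (b + 1) (Option (Msg n b)) := Fits.bitVec.option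
  have hq : Fits n (q + 1) (Option (Num n q)) := Fits.finPow.option
  have hi : Fits n (q + (q + 1) + 1) (Option (Num n q × Option (Num n q))) :=
    (Fits.finPow.prod hq).option
  have hbool : Fits n 1 Bool := Fits.bool
  refine ((hb.prod (hb.prod (hq.prod (hbool.prod (hbool.prod (hq.prod
    (hq.prod hi))))))).mono (q' := 2 * b + 5 * q + 9) (by omega)).of_injective
    (fun m => (m.msgS, m.msgT, m.depth, m.complete, m.start, m.ds, m.dt, m.item)) ?_
  rintro ⟨⟩ ⟨⟩ h
  simpa using h

instance (n b q : ℕ) : Nonempty (PrepMsg n b q) :=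
  ⟨⟨none, none, none, false, false, none, none, none⟩⟩

/-- The state of a node during the preprocessing. -/
structure PrepState (n b q : ℕ) (St : Type) where
  clock : ℕ
  path : List (Fin n)
  stS : St
  stT : St
  depth : Option ℕ
  start : Option ℕ
  acc : ℕ → ℕ∞
  inbox : Fin n → Option (PrepMsg n b q)

/-- The edges between consecutive elements of a list. -/
def listEdges {n : ℕ} (l : List (Fin n)) : List (Sym2 (Fin n)) :=
  List.zipWith (fun a b => s(a, b)) l l.tail

open Classical in
/-- The local view of a node with respect to the perturbed weights. -/
noncomputable def perturbLocal {n : ℕ} (l : List (Fin n)) (L : Local n) : Local n where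
  id := L.id
  link u := (L.link u).map fun a =>
    n ^ 2 * a + n * (if s(L.id, u) ∈ listEdges l then 0 else 1) + 1

variable {n b q : ℕ} {S : Type} (A : CongestAlg n b (Fin n × S) ℕ)

namespace PrepState

variable (L : Local n) (σ : PrepState n b q A.State)

noncomputable def outS : Option ℕ := A.out (perturbLocal σ.path L) σ.stS

noncomputable def outT : Option ℕ := A.out (perturbLocal σ.path L) σ.stT

/-- The node and all nodes behind it have finished. -/
def Complete : Prop :=
  σ.outS A L ≠ none ∧ σ.outT A L ≠ none ∧ ∀ y, L.link y ≠ none →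
    ∃ m d d', σ.inbox y = some m ∧ m.depth = some d ∧ σ.depth = some d' ∧
      (d.val ≤ d' ∨ m.complete = true)

/-- The best detour through an edge that starts at the node. -/
noncomputable def localBest (i : ℕ) : ℕ∞ :=
  sInf {c | ∃ y a d d' m, (perturbLocal σ.path L).link y = some a ∧ σ.outS A L = some d ∧
    σ.inbox y = some m ∧ m.dt = some d' ∧ (listEdges σ.path)[i]? ≠ some s(L.id, y) ∧
    onOf n d ≤ i ∧ onOf n d'.val + i + 1 ≤ σ.path.length - 1 ∧
    c = detourCode (d + a + d'.val) L.id y}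

noncomputable def bestKnown (i : ℕ) : ℕ∞ := σ.acc i ⊓ σ.localBest A L i

end PrepState

/-- In round `r` a node in depth `d` sends its value for the edge number `i`: first towards `s`,
then away from it. -/
def IsSlot (τ d h r i : ℕ) : Prop :=
  i < h ∧ (r = 2 * τ + 1 + (τ - d) + i ∨ r = 2 * τ + 1 + τ + h + d + i)

/-- The upward slots of a node end before its downward slots begin, so one value per round suffices.
-/
lemma IsSlot.unique {τ d h r i j : ℕ} (hi : IsSlot τ d h r i) (hj : IsSlot τ d h r j) : i = j := by
  unfold IsSlot at hi hj
  omega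

open Classical in
noncomputable def prepSend (L : Local n) (σ : PrepState n b q A.State) (y : Fin n) :
    PrepMsg n b q where
  msgS := A.code.send (perturbLocal σ.path L) σ.stS y
  msgT := A.code.send (perturbLocal σ.path L) σ.stT y
  depth := σ.depth.map (toNum n q)
  complete := decide (σ.Complete A L)
  start := decide (σ.start ≠ none)
  ds := (σ.outS A L).map (toNum n q)
  dt := (σ.outT A L).map (toNum n q)
  item := (pick fun i => ∃ τ d, σ.start = some τ ∧ σ.depth = some d ∧
    IsSlot τ d (σ.path.length - 1) σ.clock i).map
      fun i => (toNum n q i, toVal n q (σ.bestKnown A L i))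

open Classical in
noncomputable def prepRecv (L : Local n) (σ : PrepState n b q A.State)
    (inbox : Fin n → Option (PrepMsg n b q)) : PrepState n b q A.State :=
  let σ' : PrepState n b q A.State :=
    { clock := σ.clock + 1
      path := σ.path
      stS := A.code.recv (perturbLocal σ.path L) σ.stS fun u => (inbox u).bind PrepMsg.msgS
      stT := A.code.recv (perturbLocal σ.path L) σ.stT fun u => (inbox u).bind PrepMsg.msgT
      depth := σ.depth.or
        (if ∃ y m, inbox y = some m ∧ m.depth ≠ none then some (σ.clock + 1) else none)
      start := σ.start
      acc := fun i => σ.acc i ⊓ sInf {c | ∃ y m a, inbox y = some m ∧ m.item = some a ∧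
        a.1.val = i ∧ c = ofVal a.2}
      inbox := inbox }
  -- Completeness is judged by the updated inbox, so `start` is set after the other fields.
  { σ' with
    start := σ.start.or
      (if L.id = σ.path.headD L.id then (if σ'.Complete A L then some (σ.clock + 1) else none)
      else if ∃ y m, inbox y = some m ∧ m.start = true then
        -- The start signal travels one hop per round, so subtracting the depth recovers the round
        -- in which `s` issued it, and all nodes store the same number.
        some (σ.clock + 1 - σ'.depth.getD 0) else none) }

noncomputable def prepProtocol : TypedProtocol n (PrepMsg n b q) (PrepState n b q A.State) where
  send := prepSend A
  recv := prepRecv A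

open Classical in
noncomputable def prepInit (L : Local n) (inp : List (Fin n) × S) : PrepState n b q A.State where
  clock := 0
  path := inp.1
  stS := A.init (perturbLocal inp.1 L) (inp.1.headD L.id, inp.2)
  stT := A.init (perturbLocal inp.1 L) (inp.1.getLastD L.id, inp.2)
  depth := if L.id = inp.1.headD L.id then some 0 else none
  start := none
  acc _ := ⊤
  inbox _ := none

noncomputable def prepOut (L : Local n) (σ : PrepState n b q A.State) : Option (List ℕ∞) :=
  -- A path without edges must be answered at once, since the required time bound has no additive
  -- constant.
  if σ.path.length ≤ 1 then some []
  -- Depths are at most `τ`, so the last downward slot is at most `4 τ + 2 h`; its message arrives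
  -- one round later.
  else σ.start.bind fun τ => if 4 * τ + 2 * (σ.path.length - 1) + 1 ≤ σ.clock then
    some ((List.range (σ.path.length - 1)).map fun i => weightOf n (σ.bestKnown A L i)) else none

/-! ### Correctness of the preprocessing: simulation, hop layers and termination -/

section Correctness

variable {A} {G : SimpleGraph (Fin n)} {w : Sym2 (Fin n) → ℕ} {s t : Fin n} {p : G.Walk s t}
  {ρ : Fin n → S}

lemma listEdges_support (p : G.Walk s t) : listEdges p.support = p.edges := by
  induction p with
  | nil => rfl
  | @cons a b c h q ih =>
    rw [SimpleGraph.Walk.support_cons, SimpleGraph.Walk.edges_cons, ← ih]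
    cases q <;> rfl

lemma headD_support (p : G.Walk s t) (x : Fin n) : p.support.headD x = s := by
  cases p <;> rfl

lemma getLastD_support (p : G.Walk s t) (x : Fin n) : p.support.getLastD x = t := by
  rw [List.getLastD_eq_getLast?, List.getLast?_eq_some_getLast p.support_ne_nil, Option.getD_some,
    p.getLast_support]

lemma perturbLocal_localView (p : G.Walk s t) (v : Fin n) :
    perturbLocal p.support (localView G w v) = localView G (perturb w p.edges) v := by
  classical
  simp only [perturbLocal, localView, listEdges_support, Local.mk.injEq, true_and]
  funext u
  split_ifs with h <;> simp [perturb, *]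

/-- The states of the nodes in the preprocessing. -/
noncomputable def prepRun (q : ℕ) (A : CongestAlg n b (Fin n × S) ℕ) (G : SimpleGraph (Fin n))
    (w : Sym2 (Fin n) → ℕ) {s t : Fin n} (p : G.Walk s t) (ρ : Fin n → S) :
    ℕ → Fin n → PrepState n b q A.State :=
  (prepProtocol A).run G (localView G w)
    (fun v => prepInit A (localView G w v) (p.support, ρ v))

lemma prepRun_succ (r : ℕ) (v : Fin n) : prepRun q A G w p ρ (r + 1) v =
    prepRecv A (localView G w v) (prepRun q A G w p ρ r v)
      ((prepProtocol A).inbox G (localView G w) (prepRun q A G w p ρ r) v) := rfl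

lemma prepRun_clock (r : ℕ) (v : Fin n) : (prepRun q A G w p ρ r v).clock = r := by
  induction r with
  | zero => rfl
  | succ r ih => exact congrArg (· + 1) ih

lemma prepRun_path (r : ℕ) (v : Fin n) : (prepRun q A G w p ρ r v).path = p.support := by
  induction r with
  | zero => rfl
  | succ r ih => exact ih

lemma prepRun_inbox_eq_some_iff {r : ℕ} {v u : Fin n} {m : PrepMsg n b q} :
    (prepRun q A G w p ρ (r + 1) v).inbox u = some m ↔
      G.Adj u v ∧ prepSend A (localView G w u) (prepRun q A G w p ρ r u) v = m :=
  TypedProtocol.inbox_eq_some_iff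

/-- Every node knows the path and can therefore perturb the weights of its own links, so the
simulated copy runs exactly on the perturbed instance. -/
lemma prepRun_stS (r : ℕ) (v : Fin n) : (prepRun q A G w p ρ r v).stS =
    A.states G (perturb w p.edges) (fun u => (s, ρ u)) r v := by
  induction r generalizing v with
  | zero =>
    change A.init (perturbLocal p.support (localView G w v)) (p.support.headD _, ρ v) = _
    rw [headD_support, perturbLocal_localView]
    rfl
  | succ r ih =>
    rw [CongestAlg.states, Protocol.run, ← CongestAlg.states]
    beta_reduce
    have h1 : (prepRun q A G w p ρ (r + 1) v).stS =
        A.code.recv (perturbLocal (prepRun q A G w p ρ r v).path (localView G w v))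
          (prepRun q A G w p ρ r v).stS (fun u => ((prepProtocol A).inbox G (localView G w)
            (prepRun q A G w p ρ r) v u).bind PrepMsg.msgS) := rfl
    rw [← ih, ← perturbLocal_localView, h1, prepRun_path]
    congr 1
    funext u
    unfold TypedProtocol.inbox
    split_ifs with h
    · rw [Option.bind_some, ← ih, ← perturbLocal_localView]
      simp only [prepProtocol, prepSend, prepRun_path]
    · rfl

lemma prepRun_stT (r : ℕ) (v : Fin n) : (prepRun q A G w p ρ r v).stT =
    A.states G (perturb w p.edges) (fun u => (t, ρ u)) r v := by
  induction r generalizing v with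
  | zero =>
    change A.init (perturbLocal p.support (localView G w v)) (p.support.getLastD _, ρ v) = _
    rw [getLastD_support, perturbLocal_localView]
    rfl
  | succ r ih =>
    rw [CongestAlg.states, Protocol.run, ← CongestAlg.states]
    beta_reduce
    have h1 : (prepRun q A G w p ρ (r + 1) v).stT =
        A.code.recv (perturbLocal (prepRun q A G w p ρ r v).path (localView G w v))
          (prepRun q A G w p ρ r v).stT (fun u => ((prepProtocol A).inbox G (localView G w)
            (prepRun q A G w p ρ r) v u).bind PrepMsg.msgT) := rfl
    rw [← ih, ← perturbLocal_localView, h1, prepRun_path]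
    congr 1
    funext u
    unfold TypedProtocol.inbox
    split_ifs with h
    · rw [Option.bind_some, ← ih, ← perturbLocal_localView]
      simp only [prepProtocol, prepSend, prepRun_path]
    · rfl

lemma prepRun_outS (r : ℕ) (v : Fin n) :
    (prepRun q A G w p ρ r v).outS A (localView G w v) =
      A.output G (perturb w p.edges) (fun u => (s, ρ u)) r v := by
  rw [PrepState.outS, prepRun_path, prepRun_stS, perturbLocal_localView, CongestAlg.output]

lemma prepRun_outT (r : ℕ) (v : Fin n) :
    (prepRun q A G w p ρ r v).outT A (localView G w v) =
      A.output G (perturb w p.edges) (fun u => (t, ρ u)) r v := by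
  rw [PrepState.outT, prepRun_path, prepRun_stT, perturbLocal_localView, CongestAlg.output]

/-! ### Hop distances -/

lemma exists_adj_dist (hG : G.Connected) {x z : Fin n} {k : ℕ} (h : G.dist x z = k + 1) :
    ∃ y, G.Adj x y ∧ G.dist y z = k := by
  obtain ⟨q, hq⟩ := hG.exists_walk_length_eq_dist x z
  cases q with
  | nil => simp at h
  | @cons _ y _ hadj q =>
    refine ⟨y, hadj, le_antisymm ?_ ?_⟩
    · have := G.dist_le q
      rw [SimpleGraph.Walk.length_cons] at hq
      omega
    · have := hG.dist_triangle (u := x) (v := y) (w := z)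
      rw [SimpleGraph.dist_eq_one_iff_adj.2 hadj] at this
      omega

lemma dist_le_succ_of_adj (hG : G.Connected) {x y : Fin n} (h : G.Adj x y) (z : Fin n) :
    G.dist z y ≤ G.dist z x + 1 := by
  have := hG.dist_triangle (u := z) (v := x) (w := y)
  rwa [SimpleGraph.dist_eq_one_iff_adj.2 h] at this

lemma dist_lt (hG : G.Connected) (x y : Fin n) : G.dist x y < n := by
  obtain ⟨q, hq, hl⟩ := hG.exists_path_of_dist x y
  simpa [hl] using hq.length_lt

open Classical in
lemma prepRun_depth_succ (r : ℕ) (v : Fin n) : (prepRun q A G w p ρ (r + 1) v).depth =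
    (prepRun q A G w p ρ r v).depth.or
      (if ∃ y, G.Adj y v ∧ (prepRun q A G w p ρ r y).depth ≠ none then some (r + 1) else none) := by
  rw [prepRun_succ, prepRecv]
  simp only [prepRun_clock]
  congr 1
  refine if_congr ?_ rfl rfl
  constructor
  · rintro ⟨y, m, hm, h⟩
    obtain ⟨hadj, rfl⟩ := TypedProtocol.inbox_eq_some_iff.1 hm
    exact ⟨y, hadj, by simpa [prepProtocol, prepSend] using h⟩
  · rintro ⟨y, hadj, h⟩
    exact ⟨y, _, TypedProtocol.inbox_eq_some_iff.2 ⟨hadj, rfl⟩,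
      by simpa [prepProtocol, prepSend] using h⟩

lemma prepRun_depth (hG : G.Connected) (r : ℕ) (v : Fin n) :
    (prepRun q A G w p ρ r v).depth = if G.dist s v ≤ r then some (G.dist s v) else none := by
  induction r generalizing v with
  | zero =>
    simp only [prepRun, TypedProtocol.run, prepInit, headD_support, localView]
    by_cases hv : v = s
    · subst hv
      simp
    · have : G.dist s v ≠ 0 := fun h => hv ((hG.dist_eq_zero_iff.1 h).symm)
      rw [if_neg hv, if_neg (by omega)]
  | succ r ih =>
    rw [prepRun_depth_succ, ih v]
    by_cases h1 : G.dist s v ≤ r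
    · rw [if_pos h1, if_pos (show G.dist s v ≤ r + 1 by omega), Option.some_or]
    · rw [if_neg h1, Option.none_or]
      by_cases h2 : G.dist s v ≤ r + 1
      · have h3 : G.dist v s = r + 1 := by rw [SimpleGraph.dist_comm]; omega
        obtain ⟨y, hy, hys⟩ := exists_adj_dist hG h3
        rw [SimpleGraph.dist_comm] at hys
        rw [if_pos h2, if_pos ⟨y, hy.symm, by rw [ih, if_pos (by omega)]; simp⟩]
        congr 1; omega
      · rw [if_neg h2, if_neg]
        rintro ⟨y, hy, hm⟩
        have := dist_le_succ_of_adj hG hy s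
        rw [ih, if_neg (by omega)] at hm
        exact hm rfl

lemma prepRun_depth_eq_some (hG : G.Connected) {r d : ℕ} {v : Fin n}
    (h : (prepRun q A G w p ρ r v).depth = some d) : d = G.dist s v := by
  rw [prepRun_depth hG] at h
  split_ifs at h
  exact (Option.some.inj h).symm

/-! ### Detection of termination -/

lemma lt_two_pow_of_lt (hq : 1 ≤ q) {x : ℕ} (hx : x < n) : x < 2 ^ (q * wordLen n) :=
  hx.trans_le (le_two_pow_wordLen n hq)

lemma localView_link_ne_none {v y : Fin n} : (localView G w v).link y ≠ none ↔ G.Adj v y := by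
  simp [localView]

lemma complete_pred (hG : G.Connected) (hq : 1 ≤ q) {r : ℕ} {v y : Fin n}
    (h : (prepRun q A G w p ρ r v).Complete A (localView G w v)) (hadj : G.Adj v y)
    (hd : G.dist s y = G.dist s v + 1) :
    ∃ r', r = r' + 1 ∧ (prepRun q A G w p ρ r' y).Complete A (localView G w y) := by
  obtain ⟨m, d, d', h1, h2, h3, h4⟩ := h.2.2 y (localView_link_ne_none.2 hadj)
  cases r with
  | zero => simp [prepRun, TypedProtocol.run, prepInit] at h1
  | succ r =>
    refine ⟨r, rfl, ?_⟩
    obtain ⟨-, rfl⟩ := prepRun_inbox_eq_some_iff.1 h1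
    have hd' := prepRun_depth_eq_some hG h3
    simp only [prepSend, Option.map_eq_some_iff] at h2
    obtain ⟨x, hx, rfl⟩ := h2
    have hx' := prepRun_depth_eq_some hG hx
    rw [val_toNum (lt_two_pow_of_lt hq (hx' ▸ dist_lt hG s y))] at h4
    rcases h4 with h4 | h4
    · omega
    · simpa [prepSend] using h4

/-- A complete node has heard of the completion of its neighbours in the next hop layer, and this is
iterated along a hop-shortest path. For `v = s` it applies to all nodes and also bounds their depths
by the current round. -/
lemma complete_sound (hG : G.Connected) (hq : 1 ≤ q) {k : ℕ} : ∀ {r : ℕ} {v z : Fin n},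
    (prepRun q A G w p ρ r v).Complete A (localView G w v) → G.dist v z = k →
    G.dist s z = G.dist s v + k →
    k ≤ r ∧ (prepRun q A G w p ρ (r - k) z).Complete A (localView G w z) := by
  induction k with
  | zero =>
    intro r v z h hvz _
    obtain rfl := hG.dist_eq_zero_iff.1 hvz
    exact ⟨Nat.zero_le _, h⟩
  | succ k ih =>
    intro r v z h hvz hsz
    obtain ⟨y, hy, hyz⟩ := exists_adj_dist hG hvz
    have h1 := dist_le_succ_of_adj hG hy s
    have h2 := hG.dist_triangle (u := s) (v := y) (w := z)
    obtain ⟨r', rfl, h'⟩ := complete_pred hG hq h hy (by omega)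
    obtain ⟨h3, h4⟩ := ih h' hyz (by omega)
    exact ⟨by omega, by rwa [Nat.add_sub_add_right]⟩

/-- By round `T + D` all outputs and depths are known; neighbours hear of them one round later, and
then completeness moves inward by one layer per round. -/
lemma complete_live (hG : G.Connected) (hq : 1 ≤ q) {T D : ℕ} (hD : ∀ v, G.dist s v ≤ D)
    (hS : ∀ r ≥ T, ∀ v, A.output G (perturb w p.edges) (fun u => (s, ρ u)) r v ≠ none)
    (hT : ∀ r ≥ T, ∀ v, A.output G (perturb w p.edges) (fun u => (t, ρ u)) r v ≠ none)
    (k : ℕ) : ∀ (v : Fin n) (r : ℕ), D - G.dist s v = k → T + D + 1 + k ≤ r →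
      (prepRun q A G w p ρ r v).Complete A (localView G w v) := by
  induction k using Nat.strong_induction_on with
  | _ k ih =>
  intro v r hk hr
  obtain ⟨r, rfl⟩ : ∃ r', r = r' + 1 := ⟨r - 1, by omega⟩
  refine ⟨by rw [prepRun_outS]; exact hS _ (by omega) v,
    by rw [prepRun_outT]; exact hT _ (by omega) v, fun y hy => ?_⟩
  have hadj := localView_link_ne_none.1 hy
  have hv := hD v
  have hy := hD y
  refine ⟨_, toNum n q (G.dist s y), G.dist s v, prepRun_inbox_eq_some_iff.2 ⟨hadj.symm, rfl⟩,
    ?_, ?_, ?_⟩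
  · simp only [prepSend]
    rw [prepRun_depth hG, if_pos (by omega), Option.map_some]
  · rw [prepRun_depth hG, if_pos (by omega)]
  · rw [val_toNum (lt_two_pow_of_lt hq (dist_lt hG s y))]
    by_cases hle : G.dist s y ≤ G.dist s v
    · exact .inl hle
    · refine .inr ?_
      simp only [prepSend, decide_eq_true_eq]
      exact ih (D - G.dist s y) (by omega) y r rfl (by omega)

/-- The round in which `s` learns that all nodes have finished. -/
def IsReady (q : ℕ) (A : CongestAlg n b (Fin n × S) ℕ) (G : SimpleGraph (Fin n))
    (w : Sym2 (Fin n) → ℕ) {s t : Fin n} (p : G.Walk s t) (ρ : Fin n → S) (τ : ℕ) : Prop :=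
  (prepRun q A G w p ρ τ s).Complete A (localView G w s) ∧
    ∀ r < τ, ¬ (prepRun q A G w p ρ r s).Complete A (localView G w s)

open Classical in
lemma exists_isReady (hG : G.Connected) (hq : 1 ≤ q) {T D : ℕ} (hD : ∀ v, G.dist s v ≤ D)
    (hS : ∀ r ≥ T, ∀ v, A.output G (perturb w p.edges) (fun u => (s, ρ u)) r v ≠ none)
    (hT : ∀ r ≥ T, ∀ v, A.output G (perturb w p.edges) (fun u => (t, ρ u)) r v ≠ none) :
    ∃ τ ≤ T + 2 * D + 1, IsReady q A G w p ρ τ := by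
  have h := complete_live (q := q) hG hq hD hS hT D s (T + D + 1 + D) (by simp) le_rfl
  have hex : ∃ r, (prepRun q A G w p ρ r s).Complete A (localView G w s) := ⟨_, h⟩
  have h1 := Nat.find_min' hex h
  exact ⟨Nat.find hex, by omega, Nat.find_spec hex, fun r hr => Nat.find_min hex hr⟩

open Classical in
lemma prepRun_start_succ (r : ℕ) (v : Fin n) : (prepRun q A G w p ρ (r + 1) v).start =
    (prepRun q A G w p ρ r v).start.or
      (if v = s then (if (prepRun q A G w p ρ (r + 1) v).Complete A (localView G w v)
        then some (r + 1) else none)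
      else if ∃ y, G.Adj y v ∧ (prepRun q A G w p ρ r y).start ≠ none then
        some (r + 1 - (prepRun q A G w p ρ (r + 1) v).depth.getD 0) else none) := by
  have hid : ((localView G w v).id = (prepRun q A G w p ρ r v).path.headD (localView G w v).id) ↔
      v = s := by
    rw [prepRun_path, headD_support]; rfl
  rw [prepRun_succ, prepRecv]
  simp only [prepRun_clock, hid]
  congr 1
  refine if_congr Iff.rfl rfl (if_congr ?_ rfl rfl)
  constructor
  · rintro ⟨y, m, hm, h⟩
    obtain ⟨hadj, rfl⟩ := TypedProtocol.inbox_eq_some_iff.1 hm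
    exact ⟨y, hadj, by simpa [prepProtocol, prepSend] using h⟩
  · rintro ⟨y, hadj, h⟩
    exact ⟨y, _, TypedProtocol.inbox_eq_some_iff.2 ⟨hadj, rfl⟩,
      by simpa [prepProtocol, prepSend] using h⟩

lemma prepRun_start (hG : G.Connected) {τ : ℕ} (hτ : IsReady q A G w p ρ τ) (hτ0 : 0 < τ) (r : ℕ)
    (v : Fin n) : (prepRun q A G w p ρ r v).start =
      if τ + G.dist s v ≤ r then some τ else none := by
  induction r generalizing v with
  | zero =>
    rw [if_neg (by omega)]
    rfl
  | succ r ih =>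
    rw [prepRun_start_succ, prepRun_depth hG, ih v]
    by_cases h1 : τ + G.dist s v ≤ r
    · rw [if_pos h1, if_pos (show τ + G.dist s v ≤ r + 1 by omega), Option.some_or]
    · rw [if_neg h1, Option.none_or]
      by_cases hv : v = s
      · subst hv
        rw [SimpleGraph.dist_self, add_zero] at h1 ⊢
        rw [if_pos rfl]
        by_cases h2 : τ ≤ r + 1
        · obtain rfl : τ = r + 1 := by omega
          rw [if_pos hτ.1, if_pos le_rfl]
        · rw [if_neg (hτ.2 _ (by omega)), if_neg h2]
      · rw [if_neg hv]
        have hd : G.dist s v ≠ 0 := fun h => hv ((hG.dist_eq_zero_iff.1 h).symm)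
        by_cases h2 : τ + G.dist s v ≤ r + 1
        · obtain ⟨k, hk⟩ : ∃ k, G.dist v s = k + 1 :=
            ⟨G.dist v s - 1, by rw [SimpleGraph.dist_comm]; omega⟩
          obtain ⟨y, hy, hys⟩ := exists_adj_dist hG hk
          rw [SimpleGraph.dist_comm] at hys hk
          rw [if_pos h2, if_pos ⟨y, hy.symm, by rw [ih, if_pos (by omega)]; simp⟩,
            if_pos (show G.dist s v ≤ r + 1 by omega), Option.getD_some]
          congr 1; omega
        · rw [if_neg h2, if_neg]
          rintro ⟨y, hy, hm⟩
          have := dist_le_succ_of_adj hG hy s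
          rw [ih, if_neg (by omega)] at hm
          exact hm rfl

end Correctness

end Prep

end RPaths

namespace RPaths

/-! ### Aggregation of the best detours -/

section Aggregate

variable {n b q : ℕ} {S : Type} {A : CongestAlg n b (Fin n × S) ℕ} {G : SimpleGraph (Fin n)}
  {w : Sym2 (Fin n) → ℕ} {s t : Fin n} {p : G.Walk s t} {ρ : Fin n → S} {ds dt : Fin n → ℕ} {τ : ℕ}

/-- The given algorithm outputs nothing but the distances from `s` and `t`, all nodes have finished
in round `τ`, and all relevant numbers fit into `q` words. -/
structure IsPrep (q : ℕ) (A : CongestAlg n b (Fin n × S) ℕ) (G : SimpleGraph (Fin n))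
    (w : Sym2 (Fin n) → ℕ) {s t : Fin n} (p : G.Walk s t) (ρ : Fin n → S) (ds dt : Fin n → ℕ)
    (τ : ℕ) : Prop where
  connected : G.Connected
  one_le : 1 ≤ q
  pos : 0 < p.length
  isShortestPath : IsShortestPath w p
  isDistS : IsDist G (perturb w p.edges) s ds
  isDistT : IsDist G (perturb w p.edges) t dt
  outS : ∀ r v d, A.output G (perturb w p.edges) (fun u => (s, ρ u)) r v = some d → d = ds v
  outT : ∀ r v d, A.output G (perturb w p.edges) (fun u => (t, ρ u)) r v = some d → d = dt v
  isReady : IsReady q A G w p ρ τ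
  ds_lt : ∀ v, ds v < 2 ^ (q * wordLen n)
  dt_lt : ∀ v, dt v < 2 ^ (q * wordLen n)
  code_lt : ∀ x y, G.Adj x y → detourCode (detourLength w p ds dt x y) x y < 2 ^ (q * wordLen n)

namespace IsPrep

lemma dist_le (h : IsPrep q A G w p ρ ds dt τ) (v : Fin n) : G.dist s v ≤ τ :=
  (complete_sound h.connected h.one_le h.isReady.1 rfl (by simp)).1

/-- Completeness of `s` in round `τ` means that `v` had finished earlier, and outputs do not change.
-/
lemma outS_eq (h : IsPrep q A G w p ρ ds dt τ) {r : ℕ} (hr : τ ≤ r) (v : Fin n) :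
    (prepRun q A G w p ρ r v).outS A (localView G w v) = some (ds v) := by
  have h1 := (complete_sound (z := v) h.connected h.one_le h.isReady.1 rfl (by simp)).2.1
  obtain ⟨d, hd⟩ := Option.ne_none_iff_exists'.1 h1
  rw [prepRun_outS] at hd ⊢
  rw [A.output_eq_of_le G _ _ hd (by omega), h.outS _ _ _ hd]

lemma outT_eq (h : IsPrep q A G w p ρ ds dt τ) {r : ℕ} (hr : τ ≤ r) (v : Fin n) :
    (prepRun q A G w p ρ r v).outT A (localView G w v) = some (dt v) := by
  have h1 := (complete_sound (z := v) h.connected h.one_le h.isReady.1 rfl (by simp)).2.2.1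
  obtain ⟨d, hd⟩ := Option.ne_none_iff_exists'.1 h1
  rw [prepRun_outT] at hd ⊢
  rw [A.output_eq_of_le G _ _ hd (by omega), h.outT _ _ _ hd]

/-- As the path has an edge, `s` has a neighbour and cannot be complete before receiving a message
from it. -/
lemma tau_pos (h : IsPrep q A G w p ρ ds dt τ) : 0 < τ := by
  rcases Nat.eq_zero_or_pos τ with rfl | h0
  · have hadj := p.adj_getVert_succ h.pos
    rw [p.getVert_zero] at hadj
    obtain ⟨m, d, d', h1, -⟩ := h.isReady.1.2.2 _ (localView_link_ne_none.2 hadj)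
    simp [prepRun, TypedProtocol.run, prepInit] at h1
  · exact h0

lemma start_eq (h : IsPrep q A G w p ρ ds dt τ) {r : ℕ} {v : Fin n} (hr : τ + G.dist s v ≤ r) :
    (prepRun q A G w p ρ r v).start = some τ := by
  rw [prepRun_start h.connected h.isReady h.tau_pos, if_pos hr]

lemma start_eq_some (h : IsPrep q A G w p ρ ds dt τ) {r τ' : ℕ} {v : Fin n}
    (hr : (prepRun q A G w p ρ r v).start = some τ') : τ' = τ := by
  rw [prepRun_start h.connected h.isReady h.tau_pos] at hr
  split_ifs at hr
  exact (Option.some.inj hr).symm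

lemma inbox_eq (h : IsPrep q A G w p ρ ds dt τ) {r : ℕ} (hr : τ + 1 ≤ r) {v y : Fin n}
    {m : PrepMsg n b q} (hm : (prepRun q A G w p ρ r v).inbox y = some m) :
    G.Adj y v ∧ m.ds = some (toNum n q (ds y)) ∧ m.dt = some (toNum n q (dt y)) := by
  obtain ⟨r, rfl⟩ : ∃ r', r = r' + 1 := ⟨r - 1, by omega⟩
  obtain ⟨hadj, rfl⟩ := prepRun_inbox_eq_some_iff.1 hm
  refine ⟨hadj, ?_, ?_⟩
  · rw [prepSend, h.outS_eq (by omega), Option.map_some]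
  · rw [prepSend, h.outT_eq (by omega), Option.map_some]

lemma exists_inbox {r : ℕ} {v y : Fin n} (hr : 1 ≤ r) (hadj : G.Adj y v) :
    ∃ m, (prepRun q A G w p ρ r v).inbox y = some m := by
  obtain ⟨r, rfl⟩ : ∃ r', r = r' + 1 := ⟨r - 1, by omega⟩
  exact ⟨_, prepRun_inbox_eq_some_iff.2 ⟨hadj, rfl⟩⟩

/-- One round after `τ` every inbox contains the final distances of the neighbours, and these decide
which incident edges are candidates. -/
lemma localBest_eq (h : IsPrep q A G w p ρ ds dt τ) {r : ℕ} (hr : τ + 1 ≤ r) (v : Fin n) {i : ℕ}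
    (hi : i < p.length) :
    (prepRun q A G w p ρ r v).localBest A (localView G w v) i = bestFrom w p ds dt i v := by
  unfold PrepState.localBest bestFrom
  congr 1
  ext c
  have hid : (localView G w v).id = v := rfl
  have hedge : (listEdges p.support)[i]? = some (edgeAt p i) := by
    rw [listEdges_support, edges_eq_map_edgeAt]
    simp [hi]
  simp only [prepRun_path, perturbLocal_localView, hedge, h.outS_eq (show τ ≤ r by omega), hid,
    SimpleGraph.Walk.length_support, Nat.add_sub_cancel, Set.mem_ofPred_eq]
  constructor
  · rintro ⟨y, a, d, d', m, h1, h2, h3, h4, h5, h6, h7, rfl⟩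
    obtain ⟨hadj, -, hdt⟩ := h.inbox_eq hr h3
    obtain rfl := Option.some.inj h2
    rw [hdt] at h4
    obtain rfl := Option.some.inj h4
    rw [val_toNum (h.dt_lt y)] at h7 ⊢
    refine ⟨y, ⟨hadj.symm, fun he => h5 (he ▸ rfl), h6, h7⟩, ?_⟩
    simp only [localView, if_pos hadj.symm] at h1
    rw [← Option.some.inj h1, detourLength]
  · rintro ⟨y, ⟨hadj, h5, h6, h7⟩, rfl⟩
    obtain ⟨m, hm⟩ := exists_inbox (q := q) (A := A) (w := w) (p := p) (ρ := ρ)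
      (show 1 ≤ r by omega) hadj.symm
    obtain ⟨-, -, hdt⟩ := h.inbox_eq hr hm
    refine ⟨y, perturb w p.edges s(v, y), ds v, toNum n q (dt y), m, by simp [localView, hadj], rfl,
      hm, hdt, fun he => h5 (Option.some.inj he).symm, h6, ?_, ?_⟩
    · rwa [val_toNum (h.dt_lt y)]
    · rw [val_toNum (h.dt_lt y), detourLength]

lemma acc_succ (r : ℕ) (v : Fin n) (i : ℕ) : (prepRun q A G w p ρ (r + 1) v).acc i =
    (prepRun q A G w p ρ r v).acc i ⊓ sInf {c | ∃ y m a,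
      (prepProtocol A).inbox G (localView G w) (prepRun q A G w p ρ r) v y = some m ∧
        m.item = some a ∧ a.1.val = i ∧ c = ofVal a.2} := rfl

lemma ofVal_toVal_of_isDetourValue (h : IsPrep q A G w p ρ ds dt τ) {i : ℕ} {c : ℕ∞}
    (hc : IsDetourValue w p ds dt i c) : ofVal (toVal n q c) = c := by
  refine ofVal_toVal (hc.imp_right ?_)
  rintro ⟨x, y, hxy, rfl⟩
  exact ⟨_, h.code_lt x y hxy.1, rfl⟩

lemma length_lt (h : IsPrep q A G w p ρ ds dt τ) : p.length < n := by
  simpa using h.isShortestPath.1.length_lt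

lemma exists_slot (h : IsPrep q A G w p ρ ds dt τ) {r : ℕ} {y v : Fin n}
    {a : Num n q × Option (Num n q)}
    (ha : (prepSend A (localView G w y) (prepRun q A G w p ρ r y) v).item = some a) :
    ∃ j < p.length, τ + 1 ≤ r ∧ a.1.val = j ∧
      a.2 = toVal n q ((prepRun q A G w p ρ r y).acc j ⊓ bestFrom w p ds dt j y) := by
  simp only [prepSend, Option.map_eq_some_iff] at ha
  obtain ⟨j, hj, rfl⟩ := ha
  obtain ⟨τ', d, h1, -, h3, h4⟩ := of_pick_eq_some hj
  obtain rfl := h.start_eq_some h1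
  rw [prepRun_path, SimpleGraph.Walk.length_support, Nat.add_sub_cancel] at h3
  rw [prepRun_clock] at h4
  have hr : τ' + 1 ≤ r := by omega
  refine ⟨j, h3, hr, val_toNum (lt_two_pow_of_lt h.one_le (h3.trans h.length_lt)), ?_⟩
  rw [PrepState.bestKnown, h.localBest_eq hr y h3]

/-- Whatever arrives from any neighbour is the number of a genuine detour or infinity, so the
accumulated value never drops below `best`. The minimum being idempotent, values can be sent to all
neighbours and no tree is needed. -/
lemma isDetourValue_acc (h : IsPrep q A G w p ρ ds dt τ) (r : ℕ) (v : Fin n) (i : ℕ) :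
    IsDetourValue w p ds dt i ((prepRun q A G w p ρ r v).acc i) := by
  induction r generalizing v i with
  | zero => exact .inl rfl
  | succ r ih =>
    rw [acc_succ]
    refine (ih v i).inf (isDetourValue_sInf ?_)
    rintro c ⟨y, m, a, hm, ha, rfl, rfl⟩
    obtain ⟨hadj, rfl⟩ := TypedProtocol.inbox_eq_some_iff.1 hm
    obtain ⟨j, hj, -, h1, h2⟩ := h.exists_slot ha
    have hv := (ih y j).inf (isDetourValue_bestFrom j y)
    rwa [h2, h.ofVal_toVal_of_isDetourValue hv, h1]

lemma acc_anti {r r' : ℕ} (hr : r ≤ r') (v : Fin n) (i : ℕ) :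
    (prepRun q A G w p ρ r' v).acc i ≤ (prepRun q A G w p ρ r v).acc i := by
  induction r', hr using Nat.le_induction with
  | base => exact le_rfl
  | succ r' _ ih =>
    rw [acc_succ]
    exact inf_le_left.trans ih

lemma acc_le_of_slot (h : IsPrep q A G w p ρ ds dt τ) {r i : ℕ} {y v : Fin n} (hadj : G.Adj y v)
    (hslot : IsSlot τ (G.dist s y) p.length r i) :
    (prepRun q A G w p ρ (r + 1) v).acc i ≤
      (prepRun q A G w p ρ r y).acc i ⊓ bestFrom w p ds dt i y := by
  have hi := hslot.1
  have hd := h.dist_le y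
  have hr : 2 * τ + 1 ≤ r := by
    have := hslot.2
    omega
  have hpick : (pick fun i => ∃ τ d, (prepRun q A G w p ρ r y).start = some τ ∧
      (prepRun q A G w p ρ r y).depth = some d ∧
      IsSlot τ d ((prepRun q A G w p ρ r y).path.length - 1) (prepRun q A G w p ρ r y).clock i) =
        some i := by
    rw [prepRun_path, SimpleGraph.Walk.length_support, Nat.add_sub_cancel, prepRun_clock,
      h.start_eq (by omega), prepRun_depth h.connected, if_pos (by omega)]
    refine pick_eq_some_of_unique ⟨τ, _, rfl, rfl, hslot⟩ ?_
    rintro j ⟨τ', d, h1, h2, h3⟩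
    obtain rfl := Option.some.inj h1
    obtain rfl := Option.some.inj h2
    exact h3.unique hslot
  rw [acc_succ]
  refine inf_le_right.trans (sInf_le ⟨y, _, (toNum n q i, toVal n q
    ((prepRun q A G w p ρ r y).bestKnown A (localView G w y) i)),
    TypedProtocol.inbox_eq_some_iff.2 ⟨hadj, rfl⟩, ?_, ?_, ?_⟩)
  · simp only [prepProtocol, prepSend]
    rw [hpick, Option.map_some]
  · exact val_toNum (lt_two_pow_of_lt h.one_le (hi.trans h.length_lt))
  · rw [PrepState.bestKnown, h.localBest_eq (by omega) y hi, h.ofVal_toVal_of_isDetourValue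
      ((h.isDetourValue_acc r y i).inf (isDetourValue_bestFrom i y))]

/-- Deeper layers send value number `i` one round earlier, so by its slot a node has collected
everything lying behind it as seen from `s`. -/
lemma up_le (h : IsPrep q A G w p ρ ds dt τ) {i : ℕ} (hi : i < p.length) {k : ℕ} :
    ∀ {r : ℕ} {v z : Fin n}, G.dist v z = k → G.dist s z = G.dist s v + k →
      2 * τ + 1 + (τ - G.dist s v) + i ≤ r →
      (prepRun q A G w p ρ r v).acc i ⊓ bestFrom w p ds dt i v ≤ bestFrom w p ds dt i z := by
  induction k with
  | zero =>
    intro r v z hvz _ _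
    obtain rfl := h.connected.dist_eq_zero_iff.1 hvz
    exact inf_le_right
  | succ k ih =>
    intro r v z hvz hsz hr
    obtain ⟨y, hy, hyz⟩ := exists_adj_dist h.connected hvz
    have h1 := dist_le_succ_of_adj h.connected hy s
    have h2 := h.connected.dist_triangle (u := s) (v := y) (w := z)
    have h3 := h.dist_le z
    have h4 := h.acc_le_of_slot (r := 2 * τ + 1 + (τ - G.dist s y) + i) (i := i) hy.symm
      ⟨hi, .inl rfl⟩
    refine inf_le_left.trans ((acc_anti (r := 2 * τ + 1 + (τ - G.dist s y) + i + 1)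
      (by omega) v i).trans (h4.trans (ih hyz (by omega) le_rfl)))

/-- At `s` all nodes have been collected; the result then spreads outward by one layer per round. -/
lemma down_le (h : IsPrep q A G w p ρ ds dt τ) {i : ℕ} (hi : i < p.length) {k : ℕ} :
    ∀ {r : ℕ} {v : Fin n}, G.dist s v = k → 2 * τ + 1 + τ + p.length + k + i ≤ r →
      (prepRun q A G w p ρ r v).acc i ⊓ bestFrom w p ds dt i v ≤ best w p ds dt i := by
  induction k with
  | zero =>
    intro r v hv hr
    obtain rfl := h.connected.dist_eq_zero_iff.1 hv
    refine le_iInf fun z => h.up_le hi rfl (by simp) ?_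
    omega
  | succ k ih =>
    intro r v hv hr
    rw [SimpleGraph.dist_comm] at hv
    obtain ⟨y, hy, hys⟩ := exists_adj_dist h.connected hv
    rw [SimpleGraph.dist_comm] at hys
    have h4 := h.acc_le_of_slot (r := 2 * τ + 1 + τ + p.length + G.dist s y + i) (i := i) hy.symm
      ⟨hi, .inr rfl⟩
    refine inf_le_left.trans ((acc_anti (r := 2 * τ + 1 + τ + p.length + G.dist s y + i + 1)
      (by omega) v i).trans (h4.trans (ih hys (by omega))))

lemma bestKnown_eq (h : IsPrep q A G w p ρ ds dt τ) {i : ℕ} (hi : i < p.length) (v : Fin n) {r : ℕ}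
    (hr : 4 * τ + 2 * p.length + 1 ≤ r) :
    (prepRun q A G w p ρ r v).bestKnown A (localView G w v) i = best w p ds dt i := by
  rw [PrepState.bestKnown, h.localBest_eq (by omega) v hi]
  refine le_antisymm ?_ ((h.isDetourValue_acc r v i).inf (isDetourValue_bestFrom i v)).best_le
  have := h.dist_le v
  exact h.down_le hi rfl (by omega)

lemma prepOut_eq_none (h : IsPrep q A G w p ρ ds dt τ) {r : ℕ} (hr : r < 4 * τ + 2 * p.length + 1)
    (v : Fin n) : prepOut A (localView G w v) (prepRun q A G w p ρ r v) = none := by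
  have := h.pos
  rw [prepOut, prepRun_path, SimpleGraph.Walk.length_support, if_neg (by omega), prepRun_clock,
    Nat.add_sub_cancel]
  cases hst : (prepRun q A G w p ρ r v).start with
  | none => rfl
  | some τ' =>
    obtain rfl := h.start_eq_some hst
    rw [Option.bind_some, if_neg (by omega)]

lemma prepOut_eq (h : IsPrep q A G w p ρ ds dt τ) (v : Fin n) :
    prepOut A (localView G w v) (prepRun q A G w p ρ (4 * τ + 2 * p.length + 1) v) =
      some (p.edges.map (replacementWeight G w s t)) := by
  have := h.pos
  have hd := h.dist_le v
  rw [prepOut, prepRun_path, SimpleGraph.Walk.length_support, if_neg (by omega), prepRun_clock,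
    Nat.add_sub_cancel, h.start_eq (by omega), Option.bind_some, if_pos le_rfl, edges_eq_map_edgeAt,
    List.map_map]
  congr 1
  refine List.map_congr_left fun i hi => ?_
  rw [List.mem_range] at hi
  rw [h.bestKnown_eq hi v le_rfl, weightOf_best h.isShortestPath h.isDistS h.isDistT hi]
  rfl

end IsPrep

end Aggregate

/-! ### The knowledge of the nodes after the preprocessing -/

section Knowledge

variable {n b q : ℕ} {S : Type} (A : CongestAlg n b (Fin n × S) ℕ)

/-- Any neighbour that explains the distance may serve as parent. At `t` the field `own` is
meaningless, but it is consulted only by nodes with a successor. -/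
noncomputable def prepInfo (L : Local n) (σ : PrepState n b q A.State) : Info n where
  parS := pick fun y => ∃ a d d' m, (perturbLocal σ.path L).link y = some a ∧
    σ.outS A L = some d ∧ σ.inbox y = some m ∧ m.ds = some d' ∧ d'.val + a = d
  parT := pick fun y => ∃ a d d' m, (perturbLocal σ.path L).link y = some a ∧
    σ.outT A L = some d ∧ σ.inbox y = some m ∧ m.dt = some d' ∧ d'.val + a = d
  depS := hopOf n ((σ.outS A L).getD 0)
  depT := hopOf n ((σ.outT A L).getD 0)
  succ := pick fun y => ∃ i, σ.path[i]? = some L.id ∧ σ.path[i + 1]? = some y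
  own := (pick fun i => σ.path[i]? = some L.id).bind fun i => candOf L.id (σ.bestKnown A L i)
  len := σ.path.length - 1
  cand i := candOf L.id (σ.bestKnown A L i)
  maxHop := (Finset.range (σ.path.length - 1)).sup fun i => hopsOf n (σ.bestKnown A L i)

variable {A} {G : SimpleGraph (Fin n)} {w : Sym2 (Fin n) → ℕ} {s t : Fin n} {p : G.Walk s t}
  {ρ : Fin n → S} {ds dt : Fin n → ℕ} {τ : ℕ}

lemma IsPrep.isParentS (h : IsPrep q A G w p ρ ds dt τ) {r : ℕ} (hr : τ + 1 ≤ r) :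
    IsParent G (perturb w p.edges) s ds
      (fun v => (prepInfo A (localView G w v) (prepRun q A G w p ρ r v)).parS) := by
  have hspec : ∀ {x y}, (prepInfo A (localView G w x) (prepRun q A G w p ρ r x)).parS = some y →
      G.Adj x y ∧ ds y + perturb w p.edges s(x, y) = ds x := by
    intro x y hxy
    obtain ⟨a, d, d', m, h1, h2, h3, h4, h5⟩ := of_pick_eq_some hxy
    obtain ⟨hadj, hds, -⟩ := h.inbox_eq hr h3
    rw [h.outS_eq (by omega)] at h2
    obtain rfl := Option.some.inj h2
    rw [hds] at h4
    obtain rfl := Option.some.inj h4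
    rw [val_toNum (h.ds_lt y)] at h5
    rw [prepRun_path, perturbLocal_localView] at h1
    simp only [localView, if_pos hadj.symm] at h1
    rw [Option.some.inj h1]
    exact ⟨hadj.symm, h5⟩
  refine ⟨fun x => ⟨fun hnone => ?_, ?_⟩, fun hxy => (hspec hxy).1, fun hxy => (hspec hxy).2⟩
  · by_contra hx
    obtain ⟨y, hadj, hy⟩ := h.isDistS.exists_pred hx
    obtain ⟨m, hm⟩ := IsPrep.exists_inbox (q := q) (A := A) (w := w) (p := p) (ρ := ρ)
      (show 1 ≤ r by omega) hadj.symm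
    obtain ⟨-, hds, -⟩ := h.inbox_eq hr hm
    refine pick_eq_none.1 hnone y ⟨perturb w p.edges s(x, y), ds x, _, m, ?_,
      h.outS_eq (by omega) x, hm, hds, ?_⟩
    · rw [prepRun_path, perturbLocal_localView]
      simp [localView, hadj]
    · rw [val_toNum (h.ds_lt y), hy]
  · rintro rfl
    cases hx : (prepInfo A (localView G w x) (prepRun q A G w p ρ r x)).parS with
    | none => rfl
    | some y =>
      have h1 := (hspec hx).2
      have h2 := perturb_pos w p.edges s(x, y)
      rw [h.isDistS.source] at h1
      omega

lemma IsPrep.isParentT (h : IsPrep q A G w p ρ ds dt τ) {r : ℕ} (hr : τ + 1 ≤ r) :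
    IsParent G (perturb w p.edges) t dt
      (fun v => (prepInfo A (localView G w v) (prepRun q A G w p ρ r v)).parT) := by
  have hspec : ∀ {x y}, (prepInfo A (localView G w x) (prepRun q A G w p ρ r x)).parT = some y →
      G.Adj x y ∧ dt y + perturb w p.edges s(x, y) = dt x := by
    intro x y hxy
    obtain ⟨a, d, d', m, h1, h2, h3, h4, h5⟩ := of_pick_eq_some hxy
    obtain ⟨hadj, -, hdt⟩ := h.inbox_eq hr h3
    rw [h.outT_eq (by omega)] at h2
    obtain rfl := Option.some.inj h2
    rw [hdt] at h4
    obtain rfl := Option.some.inj h4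
    rw [val_toNum (h.dt_lt y)] at h5
    rw [prepRun_path, perturbLocal_localView] at h1
    simp only [localView, if_pos hadj.symm] at h1
    rw [Option.some.inj h1]
    exact ⟨hadj.symm, h5⟩
  refine ⟨fun x => ⟨fun hnone => ?_, ?_⟩, fun hxy => (hspec hxy).1, fun hxy => (hspec hxy).2⟩
  · by_contra hx
    obtain ⟨y, hadj, hy⟩ := h.isDistT.exists_pred hx
    obtain ⟨m, hm⟩ := IsPrep.exists_inbox (q := q) (A := A) (w := w) (p := p) (ρ := ρ)
      (show 1 ≤ r by omega) hadj.symm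
    obtain ⟨-, -, hdt⟩ := h.inbox_eq hr hm
    refine pick_eq_none.1 hnone y ⟨perturb w p.edges s(x, y), dt x, _, m, ?_,
      h.outT_eq (by omega) x, hm, hdt, ?_⟩
    · rw [prepRun_path, perturbLocal_localView]
      simp [localView, hadj]
    · rw [val_toNum (h.dt_lt y), hy]
  · rintro rfl
    cases hx : (prepInfo A (localView G w x) (prepRun q A G w p ρ r x)).parT with
    | none => rfl
    | some y =>
      have h1 := (hspec hx).2
      have h2 := perturb_pos w p.edges s(x, y)
      rw [h.isDistT.source] at h1
      omega

lemma support_getElem?_eq_some {i : ℕ} {x : Fin n} :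
    p.support[i]? = some x ↔ i ≤ p.length ∧ p.getVert i = x := by
  constructor
  · intro h
    obtain ⟨hi, h⟩ := List.getElem?_eq_some_iff.1 h
    rw [SimpleGraph.Walk.length_support] at hi
    exact ⟨by omega, by rw [p.getVert_eq_support_getElem (by omega), h]⟩
  · rintro ⟨hi, rfl⟩
    rw [p.getVert_eq_support_getElem? hi]

/-- After the preprocessing the nodes know a replacement path for every edge that has one. -/
lemma IsPrep.isPlan (h : IsPrep q A G w p ρ ds dt τ) :
    ∃ cand H, IsPlan w p (fun v => prepInfo A (localView G w v)
      (prepRun q A G w p ρ (4 * τ + 2 * p.length + 1) v)) cand H := by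
  have x₀ := s
  have hparS := h.isParentS (r := 4 * τ + 2 * p.length + 1) (by omega)
  have hparT := h.isParentT (r := 4 * τ + 2 * p.length + 1) (by omega)
  have hdepS : ∀ v, (prepInfo A (localView G w v)
      (prepRun q A G w p ρ (4 * τ + 2 * p.length + 1) v)).depS = hopOf n (ds v) := by
    intro v
    rw [prepInfo, h.outS_eq (by omega), Option.getD_some]
  have hdepT : ∀ v, (prepInfo A (localView G w v)
      (prepRun q A G w p ρ (4 * τ + 2 * p.length + 1) v)).depT = hopOf n (dt v) := by
    intro v
    rw [prepInfo, h.outT_eq (by omega), Option.getD_some]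
  have hinj := h.isShortestPath.1.getVert_injOn
  refine ⟨fun i => candOf x₀ (best w p ds dt i),
    (Finset.range p.length).sup fun i => hopsOf n (best w p ds dt i), ?_⟩
  constructor
  · simp only [hdepS]
    exact hparS.isForest h.isDistS
  · simp only [hdepT]
    exact hparT.isForest h.isDistT
  · intro v
    simp [prepInfo, prepRun_path]
  · intro v i hi
    simp only [prepInfo]
    rw [h.bestKnown_eq hi v le_rfl]
    rfl
  · intro v
    simp only [prepInfo, prepRun_path, SimpleGraph.Walk.length_support, Nat.add_sub_cancel]
    refine Finset.sup_congr rfl fun i hi => ?_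
    rw [h.bestKnown_eq (Finset.mem_range.1 hi) v le_rfl]
  · refine Finset.sup_le fun i hi => ?_
    rw [Finset.mem_range] at hi
    cases hc : candOf x₀ (best w p ds dt i) with
    | none =>
      unfold candOf at hc
      split_ifs at hc with htop
      simp [hopsOf, htop]
    | some uv =>
      obtain ⟨q', hq', -, hlen⟩ := exists_isDetour h.isShortestPath h.isDistS h.isDistT hparS hparT
        hi x₀ (u := uv.1) (v := uv.2) hc
      rw [hlen]
      exact hq'.isReplacementPath.length_le_hRep ((mem_edges_iff p).2 ⟨i, hi, rfl⟩)
  · intro x y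
    simp only [prepInfo, prepRun_path, support_getElem?_eq_some]
    have hid : (localView G w x).id = x := rfl
    rw [hid]
    constructor
    · intro hxy
      obtain ⟨i, ⟨-, h1⟩, h2, h3⟩ := of_pick_eq_some hxy
      exact ⟨i, h2, h1.symm, h3.symm⟩
    · rintro ⟨i, hi, rfl, rfl⟩
      refine pick_eq_some_of_unique ⟨i, ⟨hi.le, rfl⟩, hi, rfl⟩ ?_
      rintro y ⟨j, ⟨h1, h2⟩, h3, rfl⟩
      rw [hinj (by simpa using h1) (by simpa using hi.le) h2]
  · intro i hi
    simp only [prepInfo, prepRun_path, support_getElem?_eq_some]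
    have hpick : (pick fun j => j ≤ p.length ∧
        p.getVert j = (localView G w (p.getVert i)).id) = some i := by
      refine pick_eq_some_of_unique ⟨hi.le, rfl⟩ ?_
      rintro j ⟨h1, h2⟩
      exact hinj (by simpa using h1) (by simpa using hi.le) h2
    rw [hpick, Option.bind_some, h.bestKnown_eq hi _ le_rfl]
    rfl
  · intro i hi u v hc
    obtain ⟨q', hq', hsum, hlen⟩ := exists_isDetour h.isShortestPath h.isDistS h.isDistT hparS hparT
      hi x₀ hc
    refine ⟨q', hq', by rw [hdepS, hdepT, hsum], hlen ▸ ?_⟩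
    exact Finset.le_sup (f := fun i => hopsOf n (best w p ds dt i)) (Finset.mem_range.2 hi)
  · intro i hi hc
    rcases best_eq_top_or (w := w) (p := p) (ds := ds) (dt := dt) i with ⟨-, hno⟩ | ⟨x, y, -, hb, -⟩
    · exact not_isCand_of_forall_not h.isShortestPath h.isDistS h.isDistT hi hno
    · rw [hb, candOf_detourCode] at hc
      cases hc

end Knowledge

end RPaths

namespace RPaths

/-! ### Replacement paths from single source shortest paths -/

section Core

variable {n : ℕ} {G : SimpleGraph (Fin n)} {w : Sym2 (Fin n) → ℕ} {s t : Fin n}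

lemma weight_le_length_mul {M : ℕ} (hw : ∀ e ∈ G.edgeSet, w e ≤ M) (q : G.Walk s t) :
    weight w q ≤ q.length * M := by
  induction q with
  | nil => simp
  | cons h q ih =>
    rw [weight_cons, SimpleGraph.Walk.length_cons, add_mul, one_mul, add_comm]
    exact Nat.add_le_add ih (hw _ h)

lemma IsDist.le_mul {M : ℕ} {d : Fin n → ℕ} (hd : IsDist G w s d)
    (hw : ∀ e ∈ G.edgeSet, w e ≤ M) (v : Fin n) : d v ≤ (n - 1) * M := by
  obtain ⟨q, hq, hqd⟩ := hd v
  rw [← hqd]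
  have : q.length < n := by simpa using hq.1.length_lt
  exact (weight_le_length_mul hw q).trans (Nat.mul_le_mul_right _ (by omega))

lemma pow_le_two_pow (n m : ℕ) : n ^ m ≤ 2 ^ (m * wordLen n) := by
  have h := Nat.pow_le_pow_left (le_two_pow_wordLen n le_rfl) m
  rwa [one_mul, ← pow_mul, mul_comm] at h

lemma ComputesSSSP.exists_isDist {b : ℕ} {S : Type} {A : CongestAlg n b (Fin n × S) ℕ}
    {ρ : Fin n → S} {r : ℕ} (h : ComputesSSSP A G w s ρ r) :
    ∃ d, IsDist G w s d ∧ ∀ v, A.output G w (fun u => (s, ρ u)) r v = some (d v) := by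
  choose p hp hout using h
  exact ⟨fun v => weight w (p v), fun v => ⟨p v, hp v, rfl⟩, hout⟩

lemma dist_le_diam_of_connected (hG : G.Connected) (x y : Fin n) : G.dist x y ≤ G.diam := by
  have := hG.nonempty
  exact SimpleGraph.dist_le_diam (SimpleGraph.connected_iff_ediam_ne_top.1 hG)

/-- Detour lengths are below `n ^ (m + 2)`, being sums of two distances and one weight, and the edge
takes another factor `n ^ 2`; hence `m + 4` words. -/
lemma exists_isPrep {b m : ℕ} {S : Type} {A : CongestAlg n b (Fin n × S) ℕ} {p : G.Walk s t}
    {ρ : Fin n → S} {T : ℕ} (hG : G.Connected) (hp : IsShortestPath w p) (hpos : 0 < p.length)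
    (hw : ∀ e ∈ G.edgeSet, perturb w p.edges e ≤ n ^ m)
    (hs : ComputesSSSP A G (perturb w p.edges) s ρ T)
    (ht : ComputesSSSP A G (perturb w p.edges) t ρ T) :
    ∃ ds dt, ∃ τ ≤ T + 2 * G.diam + 1, IsPrep (m + 4) A G w p ρ ds dt τ := by
  obtain ⟨ds, hds, houts⟩ := hs.exists_isDist
  obtain ⟨dt, hdt, houtt⟩ := ht.exists_isDist
  obtain ⟨τ, hτ, hready⟩ := exists_isReady (q := m + 4) (A := A) (p := p) (w := w) (ρ := ρ) hG
    (by omega) (T := T) (D := G.diam) (dist_le_diam_of_connected hG s)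
    (fun r hr v => by rw [A.output_eq_of_le G _ _ (houts v) hr]; simp)
    (fun r hr v => by rw [A.output_eq_of_le G _ _ (houtt v) hr]; simp)
  have hn : 2 ≤ n := by
    have : p.length < n := by simpa using hp.1.length_lt
    omega
  obtain ⟨k, rfl⟩ : ∃ k, n = k + 1 := ⟨n - 1, by omega⟩
  have hM : 1 ≤ (k + 1) ^ m := Nat.one_le_pow _ _ (by omega)
  have hbig := pow_le_two_pow (k + 1) (m + 4)
  have hpow : (k + 1) ^ (m + 4) = (k + 1) ^ m * (k + 1) ^ 2 * (k + 1) ^ 2 := by ring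
  have hds' : ∀ v, ds v ≤ k * (k + 1) ^ m := hds.le_mul hw
  have hdt' : ∀ v, dt v ≤ k * (k + 1) ^ m := hdt.le_mul hw
  have hlt : k * (k + 1) ^ m < (k + 1) ^ (m + 4) := by
    rw [hpow]
    have : k < (k + 1) ^ 2 * (k + 1) ^ 2 := by
      rw [← pow_add]
      exact (Nat.lt_succ_self k).trans_le (Nat.le_self_pow (by omega) _)
    calc k * (k + 1) ^ m < ((k + 1) ^ 2 * (k + 1) ^ 2) * (k + 1) ^ m :=
          Nat.mul_lt_mul_of_pos_right this hM
      _ = _ := by ring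
  refine ⟨ds, dt, τ, hτ, hG, by omega, hpos, hp, hds, hdt,
    fun r v d h => A.output_eq_of_output G _ _ h (houts v),
    fun r v d h => A.output_eq_of_output G _ _ h (houtt v), hready,
    fun v => (hds' v).trans_lt (hlt.trans_le hbig), fun v => (hdt' v).trans_lt (hlt.trans_le hbig),
    fun x y hxy => lt_of_lt_of_le ?_ hbig⟩
  have h1 := hds' x
  have h2 := hdt' y
  have h3 := hw s(x, y) hxy
  have hl : detourLength w p ds dt x y + 1 ≤ (k + 1) ^ m * (k + 1) ^ 2 := by
    have : 2 * k + 2 ≤ (k + 1) ^ 2 := by nlinarith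
    have := Nat.mul_le_mul_left ((k + 1) ^ m) this
    rw [detourLength]
    nlinarith
  have hx := x.2
  have hy := y.2
  rw [hpow, detourCode]
  calc (detourLength w p ds dt x y * (k + 1) + x) * (k + 1) + y
      < (detourLength w p ds dt x y + 1) * (k + 1) ^ 2 := by nlinarith
    _ ≤ _ := Nat.mul_le_mul_right _ hl

lemma edges_eq_nil_of_length {p : G.Walk s t} (h : p.length = 0) : p.edges = [] :=
  List.eq_nil_of_length_eq_zero (by rw [p.length_edges, h])

/-- Replacement paths can be constructed with an algorithm for single source shortest paths. -/
lemma exists_rPathsConstruction (n b m : ℕ) {S In : Type} (A : CongestAlg n b (Fin n × S) ℕ)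
    (f : In → List (Fin n) × S) :
    ∃ (P : CongestAlg n (2 * b + 5 * (m + 4) + 9) In (List ℕ∞))
      (K : CongestAlg n (2 * b + 5 * (m + 4) + 9) P.State (List (Option (Fin n))))
      (R : OnTheFly n (2 * b + 5 * (m + 4) + 9) 16 P.State),
      ∀ (G : SimpleGraph (Fin n)), G.Connected → ∀ (w : Sym2 (Fin n) → ℕ) (s t : Fin n)
        (p : G.Walk s t), IsShortestPath w p → ∀ (ρ : Fin n → S) (inp : Fin n → In),
        (∀ v, f (inp v) = (p.support, ρ v)) →
        (∀ e ∈ G.edgeSet, perturb w p.edges e ≤ n ^ m) → ∀ T r₁ r₂ : ℕ,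
        ComputesSSSP A G (perturb w p.edges) s ρ T →
        ComputesSSSP A G (perturb w p.edges) t ρ T →
        (0 < p.length → 4 * T + 8 * G.diam + 2 * p.length + 5 ≤ r₁) →
        (0 < p.length → p.length + hRep w p ≤ r₂) →
        RPathsConstruction P K R G w p inp r₁ r₂ := by
  obtain ⟨enc, dec, hdec⟩ := (fits_prepMsg n b (m + 4)).exists_code
  obtain ⟨K, hK, hK0⟩ := exists_computesTables n (b := 2 * b + 5 * (m + 4) + 9) (by omega)
    (prepInfo (q := m + 4) A)
  obtain ⟨R, hR⟩ := exists_reroutesWithin n (b := 2 * b + 5 * (m + 4) + 9) (c := 16) (by omega)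
    le_rfl (prepInfo (q := m + 4) A)
  refine ⟨(prepProtocol A).toAlg enc dec (fun L x => prepInit A L (f x)) (prepOut A), K, R, ?_⟩
  intro G hG w s t p hp ρ inp hinp hw T r₁ r₂ hs ht hr₁ hr₂
  have hstart : (fun v => prepInit (q := m + 4) A (localView G w v) (f (inp v))) =
      fun v => prepInit A (localView G w v) (p.support, ρ v) := by
    funext v
    rw [hinp v]
  rcases Nat.eq_zero_or_pos p.length with h0 | hpos
  · have hnil := edges_eq_nil_of_length h0
    have hpath : ∀ v, (prepInit (q := m + 4) A (localView G w v) (f (inp v))).path = p.support :=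
      fun v => by rw [hinp v]; rfl
    refine ⟨0, Nat.zero_le _, ⟨fun v => ?_, fun r hr => absurd hr (by omega)⟩,
      ⟨fun _ _ => none, fun e he => ?_, fun v => ?_⟩, fun e he => ?_⟩
    · change prepOut A (localView G w v) (prepInit A (localView G w v) (f (inp v))) = _
      rw [prepOut, hpath, if_pos (by rw [p.length_support, h0]), hnil]
      rfl
    · simp [hnil] at he
    · rw [hnil, List.map_nil]
      refine hK0 G w _ r₂ v ?_ ?_
      · change (prepInfo A (localView G w v)
          (prepInit A (localView G w v) (f (inp v)))).len = 0
        rw [prepInfo, hpath, p.length_support, h0]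
      · change (prepInfo A (localView G w v)
          (prepInit A (localView G w v) (f (inp v)))).maxHop = 0
        rw [prepInfo, hpath, p.length_support, h0]
        rfl
    · simp [hnil] at he
  · obtain ⟨ds, dt, τ, hτ, hprep⟩ := exists_isPrep hG hp hpos hw hs ht
    have hst : ∀ r ≤ 4 * τ + 2 * p.length + 1,
        ((prepProtocol A).toAlg enc dec (fun L x => prepInit A L (f x)) (prepOut A)).states
          G w inp r = prepRun (m + 4) A G w p ρ r := by
      intro r hr
      refine ((prepProtocol A).states_toAlg hdec G w inp (τ := 4 * τ + 2 * p.length + 1)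
        (fun r hr v => ?_) hr).trans (by rw [hstart]; rfl)
      rw [hstart]
      exact hprep.prepOut_eq_none hr v
    obtain ⟨cand, H, hplan⟩ := hprep.isPlan
    have hr₁' := hr₁ hpos
    have hr₂' := hr₂ hpos
    have hH := hplan.maxHop_le
    refine ⟨4 * τ + 2 * p.length + 1, by omega, ⟨fun v => ?_, fun r hr v => ?_⟩, ?_, ?_⟩
    · rw [CongestAlg.output, hst _ le_rfl]
      exact hprep.prepOut_eq v
    · rw [CongestAlg.output, hst _ hr.le]
      exact hprep.prepOut_eq_none hr v
    · rw [hst _ le_rfl]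
      exact hK G w s t p _ cand H hp.1 hplan r₂ (by omega)
    · rw [hst _ le_rfl]
      exact hR G w s t p _ cand H hp.1 hplan

end Core

/-! ### Breadth first search -/

section BFS

variable {n : ℕ} {G : SimpleGraph (Fin n)} {s t : Fin n}

structure BfsState where
  val : Option ℕ
  old : Bool

open Classical in
/-- Every node takes the best distance offered in the first round in which it gets an offer, and
sends it to its neighbours in the next round. -/
noncomputable def bfs (n q : ℕ) : CongestAlg n q (Fin n × Unit) ℕ where
  State := BfsState
  init L x := ⟨if L.id = x.1 then some 0 else none, false⟩
  code :=
    { send := fun _ σ _ => if σ.old then none else σ.val.map (BitVec.ofNat _)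
      recv := fun L σ m => if σ.old then σ else
        if σ.val ≠ none then ⟨σ.val, true⟩ else
        ⟨if ∃ u, m u ≠ none then
          some (sInf {x | ∃ u k a, m u = some k ∧ L.link u = some a ∧ x = k.toNat + a})
          else none, false⟩ }
  out _ σ := if σ.old then σ.val else none
  silent_of_out L σ h u := if_pos (by by_contra h'; exact h (if_neg h'))
  stay_of_out L σ h m := if_pos (by by_contra h'; exact h (if_neg h'))

lemma weight_one (q : G.Walk s t) : weight (fun _ => 1) q = q.length := by
  induction q with
  | nil => rfl
  | cons h q ih => rw [weight_cons, ih, SimpleGraph.Walk.length_cons, add_comm]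

lemma IsShortestPath.length_eq_dist (hG : G.Connected) {q : G.Walk s t}
    (hq : IsShortestPath (fun _ => 1) q) : q.length = G.dist s t := by
  obtain ⟨q', hq'⟩ := hG.exists_walk_length_eq_dist s t
  have := hq.le_weight q'
  rw [weight_one, weight_one] at this
  have := G.dist_le q
  omega

lemma hopOf_eq_dist (hG : G.Connected) {E : List (Sym2 (Fin n))} {d : Fin n → ℕ}
    (hd : IsDist G (perturb (fun _ => 1) E) s d) (v : Fin n) : hopOf n (d v) = G.dist s v := by
  obtain ⟨q, hq, -⟩ := hd v
  rw [hopOf_eq_length hd hq, (isShortestPath_of_perturb E hq).length_eq_dist hG]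

lemma exists_isDist (hG : G.Connected) {w : Sym2 (Fin n) → ℕ} (hw : ∀ e, 0 < w e) (s : Fin n) :
    ∃ d, IsDist G w s d := by
  have : ∀ v, ∃ q : G.Walk s v, ∀ q' : G.Walk s v, weight w q ≤ weight w q' := by
    intro v
    have : Nonempty (G.Walk s v) := hG.preconnected s v
    exact ⟨Function.argmin (weight w (s := s) (t := v)), fun q' => Function.argmin_le _ q'⟩
  choose q hq using this
  exact ⟨fun v => weight w (q v), fun v => ⟨q v, isShortestPath_of_le hw (hq v), rfl⟩⟩

open Classical in
-- For unit weights a perturbed shortest path is hop-shortest, so the predecessor of a node on it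
-- lies in the previous layer. All offers of that layer arrive in the same round, and their minimum
-- is the distance.
lemma bfs_states (hG : G.Connected) {q : ℕ} {E : List (Sym2 (Fin n))} {d : Fin n → ℕ}
    (hd : IsDist G (perturb (fun _ => 1) E) s d) (hlt : ∀ v, d v < 2 ^ (q * wordLen n)) (r : ℕ)
    (v : Fin n) :
    (bfs n q).states G (perturb (fun _ => 1) E) (fun _ => (s, ())) r v =
      ⟨if G.dist s v ≤ r then some (d v) else none, decide (G.dist s v < r)⟩ := by
  induction r generalizing v with
  | zero =>
    have : (localView G (perturb (fun _ => 1) E) v).id = v := rfl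
    simp only [CongestAlg.states, Protocol.run, bfs, this]
    by_cases hv : v = s
    · subst hv
      simp [hd.source]
    · have : G.dist s v ≠ 0 := fun h => hv (hG.dist_eq_zero_iff.1 h).symm
      simp [hv, this]
  | succ r ih =>
    change (bfs n q).code.recv (localView G (perturb (fun _ => 1) E) v)
      ((bfs n q).states G (perturb (fun _ => 1) E) (fun _ => (s, ())) r v)
      (fun u => if G.Adj u v then (bfs n q).code.send (localView G (perturb (fun _ => 1) E) u)
        ((bfs n q).states G (perturb (fun _ => 1) E) (fun _ => (s, ())) r u) v else none) = _
    have hm : ∀ u, (if G.Adj u v then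
        (bfs n q).code.send (localView G (perturb (fun _ => 1) E) u)
          ((bfs n q).states G (perturb (fun _ => 1) E) (fun _ => (s, ())) r u) v else none) =
        if G.Adj u v ∧ G.dist s u = r then some (BitVec.ofNat _ (d u)) else none := by
      intro u
      rw [ih u]
      by_cases huv : G.Adj u v
      · rcases lt_trichotomy (G.dist s u) r with h | h | h
        · simp [bfs, h, h.ne]
        · simp [bfs, h, huv]
        · simp [bfs, h.not_gt, h.not_ge, h.ne']
      · simp [huv]
    simp only [hm, ih v]
    rcases lt_trichotomy (G.dist s v) r with h | h | h
    · simp [bfs, h, h.le, h.le.trans (Nat.le_succ r), h.trans (Nat.lt_succ_self r)]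
    · simp [bfs, h]
    · have hval : ∀ u, (BitVec.ofNat (q * wordLen n) (d u)).toNat = d u := fun u =>
        (BitVec.toNat_ofNat _ _).trans (Nat.mod_eq_of_lt (hlt u))
      have hlink : ∀ u a, (localView G (perturb (fun _ => 1) E) v).link u = some a ↔
          G.Adj v u ∧ perturb (fun _ => 1) E s(v, u) = a := by
        intro u a
        simp [localView]
      have hset : {x | ∃ u k a, (if G.Adj u v ∧ G.dist s u = r then
          some (BitVec.ofNat (q * wordLen n) (d u)) else none) = some k ∧
          (localView G (perturb (fun _ => 1) E) v).link u = some a ∧ x = k.toNat + a} =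
          {x | ∃ u, G.Adj v u ∧ G.dist s u = r ∧ x = d u + perturb (fun _ => 1) E s(v, u)} := by
        ext x
        simp only [Set.mem_ofPred_eq, hlink]
        constructor
        · rintro ⟨u, k, a, h1, ⟨h2, rfl⟩, rfl⟩
          obtain ⟨⟨-, h3⟩, rfl⟩ : (G.Adj u v ∧ G.dist s u = r) ∧ BitVec.ofNat _ (d u) = k := by
            simpa using h1
          exact ⟨u, h2, h3, by rw [hval]⟩
        · rintro ⟨u, h1, h2, rfl⟩
          exact ⟨u, _, _, if_pos ⟨h1.symm, h2⟩, ⟨h1, rfl⟩, by rw [hval]⟩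
      have hrecv : ∀ m, (bfs n q).code.recv (localView G (perturb (fun _ => 1) E) v)
          ⟨none, false⟩ m = ⟨if ∃ u, m u ≠ none then
          some (sInf {x | ∃ u k a, m u = some k ∧
            (localView G (perturb (fun _ => 1) E) v).link u = some a ∧ x = k.toNat + a})
          else none, false⟩ := fun m => by simp [bfs]
      simp only [if_neg h.not_ge, h.not_gt, decide_false]
      rw [hrecv, hset]
      have hdec : decide (G.dist s v < r + 1) = false := decide_eq_false (by omega)
      rw [hdec]
      by_cases h1 : G.dist s v = r + 1
      · obtain ⟨y, hy, hys⟩ := exists_adj_dist hG ((SimpleGraph.dist_comm).trans h1)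
        rw [SimpleGraph.dist_comm] at hys
        rw [if_pos h1.le, if_pos ⟨y, by rw [if_pos ⟨hy.symm, hys⟩]; simp⟩]
        congr 2
        refine le_antisymm (Nat.sInf_le ?_) (le_csInf ⟨_, y, hy, hys, rfl⟩ ?_)
        · have hv : v ≠ s := by
            rintro rfl
            simp at h1
          obtain ⟨u, huv, hu⟩ := hd.exists_pred hv
          have := hopOf_succ hd huv hu
          rw [hopOf_eq_dist hG hd, hopOf_eq_dist hG hd] at this
          exact ⟨u, huv, by omega, hu.symm⟩
        · rintro _ ⟨u, huv, -, rfl⟩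
          rw [Sym2.eq_swap]
          exact hd.le_add huv.symm
      · rw [if_neg (show ¬ G.dist s v ≤ r + 1 by omega), if_neg]
        rintro ⟨u, hu⟩
        obtain ⟨h2, h3⟩ : G.Adj u v ∧ G.dist s u = r := by simpa using hu
        have := dist_le_succ_of_adj hG h2 s
        omega

lemma bfs_computesSSSP (hG : G.Connected) {q : ℕ} {E : List (Sym2 (Fin n))}
    (hw : ∀ e ∈ G.edgeSet, perturb (fun _ => 1) E e ≤ n ^ q) (s : Fin n) (ρ : Fin n → Unit) :
    ComputesSSSP (bfs n (q + 1)) G (perturb (fun _ => 1) E) s ρ (G.diam + 1) := by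
  obtain ⟨d, hd⟩ := exists_isDist hG (perturb_pos (fun _ => 1) E) s
  have hlt : ∀ v, d v < 2 ^ ((q + 1) * wordLen n) := by
    intro v
    refine lt_of_lt_of_le ((hd.le_mul hw v).trans_lt ?_) (pow_le_two_pow n (q + 1))
    have := v.pos
    rw [pow_succ']
    exact Nat.mul_lt_mul_of_pos_right (by omega) (Nat.pow_pos this)
  intro v
  obtain ⟨p, hp, hpd⟩ := hd v
  refine ⟨p, hp, ?_⟩
  have := dist_le_diam_of_connected hG s v
  rw [CongestAlg.output, bfs_states hG hd hlt, hpd]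
  simp [bfs]
  omega

end BFS

end RPaths

namespace RPaths

/-! ### Size of the perturbed weights, and hop bound for unweighted detours -/

section Bounds

variable {n : ℕ} {G : SimpleGraph (Fin n)} {w : Sym2 (Fin n) → ℕ} {s t : Fin n}

lemma perturb_le (hn : 2 ≤ n) {k : ℕ} {E : List (Sym2 (Fin n))} {e : Sym2 (Fin n)}
    (h : w e ≤ n ^ k) : perturb w E e ≤ n ^ (k + 4) := by
  have h1 : 1 ≤ n ^ k := Nat.one_le_pow _ _ (by omega)
  have h2 : n * (if e ∈ E then 0 else 1) ≤ n := by split_ifs <;> simp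
  have h3 := Nat.mul_le_mul_left (n ^ 2) h
  have h4 : n ^ 2 + n + 1 ≤ n ^ 4 := by
    have h5 : 2 * n ≤ n ^ 2 := by nlinarith
    have h6 : n ^ 4 = n ^ 2 * n ^ 2 := by ring
    nlinarith [Nat.mul_le_mul_right (n ^ 2) (show 4 ≤ n ^ 2 by nlinarith)]
  calc perturb w E e ≤ n ^ 2 * n ^ k + n + 1 := by unfold perturb; omega
    _ ≤ n ^ k * (n ^ 2 + n + 1) := by nlinarith
    _ ≤ n ^ k * n ^ 4 := Nat.mul_le_mul_left _ h4
    _ = n ^ (k + 4) := (pow_add _ _ _).symm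

lemma two_le_of_adj {x y : Fin n} (h : G.Adj x y) : 2 ≤ n := by
  have := x.2
  have := y.2
  have : (x : ℕ) ≠ y := fun hxy => h.ne (Fin.ext hxy)
  omega

lemma perturb_le_of_mem (E : List (Sym2 (Fin n))) {k : ℕ} (h : ∀ e ∈ G.edgeSet, w e ≤ n ^ k) :
    ∀ e ∈ G.edgeSet, perturb w E e ≤ n ^ (k + 4) := by
  intro e he
  refine perturb_le ?_ (h e he)
  induction e with
  | _ x y => exact two_le_of_adj (G.mem_edgeSet.1 he)

/-- If a replacement path exists, so does a candidate edge, and its detour consists of two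
hop-shortest paths and one edge. -/
lemma hRep_one_le (hG : G.Connected) {p : G.Walk s t} (hp : IsShortestPath (fun _ => 1) p) :
    hRep (fun _ => 1) p ≤ 2 * G.diam + 1 := by
  refine csSup_le' ?_
  rintro _ ⟨e, he, q, hq, rfl⟩
  obtain ⟨i, hi, rfl⟩ := (mem_edges_iff p).1 he
  obtain ⟨ds, hs⟩ := exists_isDist hG (perturb_pos (fun _ => 1) p.edges) s
  obtain ⟨dt, ht⟩ := exists_isDist hG (perturb_pos (fun _ => 1) p.edges) t
  obtain ⟨u, v, huv, -⟩ := exists_isCand_le hp hs ht hi q hq.2.1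
  obtain ⟨qs, hqs, -⟩ := hs u
  obtain ⟨qt, hqt, -⟩ := ht v
  have hne := huv.notMem_edges hp hs ht hi hqs hqt
  have hle := hq.2.2 _ (SimpleGraph.Walk.bypass_isPath _)
    fun hm => hne (SimpleGraph.Walk.edges_bypass_subset_edges _ hm)
  have h1 := (SimpleGraph.Walk.length_bypass_le_length (qs.append (.cons huv.1 qt.reverse)))
  have h2 := (isShortestPath_of_perturb _ hqs).length_eq_dist hG
  have h3 := (isShortestPath_of_perturb _ hqt).length_eq_dist hG
  have h4 := dist_le_diam_of_connected hG s u
  have h5 := dist_le_diam_of_connected hG t v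
  rw [weight_one, weight_one] at hle
  simp only [SimpleGraph.Walk.length_append, SimpleGraph.Walk.length_cons,
    SimpleGraph.Walk.length_reverse] at h1
  omega

end Bounds

end RPaths

theorem mainTheorem9 :
    -- weighted graphs, relative to an arbitrary algorithm `A` for SSSP
    (∀ k : ℕ, ∃ k' : ℕ, ∀ b : ℕ, ∃ b' C c : ℕ,
      ∀ (S : ℕ → Type) [∀ n, MeasurableSpace (S n)]
        (μ : ∀ n, MeasureTheory.Measure (Fin n → S n))
        [∀ n, MeasureTheory.IsProbabilityMeasure (μ n)]
        (A : ∀ n, RPaths.CongestAlg n b (Fin n × S n) ℕ) (T : ℕ → ℕ → ℕ) (ε : ℕ → ENNReal),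
        RPaths.SolvesSSSP k' b S μ A T ε →
        ∃ (P : ∀ n, RPaths.CongestAlg n b' (List (Fin n) × S n) (List ℕ∞))
          (K : ∀ n, RPaths.CongestAlg n b' (P n).State (List (Option (Fin n))))
          (R : ∀ n, RPaths.OnTheFly n b' c (P n).State),
          ∀ (n : ℕ) (G : SimpleGraph (Fin n)), G.Connected →
          ∀ w : Sym2 (Fin n) → ℕ, (∀ e ∈ G.edgeSet, w e ≤ n ^ k) →
          ∀ (s t : Fin n) (p : G.Walk s t), RPaths.IsShortestPath w p →
            μ n {ρ | ¬ RPaths.RPathsConstruction (P n) (K n) (R n) G w p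
              (fun v => (p.support, ρ v))
              (C * (T n G.diam + G.diam + p.length))
              (C * (p.length + RPaths.hRep w p))} ≤ 2 * ε n) ∧
    -- unweighted graphs
    (∃ (b' C c : ℕ)
      (P : ∀ n, RPaths.CongestAlg n b' (List (Fin n)) (List ℕ∞))
      (K : ∀ n, RPaths.CongestAlg n b' (P n).State (List (Option (Fin n))))
      (R : ∀ n, RPaths.OnTheFly n b' c (P n).State),
      ∀ (n : ℕ) (G : SimpleGraph (Fin n)), G.Connected →
      ∀ (s t : Fin n) (p : G.Walk s t), RPaths.IsShortestPath (fun _ => 1) p →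
        RPaths.RPathsConstruction (P n) (K n) (R n) G (fun _ => 1) p (fun _ => p.support)
          (C * G.diam) (C * G.diam)) := by
  -- Perturbed weights are at most `n ^ (k + 4)`. The preprocessing needs `4 T + 8 D + 2 h + 5`
  -- rounds, which is at most `8 (T + D + h)` because `h` is positive in the nontrivial case.
  refine ⟨fun k => ⟨k + 4, fun b => ⟨2 * b + 5 * (k + 4 + 4) + 9, 8, 16, ?_⟩⟩, ?_⟩
  · intro S _ μ _ A T ε hA
    choose P K R h using fun n => RPaths.exists_rPathsConstruction n b (k + 4) (A n) id
    refine ⟨P, K, R, fun n G hG w hw s t p hp => ?_⟩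
    have hw' := RPaths.perturb_le_of_mem p.edges hw
    -- A failure requires one of the two runs to fail. The union bound needs no independence, so
    -- both runs may share their random strings.
    refine (MeasureTheory.measure_mono (fun ρ hρ => ?_)).trans
      ((MeasureTheory.measure_union_le _ _).trans ((add_le_add (hA n G hG _ hw' s) (hA n G hG _ hw' t)).trans_eq (two_mul _).symm))
    by_contra hnot
    rw [Set.mem_union, not_or] at hnot
    simp only [Set.mem_ofPred_eq, not_not] at hnot
    refine hρ (h n G hG w s t p hp ρ _ (fun _ => rfl) hw' _ _ _ hnot.1 hnot.2 ?_ ?_)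
    · intro hpos
      omega
    · intro hpos
      omega
  -- Perturbed unit weights are at most `n ^ 4`, so distances fit into five words.
  · choose P K R h using fun n => RPaths.exists_rPathsConstruction n 5 4 (RPaths.bfs n 5)
      (fun l : List (Fin n) => (l, ()))
    -- With `T = D + 1` and `h ≤ D` the preprocessing takes at most `14 D + 9` rounds and the tables
    -- at most `3 D + 1`; both are below `32 D`, since a path with an edge forces `D ≥ 1`.
    refine ⟨2 * 5 + 5 * (4 + 4) + 9, 32, 16, P, K, R, fun n G hG s t p hp => ?_⟩
    have hw := RPaths.perturb_le_of_mem (G := G) (w := fun _ => 1) p.edges (k := 0)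
      (fun _ _ => by simp)
    have hlen := hp.length_eq_dist hG
    have hdiam := RPaths.dist_le_diam_of_connected hG s t
    have hrep := RPaths.hRep_one_le hG hp
    refine h n G hG _ s t p hp (fun _ => ()) _ (fun _ => rfl) hw (G.diam + 1) _ _
      (RPaths.bfs_computesSSSP hG hw s _) (RPaths.bfs_computesSSSP hG hw t _) ?_ ?_
    · intro hpos
      omega
    · intro hpos
      omega
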